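/- **Soundness of the tagged Hoare logic $\mathcal H$ for the dynamically typed object-oriented language dyn.** *Language.* Expressions and statements of dyn are $e ::= \mathsf{null} \mid u \mid @x \mid \mathbf{this} \mid e == e \mid e\ \mathsf{is\_a?}\ C \mid e.m(\vec e) \mid \mathsf{new}\ C(\vec e) \mid u := e \mid @x := e \mid \mathsf{if}\ e\ \mathsf{then}\ s\ \mathsf{else}\ s\ \mathsf{end} \mid \mathsf{while}\ e\ \mathsf{do}\ s\ \mathsf{done}$ and $s ::= s;s \mid e$. A program $\pi$ assigns to each class $C$ its methods, at most one $\mathbf{method}\ m(u_1,\dots,u_n)\{s\}$ (distinct $u_i$) for each name and arity. Literals are sugar: $\mathit{false}\equiv \mathsf{new}\ bool(\mathsf{null})$, $\mathit{true}\equiv \mathit{false}.not()$. Auxiliary statements are the empty program $\mathbf r$, object activation $\mathsf{new}_C$, parallel assignment $\vec u:=\vec t$, and $\mathsf{begin\ local}\ \vec u:=\vec t; s\ \mathsf{end}$. *States.* Values are objects: $\mathit{null}$, the mark $\odot$ of a non-existing variable, one object $\theta_C$ per class, and objects $o_0,o_1,\dots$. A state gives values to $\mathbf{this}$, the local variables,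 the result variable $\mathbf r$, and the instance variables of each object, including the hidden $@\mathbf c$ (the class). Dereferencing $\mathit{null}$ or $\odot$ gives $\mathit{null}$. An $o_k$ is inactive if $o_k.@\mathbf c=\mathit{null}$; all other objects exist. States are consistent: no variable and no instance variable of an existing object refers to an inactive object. *Operational semantics.* Every expression leaves its value in $\mathbf r$; the rules evaluate subexpressions from left to right by premises $\langle e,\sigma\rangle\to^*\langle\mathbf r,\tau\rangle$. Reading a variable with value $\odot$ gives $\mathbf{typeerror}$; a condition that is $\mathit{null}$ gives $\mathbf{fail}$, and one that is neither $\mathit{null}$ nor of class $bool$ gives $\mathbf{typeerror}$; a call gives, right after the evaluation of its receiver, $\mathbf{fail}$ if the receiver is $\mathit{null}$ and $\mathbf{typeerror}$ if its class has no method of that name and arity; otherwise it runs $\mathsf{begin\ local}\ \mathbf{this},\vec u:=\dots; s\ \mathsf{end}$ with the body $s$ of that method, which sets all other local variables to $\odot$ and restores all of them at the end. While-loops unfold to conditionals, $\mathsf{new}\ C(\vec e)$ to $\mathsf{new}_C.init(\vec e)$; $\mathsf{new}_C$ activates the inactive object of least index with $@\mathbf c=\theta_C$ and all other instance variables $\odot$;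 $==$ and $\mathsf{is\_a?}$ continue with the literal for their truth value. An assignment to $@x$ needs a $\mathbf{this}$ other than $\mathit{null},\odot$. Errors and divergence in the evaluation of a subexpression are errors and divergence of the whole statement. *Tagged triples.* Tags are $\mathbf{terminates},\mathbf{typesafe},\mathbf{failsafe}$ with error states $\bot,\mathbf{typeerror},\mathbf{fail}$. $\mathcal M_{tags}[\![s]\!](\sigma)$ consists of the final states of the computations of $s$ from $\sigma$ and, for each tag in $tags$, its error state if some computation diverges, ends in $\mathbf{typeerror}$, ends in $\mathbf{fail}$, respectively. Assertions are formulas over typed logical expressions (types: naturals, objects, booleans, strings, and finite sequences of these; logical and program variables, $l.@x$, conditionals, constants, arithmetic, boolean and sequence operations), built from equations, class membership $[\![l]\!]\in\{C_1,\dots,C_k\}$, negation, conjunction, quantification over finite sequences of (existing) values, and tags; the atom $\mathbf{tag}$ is true under $tags$ iff $\mathbf{tag}\in tags$. Let $[\![p]\!]_{tags}$ be the set of states satisfying $p$ under $tags$. Then $\models\{p\}s\{tags\wedge q\}$ iff, for all values of the logical variables (denoting existing objects), $\mathcal M_{tags}[\![s]\!]([\![p]\!]_{tags})\subseteq[\![q]\!]_{tags}$.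 Write $bool(l)\equiv l\neq null\wedge l.@\mathbf c=\theta_{bool}$, $bool(l,b)\equiv bool(l)\wedge(b\leftrightarrow l.@to\_ref\neq null)$ and $G(l,a)\equiv(\mathbf{failsafe}\to l\neq null)\wedge(\mathbf{typesafe}\to(l\neq null\to a))$. A side condition $p\to q$ of a rule is semantic truth under the tags of the triple. *Proof system $\mathcal H$.* Substitutions are capture-avoiding and recursive; $[\mathbf{this}.@x:=\mathbf r]$ and $[\mathbf r:=\mathsf{new}_C]$ take aliasing, respectively references and quantified sequences containing the new object, into account. $changed(s)$ consists of $\mathbf r$, the variables assigned in $s$, and the instance variables assigned in methods of $\pi$. The rules are: - VAR $\{p[\mathbf r:=v]\}\,v\,\{p\}$; VAR-TAG $\{\mathbf{typesafe}\to v\ne\odot\}\,v\,\{tags\}$; IVAR, IVAR-TAG likewise with $\mathbf{this}.@x$; CONST $\{p[\mathbf r:=null]\}\,\mathsf{null}\,\{tags\wedge p\}$; PASGN $\{p[\vec u:=\vec t]\}\,\vec u:=\vec t\,\{tags\wedge p\}$; NEW $\{p[\mathbf r:=\mathsf{new}_C]\}\,\mathsf{new}_C\,\{tags\wedge p\}$.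 - EQUAL $\{\mathbf{typesafe}\to u_0\neq\odot\wedge u_1\neq\odot\}\,u_0==u_1\,\{tags\wedge bool(\mathbf r,u_0=u_1)\}$; IS_A $\{\mathbf{typesafe}\to u\neq\odot\}\,u\ \mathsf{is\_a?}\ C\,\{tags\wedge bool(\mathbf r,[\![u]\!]\in\{C\})\}$. - ASGN: from $\{p\}e\{tags\wedge q[v:=\mathbf r]\}$ infer $\{p\}v:=e\{tags\wedge q\}$. SEQ: the usual rule. CNST: from $\{p\}\mathsf{new}_C.init(\vec e)\{tags\wedge q\}$ infer $\{p\}\mathsf{new}\ C(\vec e)\{tags\wedge q\}$. - COND: from $\{p\}e\{tags\wedge r\wedge G(\mathbf r,bool(\mathbf r))\}$, $\{r\wedge bool(\mathbf r,true)\}s_1\{tags\wedge q\}$, $\{r\wedge bool(\mathbf r,false)\}s_2\{tags\wedge q\}$ infer $\{p\}\,\mathsf{if}\ e\ \mathsf{then}\ s_1\ \mathsf{else}\ s_2\ \mathsf{end}\,\{tags\wedge q\}$. - LOOP: from $\{p\}e\{tags\wedge p'\wedge G(\mathbf r,bool(\mathbf r))\}$, $\{p'\wedge bool(\mathbf r,true)\}s\{tags\wedge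 p\}$ and $\{p'\wedge bool(\mathbf r,true)\wedge r(z)\}\,s;e\,\{tags\wedge p'\wedge(\mathbf{terminates}\to\forall z':\mathbb N.\ r(z')\to z'<z)\}$ infer $\{p\}\,\mathsf{while}\ e\ \mathsf{do}\ s\ \mathsf{done}\,\{tags\wedge\exists b.\ p'[\mathbf r:=b]\wedge bool(b,false)\wedge\mathbf r=null\}$, where $z:\mathbb N$ is not free in $p,p'$, is not currently treated as a constant, and $p'\to\exists z':\mathbb N.\ r(z')$. - CONS: from $\{p_1\}s\{tags'\wedge q_1\}$ infer $\{p\}s\{tags\wedge q\}$ if $tags\subseteq tags'$, $[\![p]\!]_{tags}\subseteq[\![p_1]\!]_{tags'}$ and $[\![q_1]\!]_{tags'}\subseteq[\![q]\!]_{tags}$. - BLCK: from $\{p\}\vec u\,\vec{\bar u}:=\vec t\,\vec\odot;s\{tags\wedge q\}$ infer $\{p\}\,\mathsf{begin\ local}\ \vec u:=\vec t;s\ \mathsf{end}\,\{tags\wedge q\}$, where $\vec{\bar u}$ are the local variables not in $\vec u$, and $q$ mentions none of $\vec u,\vec{\bar u}$. - METH: from $\{p_0\}e_0\{tags\wedge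 p_1[v_0:=\mathbf r]\wedge G(\mathbf r,[\![\mathbf r]\!]\in\{C_1,\dots,C_k\})\}$ with classes $C_j$ that have a method $m$ of arity $n$, $\{p_i\}e_i\{tags\wedge p_{i+1}[v_i:=\mathbf r]\}$ ($1\le i\le n$) and $\{p_{n+1}\}v_0.m(v_1,\dots,v_n)\{tags\wedge q\}$ infer $\{p_0\}e_0.m(e_1,\dots,e_n)\{tags\wedge q\}$, where the $v_i$ are distinct local variables occurring neither in $q$ nor in any $e_j$. - REC: let $\{p_i\}l_i.m_i(\vec v_i)\{tags_i\wedge q_i\}$ ($1\le i\le n$) be triples for calls whose receivers and arguments are variables or $\mathsf{null}$, let $\mathbf{method}\ m_i(\vec u_i)\{s_i\}$ be a method of the class $C_i$, and suppose, under $tags_i$, that $p_i\to G(l_i,\,l_i.@\mathbf c=\theta_{C_i})$, that $p_i\to(\mathbf{typesafe}\to(l_i\neq null\to v\neq\odot))$ for each argument $v$, that $p_i\to\neg[\![l_i]\!]\in\{D\}$ for every other class $D$ having a method of the name and arity of $m_i$, and that $p_i\to\exists z':\mathbb N.\ r_i(z')$. If $T$ is derivable from the current assumptions together with these triples, and each $\{p_i\wedge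 r_i(z)\}\,\mathsf{begin\ local}\ \mathbf{this},\vec u_i:=l_i,\vec v_i;s_i\ \mathsf{end}\,\{tags_i\wedge q_i\}$ is derivable from the current assumptions together with the triples $\{p_j\wedge(\mathbf{terminates}\to\forall z':\mathbb N.\ r_j(z')\to z'<z)\}\,l_j.m_j(\vec v_j)\,\{tags_j\wedge q_j\}$, with $z$ treated as a constant ($z$ new, not free in $p_i,q_i$), then $T$ is derivable from the current assumptions. - DISJ: the usual rule. CONJ: from $\{p_1\}s\{tags\wedge q_1\}$, $\{p_2\}s\{tags'\wedge q_2\}$ infer $\{p_1\wedge p_2\}s\{(tags\cup tags')\wedge q_1\wedge q_2\}$, if no tag of $tags'\setminus tags$ occurs in $p_1,q_1$ and none of $tags\setminus tags'$ in $p_2,q_2$. - $\exists$-INT: from $\{p\}s\{tags\wedge q\}$ infer $\{\exists x.p\}s\{tags\wedge q\}$ for a logical variable $x$ not free in $q$ and not treated as a constant. - INV: from $\{r\}s\{tags\wedge q\}$ infer $\{p\wedge r\}s\{tags\wedge p\wedge q\}$ if no free variable of $p$ is in $changed(s)$ and $p$ does not quantify over objects. - SUBST: from $\{p\}s\{tags\wedge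 q\}$ infer $\{p[\vec z:=\vec t]\}s\{tags\wedge q[\vec z:=\vec t]\}$ if the $\vec z$ are logical variables not treated as constants, or program variables other than $\mathbf r$ accessed neither in $s$ nor in the methods of $\pi$, and no variable of $\vec t$ is in $changed(s)$. **Theorem.** Let $\pi$ be a program whose class $bool$ implements the literals, i.e. from every consistent state $true$ and $false$ evaluate without divergence, type errors and failures only to objects $o$ with $bool(o,true)$, respectively $bool(o,false)$. Then for every statement $s$, all assertions $p,q$ and every set $tags$ of tags, if $\{p\}s\{tags\wedge q\}$ is derivable in $\mathcal H$ (without assumptions), then $\models\{p\}s\{tags\wedge q\}$. -/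

import Mathlib

namespace Dyn

/-! ## Names, objects, states -/

/-- Class names; `bool` is the class behind the literals `true` and `false`. -/
inductive ClassName
  | bool
  | user (n : ℕ)
  deriving DecidableEq

/-- Method names; `init` is the constructor, `not` is used by the literal `true`. -/
inductive MethName
  | init
  | not
  | user (n : ℕ)
  deriving DecidableEq

/-- Instance variables that may occur in programs. -/
inductive FieldName
  | toRef
  | user (n : ℕ)
  deriving DecidableEq

/-- All instance variables: the ones of programs and the hidden `@c`, which holds the class. -/
inductive Field
  | cls
  | prog (x : FieldName)
  deriving DecidableEq

/-- `this` and the local variables. The result variable `r` is kept apart. -/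
inductive Var
  | this
  | loc (u : ℕ)
  deriving DecidableEq

/-- The value domain: `null`, the mark of a non-existing variable, the representative object of
each class, and the enumerated objects that can be created. -/
inductive Obj
  | null
  | undef
  | rep (C : ClassName)
  | obj (n : ℕ)
  deriving DecidableEq

structure State where
  loc : Var → Obj
  res : Obj
  heap : Obj → Field → Obj

/-- Neither `null` nor the mark of a non-existing variable. -/
def Obj.IsObj (o : Obj) : Prop := o ≠ .null ∧ o ≠ .undef

open Classical in
/-- The value of `o.@x`; an undefined access yields `null`. -/
noncomputable def State.fld (σ : State) (o : Obj) (x : Field) : Obj :=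
  if o.IsObj then σ.heap o x else .null

/-- `o` exists in `σ`: an enumerated object exists (is active) when its `@c` is not `null`. -/
def State.Alive (σ : State) : Obj → Prop
  | .obj n => σ.heap (.obj n) .cls ≠ .null
  | _ => True

/-- No reference of the state leads to an object that is not yet created. -/
def State.Consistent (σ : State) : Prop :=
  (∀ v, σ.Alive (σ.loc v)) ∧ σ.Alive σ.res ∧ ∀ o x, σ.Alive o → σ.Alive (σ.heap o x)

def State.setRes (σ : State) (o : Obj) : State := { σ with res := o }

def State.setLoc (σ : State) (v : Var) (o : Obj) : State :=
  { σ with loc := Function.update σ.loc v o }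

def State.setFld (σ : State) (o : Obj) (x : Field) (d : Obj) : State :=
  { σ with heap := Function.update σ.heap o (Function.update (σ.heap o) x d) }

/-- Simultaneous assignment; `none` leaves a variable as it is. -/
def State.setAll (σ : State) (g : Var → Option Obj) : State :=
  { σ with loc := fun v => (g v).getD (σ.loc v) }

/-- The internal state of a new object of class `C`. -/
def initFields (C : ClassName) : Field → Obj
  | .cls => .rep C
  | .prog _ => .undef

/-- `n` is the least index of an inactive object. -/
def State.Next (σ : State) (n : ℕ) : Prop :=
  ¬ σ.Alive (.obj n) ∧ ∀ k < n, σ.Alive (.obj k)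

/-- Activation of the object with index `n` as an instance of `C`, which becomes the result. -/
def State.create (σ : State) (C : ClassName) (n : ℕ) : State :=
  { σ with res := .obj n, heap := Function.update σ.heap (.obj n) (initFields C) }

def State.IsBool (σ : State) (o : Obj) : Prop := σ.fld o .cls = .rep .bool

def State.IsBoolVal (σ : State) (o : Obj) (b : Bool) : Prop :=
  σ.IsBool o ∧ (b = true ↔ σ.fld o (.prog .toRef) ≠ .null)

/-! ## Statements and programs -/

/-- Simple actual parameters. -/
inductive Arg
  | var (v : Var)
  | null

/-- Sources of simultaneous assignments. Values occur only while a program runs. -/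
inductive Term
  | arg (a : Arg)
  | undef
  | val (o : Obj)

/-- Expressions and statements in one type, together with the auxiliary forms of the semantics:
the empty program `skip` (written `r`), `alloc C` (written `new_C`), the simultaneous assignment
`assign f` and `block f s` (written `begin local f; s end`). In the last two, `f` maps the variables
on the left-hand side to their sources and all others to `none`. -/
inductive Stmt
  | skip
  | null
  | var (v : Var)
  | ivar (x : FieldName)
  | asgn (u : ℕ) (e : Stmt)
  | iasgn (x : FieldName) (e : Stmt)
  | seq (s₁ s₂ : Stmt)
  | ite (e s₁ s₂ : Stmt)
  | while (e s : Stmt)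
  | eq (e₀ e₁ : Stmt)
  | isA (e : Stmt) (C : ClassName)
  | call (e₀ : Stmt) (m : MethName) (n : ℕ) (args : Fin n → Stmt)
  | new (C : ClassName) (n : ℕ) (args : Fin n → Stmt)
  | alloc (C : ClassName)
  | assign (f : Var → Option Term)
  | block (f : Var → Option Term) (s : Stmt)

/-- Statements of the language proper (and `new_C`): no empty program, simultaneous assignment
or block. Sequences are allowed wherever expressions are. -/
def Stmt.Proper : Stmt → Prop
  | .skip | .assign _ | .block _ _ => False
  | .null | .var _ | .ivar _ | .alloc _ => True
  | .asgn _ e | .iasgn _ e | .isA e _ => e.Proper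
  | .seq a b | .while a b | .eq a b => a.Proper ∧ b.Proper
  | .ite e a b => e.Proper ∧ a.Proper ∧ b.Proper
  | .call e _ _ args => e.Proper ∧ ∀ i, (args i).Proper
  | .new _ _ args => ∀ i, (args i).Proper

/-- A method with `n` distinct formal parameters. -/
structure Method (n : ℕ) where
  params : Fin n → ℕ
  params_injective : Function.Injective params
  body : Stmt
  body_proper : body.Proper

/-- For every class the methods it supports, found by name and number of parameters. -/
abbrev Program := ClassName → MethName → (n : ℕ) → Option (Method n)

open Classical in
/-- Bind `this` to the receiver and the formal to the actual parameters. -/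
noncomputable def Method.bind {n : ℕ} (d : Method n) (recv : Term) (args : Fin n → Term) :
    Var → Option Term
  | .this => some recv
  | .loc u => if h : ∃ i, d.params i = u then some (args h.choose) else none

/-- Extend the initialisation of a block: all other local variables become non-existing. -/
def fillUndef (f : Var → Option Term) : Var → Option Term
  | .this => f .this
  | .loc u => some ((f (.loc u)).getD .undef)

def State.arg (σ : State) : Arg → Obj
  | .var v => σ.loc v
  | .null => .null

def State.term (σ : State) : Term → Obj
  | .arg a => σ.arg a
  | .undef => .undef
  | .val o => o

/-- The assignment of the old values to all variables that the block has initialised. -/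
def State.restore (σ : State) (f : Var → Option Term) : Var → Option Term :=
  fun v => (fillUndef f v).map fun _ => .val (σ.loc v)

/-- `false` is `new bool(null)`, and `true` is `false.not()`. -/
def boolLit : Bool → Stmt
  | false => .new .bool 1 fun _ => .null
  | true => .call (.new .bool 1 fun _ => .null) .not 0 Fin.elim0

/-! ## Operational semantics -/

inductive Tag
  | terminates
  | typesafe
  | failsafe

/-- States and the error states. -/
inductive XState
  | ok (σ : State)
  | bot
  | typeerror
  | fail

def XState.IsError (x : XState) : Prop := ∀ σ, x ≠ .ok σ

abbrev Conf := Stmt × XState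

mutual

/-- The transition relation. Errors in subexpressions are passed on. -/
inductive Step (π : Program) : Conf → Conf → Prop
  | null {σ} : Step π (.null, .ok σ) (.skip, .ok (σ.setRes .null))
  | var {v σ} : σ.loc v ≠ .undef → Step π (.var v, .ok σ) (.skip, .ok (σ.setRes (σ.loc v)))
  | varErr {v σ} : σ.loc v = .undef → Step π (.var v, .ok σ) (.skip, .typeerror)
  | ivar {x σ} : σ.fld (σ.loc .this) (.prog x) ≠ .undef →
      Step π (.ivar x, .ok σ) (.skip, .ok (σ.setRes (σ.fld (σ.loc .this) (.prog x))))
  | ivarErr {x σ} : σ.fld (σ.loc .this) (.prog x) = .undef →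
      Step π (.ivar x, .ok σ) (.skip, .typeerror)
  | asgn {u e σ τ} : Steps π (e, .ok σ) (.skip, .ok τ) →
      Step π (.asgn u e, .ok σ) (.skip, .ok (τ.setLoc (.loc u) τ.res))
  | asgnErr {u e σ x} : Steps π (e, .ok σ) (.skip, x) → x.IsError →
      Step π (.asgn u e, .ok σ) (.skip, x)
  | iasgn {y e σ τ} : Steps π (e, .ok σ) (.skip, .ok τ) → (τ.loc .this).IsObj →
      Step π (.iasgn y e, .ok σ) (.skip, .ok (τ.setFld (τ.loc .this) (.prog y) τ.res))
  | iasgnErr {y e σ x} : Steps π (e, .ok σ) (.skip, x) → x.IsError →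
      Step π (.iasgn y e, .ok σ) (.skip, x)
  | seq {s₁ s₂ s σ τ} : Step π (s₁, .ok σ) (s₂, .ok τ) →
      Step π (.seq s₁ s, .ok σ) (.seq s₂ s, .ok τ)
  | seqErr {s₁ s₂ s σ x} : Step π (s₁, .ok σ) (s₂, x) → x.IsError →
      Step π (.seq s₁ s, .ok σ) (.skip, x)
  | seqSkip {s σ} : Step π (.seq .skip s, .ok σ) (s, .ok σ)
  | iteTrue {e s₁ s₂ σ τ} : Steps π (e, .ok σ) (.skip, .ok τ) → τ.IsBoolVal τ.res true →
      Step π (.ite e s₁ s₂, .ok σ) (s₁, .ok τ)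
  | iteFalse {e s₁ s₂ σ τ} : Steps π (e, .ok σ) (.skip, .ok τ) → τ.IsBoolVal τ.res false →
      Step π (.ite e s₁ s₂, .ok σ) (s₂, .ok τ)
  | iteNull {e s₁ s₂ σ τ} : Steps π (e, .ok σ) (.skip, .ok τ) → τ.res = .null →
      Step π (.ite e s₁ s₂, .ok σ) (.skip, .fail)
  | iteType {e s₁ s₂ σ τ} : Steps π (e, .ok σ) (.skip, .ok τ) → τ.res ≠ .null →
      ¬ τ.IsBool τ.res → Step π (.ite e s₁ s₂, .ok σ) (.skip, .typeerror)
  | iteErr {e s₁ s₂ σ x} : Steps π (e, .ok σ) (.skip, x) → x.IsError →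
      Step π (.ite e s₁ s₂, .ok σ) (.skip, x)
  | while {e s σ} :
      Step π (.while e s, .ok σ) (.ite e (.seq s (.while e s)) .null, .ok σ)
  | assign {f σ} :
      Step π (.assign f, .ok σ) (.skip, .ok (σ.setAll fun v => (f v).map σ.term))
  | block {f s σ} :
      Step π (.block f s, .ok σ)
        (.seq (.assign (fillUndef f)) (.seq s (.assign (σ.restore f))), .ok σ)
  | call {e₀ m n args σ₀ C} {d : Method n} {σ : Fin (n + 1) → State} :
      Steps π (e₀, .ok σ₀) (.skip, .ok (σ 0)) →
      (σ 0).res ≠ .null → (σ 0).fld (σ 0).res .cls = .rep C → π C m n = some d →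
      (∀ i : Fin n, Steps π (args i, .ok (σ i.castSucc)) (.skip, .ok (σ i.succ))) →
      Step π (.call e₀ m n args, .ok σ₀)
        (.block (d.bind (.val (σ 0).res) fun i => .val (σ i.succ).res) d.body, .ok (σ (Fin.last n)))
  | callNull {e₀ m n args σ₀ σ₁} : Steps π (e₀, .ok σ₀) (.skip, .ok σ₁) → σ₁.res = .null →
      Step π (.call e₀ m n args, .ok σ₀) (.skip, .fail)
  | callType {e₀ m n args σ₀ σ₁ C} : Steps π (e₀, .ok σ₀) (.skip, .ok σ₁) → σ₁.res ≠ .null →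
      σ₁.fld σ₁.res .cls = .rep C → π C m n = none →
      Step π (.call e₀ m n args, .ok σ₀) (.skip, .typeerror)
  | callErr {e₀ m n args σ₀ x} : Steps π (e₀, .ok σ₀) (.skip, x) → x.IsError →
      Step π (.call e₀ m n args, .ok σ₀) (.skip, x)
  | callArgErr {e₀ m n args σ₀ C x} {d : Method n} {σ : Fin (n + 1) → State} (i : Fin n) :
      Steps π (e₀, .ok σ₀) (.skip, .ok (σ 0)) →
      (σ 0).res ≠ .null → (σ 0).fld (σ 0).res .cls = .rep C → π C m n = some d →
      (∀ j : Fin n, j < i → Steps π (args j, .ok (σ j.castSucc)) (.skip, .ok (σ j.succ))) →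
      Steps π (args i, .ok (σ i.castSucc)) (.skip, x) → x.IsError →
      Step π (.call e₀ m n args, .ok σ₀) (.skip, x)
  | new {C n args σ} :
      Step π (.new C n args, .ok σ) (.call (.alloc C) .init n args, .ok σ)
  | alloc {C σ n} : σ.Next n → Step π (.alloc C, .ok σ) (.skip, .ok (σ.create C n))
  | eq {e₀ e₁ σ₀ σ₁ σ₂ b} : Steps π (e₀, .ok σ₀) (.skip, .ok σ₁) →
      Steps π (e₁, .ok σ₁) (.skip, .ok σ₂) → (b = true ↔ σ₁.res = σ₂.res) →
      Step π (.eq e₀ e₁, .ok σ₀) (boolLit b, .ok σ₂)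
  | eqErrLeft {e₀ e₁ σ₀ x} : Steps π (e₀, .ok σ₀) (.skip, x) → x.IsError →
      Step π (.eq e₀ e₁, .ok σ₀) (.skip, x)
  | eqErrRight {e₀ e₁ σ₀ σ₁ x} : Steps π (e₀, .ok σ₀) (.skip, .ok σ₁) →
      Steps π (e₁, .ok σ₁) (.skip, x) → x.IsError → Step π (.eq e₀ e₁, .ok σ₀) (.skip, x)
  | isA {e C σ σ₁ b} : Steps π (e, .ok σ) (.skip, .ok σ₁) →
      (b = true ↔ σ₁.fld σ₁.res .cls = .rep C) →
      Step π (.isA e C, .ok σ) (boolLit b, .ok σ₁)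
  | isAErr {e C σ x} : Steps π (e, .ok σ) (.skip, x) → x.IsError →
      Step π (.isA e C, .ok σ) (.skip, x)

/-- The reflexive transitive closure of the transition relation. -/
inductive Steps (π : Program) : Conf → Conf → Prop
  | refl {c} : Steps π c c
  | head {c c' c''} : Step π c c' → Steps π c' c'' → Steps π c c''

end

/-- The first configuration has to evaluate the second one before it can make its next step. -/
inductive Descend (π : Program) : Conf → Conf → Prop
  | asgn {u e σ} : Descend π (.asgn u e, .ok σ) (e, .ok σ)
  | iasgn {x e σ} : Descend π (.iasgn x e, .ok σ) (e, .ok σ)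
  | seq {s₁ s₂ σ} : Descend π (.seq s₁ s₂, .ok σ) (s₁, .ok σ)
  | ite {e s₁ s₂ σ} : Descend π (.ite e s₁ s₂, .ok σ) (e, .ok σ)
  | callRecv {e₀ m n args σ} : Descend π (.call e₀ m n args, .ok σ) (e₀, .ok σ)
  | callArg {e₀ m n args σ₀ C} {d : Method n} {σ : Fin (n + 1) → State} (i : Fin n) :
      Steps π (e₀, .ok σ₀) (.skip, .ok (σ 0)) →
      (σ 0).res ≠ .null → (σ 0).fld (σ 0).res .cls = .rep C → π C m n = some d →
      (∀ j : Fin n, j < i → Steps π (args j, .ok (σ j.castSucc)) (.skip, .ok (σ j.succ))) →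
      Descend π (.call e₀ m n args, .ok σ₀) (args i, .ok (σ i.castSucc))
  | eqLeft {e₀ e₁ σ} : Descend π (.eq e₀ e₁, .ok σ) (e₀, .ok σ)
  | eqRight {e₀ e₁ σ₀ σ₁} : Steps π (e₀, .ok σ₀) (.skip, .ok σ₁) →
      Descend π (.eq e₀ e₁, .ok σ₀) (e₁, .ok σ₁)
  | isA {e C σ} : Descend π (.isA e C, .ok σ) (e, .ok σ)

/-- Finite sequences `c 0, …, c n` and infinite sequences of configurations. -/
inductive Comp
  | fin (n : ℕ) (c : ℕ → Conf)
  | inf (c : ℕ → Conf)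

/-- The computations of `s` from `σ`. An infinite computation may descend into the evaluation of a
subexpression, so that a statement diverges if the evaluation of a subexpression does. -/
def Comp.From (π : Program) (s : Stmt) (σ : State) : Comp → Prop
  | .fin n c => c 0 = (s, .ok σ) ∧ ∀ i < n, Step π (c i) (c (i + 1))
  | .inf c => c 0 = (s, .ok σ) ∧ ∀ i, Step π (c i) (c (i + 1)) ∨ Descend π (c i) (c (i + 1))

/-- The outcome that a tag (or no tag) selects from a computation. -/
def select : Option Tag → Comp → Set XState
  | none, .fin n c => {x | ∃ τ, x = .ok τ ∧ c n = (.skip, .ok τ)}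
  | some .terminates, .inf _ => {.bot}
  | some .typesafe, .fin n c => {x | x = .typeerror ∧ c n = (.skip, .typeerror)}
  | some .failsafe, .fin n c => {x | x = .fail ∧ c n = (.skip, .fail)}
  | _, _ => ∅

/-- The tagged semantics of a statement. -/
def outcomes (π : Program) (tags : Set Tag) (s : Stmt) (σ : State) : Set XState :=
  {x | ∃ ρ : Comp, ρ.From π s σ ∧
    (x ∈ select none ρ ∨ ∃ tag ∈ tags, x ∈ select (some tag) ρ)}

/-- The class `bool` of the program implements the literals: in every consistent state, `true` and
`false` evaluate, without divergence and errors, to objects that represent these truth values. -/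
def BoolCorrect (π : Program) : Prop :=
  ∀ (b : Bool) (σ : State), σ.Consistent →
    outcomes π Set.univ (boolLit b) σ ⊆ {x | ∃ τ, x = .ok τ ∧ τ.IsBoolVal τ.res b}

/-! ## Assertions -/

inductive BTy
  | nat
  | obj
  | bool
  | str
  deriving DecidableEq

/-- Basic types and finite sequences over them. -/
inductive Ty
  | base (t : BTy)
  | seq (t : BTy)

abbrev BTy.Val : BTy → Type
  | .nat => ℕ
  | .obj => Obj
  | .bool => Bool
  | .str => List ℕ

abbrev Ty.Val : Ty → Type
  | .base t => t.Val
  | .seq t => List t.Val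

/-- The value of undefined operations. -/
def BTy.dflt : (t : BTy) → t.Val
  | .nat => (0 : ℕ)
  | .obj => Obj.null
  | .bool => false
  | .str => ([] : List ℕ)

inductive Op1 : Ty → Ty → Type
  | not : Op1 (.base .bool) (.base .bool)
  | len (t : BTy) : Op1 (.seq t) (.base .nat)
  | strLen : Op1 (.base .str) (.base .nat)

inductive Op2 : Ty → Ty → Ty → Type
  | add : Op2 (.base .nat) (.base .nat) (.base .nat)
  | sub : Op2 (.base .nat) (.base .nat) (.base .nat)
  | mul : Op2 (.base .nat) (.base .nat) (.base .nat)
  | div : Op2 (.base .nat) (.base .nat) (.base .nat)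
  | mod : Op2 (.base .nat) (.base .nat) (.base .nat)
  | lt : Op2 (.base .nat) (.base .nat) (.base .bool)
  | and : Op2 (.base .bool) (.base .bool) (.base .bool)
  | eq (t : BTy) : Op2 (.base t) (.base t) (.base .bool)
  | at (t : BTy) : Op2 (.seq t) (.base .nat) (.base t)
  | snoc (t : BTy) : Op2 (.seq t) (.base t) (.seq t)
  | strAt : Op2 (.base .str) (.base .nat) (.base .nat)
  | strSnoc : Op2 (.base .str) (.base .nat) (.base .str)

def Op1.eval : {a b : Ty} → Op1 a b → a.Val → b.Val
  | _, _, .not, x => !x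
  | _, _, .len _, x => List.length x
  | _, _, .strLen, x => List.length x

open Classical in
noncomputable def Op2.eval : {a b c : Ty} → Op2 a b c → a.Val → b.Val → c.Val
  | _, _, _, .add, x, y => Nat.add x y
  | _, _, _, .sub, x, y => Nat.sub x y
  | _, _, _, .mul, x, y => Nat.mul x y
  | _, _, _, .div, x, y => Nat.div x y
  | _, _, _, .mod, x, y => Nat.mod x y
  | _, _, _, .lt, x, y => decide (Nat.lt x y)
  | _, _, _, .and, x, y => x && y
  | _, _, _, .eq _, x, y => decide (x = y)
  | _, _, _, .at t, x, y => List.getD x y t.dflt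
  | _, _, _, .snoc _, x, y => x ++ [y]
  | _, _, _, .strAt, x, y => List.getD x y 0
  | _, _, _, .strSnoc, x, y => List.append x [y]

/-- Logical expressions. Logical variables of basic type are names `lvar t x`; logical variables of
sequence type are de Bruijn indices `svar t k`, counted for each `t` separately, and only they are
bound by quantifiers. -/
inductive LExp : Ty → Type
  | lvar (t : BTy) (x : ℕ) : LExp (.base t)
  | svar (t : BTy) (k : ℕ) : LExp (.seq t)
  | var (v : Var) : LExp (.base .obj)
  | res : LExp (.base .obj)
  | fld (l : LExp (.base .obj)) (x : Field) : LExp (.base .obj)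
  | null : LExp (.base .obj)
  | undef : LExp (.base .obj)
  | rep (C : ClassName) : LExp (.base .obj)
  | natC (n : ℕ) : LExp (.base .nat)
  | boolC (b : Bool) : LExp (.base .bool)
  | strC (s : List ℕ) : LExp (.base .str)
  | nil (t : BTy) : LExp (.seq t)
  | cond {τ : Ty} (c : LExp (.base .bool)) (l₁ l₂ : LExp τ) : LExp τ
  | op1 {a b : Ty} (o : Op1 a b) (l : LExp a) : LExp b
  | op2 {a b c : Ty} (o : Op2 a b c) (l₁ : LExp a) (l₂ : LExp b) : LExp c

/-- Assertions; `ex t a` quantifies over the finite sequences of type `t`, and `isIn l Cs` says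
that the class of `l` is among `Cs`. -/
inductive Asrt
  | eq {τ : Ty} (l₁ l₂ : LExp τ)
  | isIn (l : LExp (.base .obj)) (Cs : List ClassName)
  | neg (a : Asrt)
  | and (a b : Asrt)
  | ex (t : BTy) (a : Asrt)
  | tag (t : Tag)

/-- Values of the logical variables. -/
structure Env where
  base : (t : BTy) → ℕ → t.Val
  seq : (t : BTy) → ℕ → List t.Val

/-- Bind a new sequence variable with index `0`. -/
def Env.push (ω : Env) (t : BTy) (v : List t.Val) : Env where
  base := ω.base
  seq := fun t' k =>
    if h : t' = t then
      match k with
      | 0 => h ▸ v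
      | k + 1 => ω.seq t' k
    else ω.seq t' k

/-- A value exists in a state; only objects may fail to. -/
def State.AliveVal (σ : State) : (t : BTy) → t.Val → Prop
  | .obj, o => σ.Alive o
  | _, _ => True

/-- Logical variables denote existing objects only. -/
def Env.Consistent (ω : Env) (σ : State) : Prop :=
  (∀ t x, σ.AliveVal t (ω.base t x)) ∧ ∀ t k, ∀ v ∈ ω.seq t k, σ.AliveVal t v

noncomputable def LExp.eval (σ : State) (ω : Env) : {τ : Ty} → LExp τ → τ.Val
  | _, .lvar t x => ω.base t x
  | _, .svar t k => ω.seq t k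
  | _, .var v => σ.loc v
  | _, .res => σ.res
  | _, .fld l x => σ.fld (l.eval σ ω) x
  | _, .null => Obj.null
  | _, .undef => Obj.undef
  | _, .rep C => Obj.rep C
  | _, .natC n => n
  | _, .boolC b => b
  | _, .strC s => s
  | _, .nil _ => []
  | _, .cond c l₁ l₂ => bif c.eval σ ω then l₁.eval σ ω else l₂.eval σ ω
  | _, .op1 o l => o.eval (l.eval σ ω)
  | _, .op2 o l₁ l₂ => o.eval (l₁.eval σ ω) (l₂.eval σ ω)

/-- Truth of an assertion under a set of tags. Quantifiers range over sequences of existing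
objects. -/
def Sat (σ : State) (tags : Set Tag) : Env → Asrt → Prop
  | ω, .eq l₁ l₂ => l₁.eval σ ω = l₂.eval σ ω
  | ω, .isIn l Cs => ∃ C ∈ Cs, σ.fld (l.eval σ ω) .cls = .rep C
  | ω, .neg a => ¬ Sat σ tags ω a
  | ω, .and a b => Sat σ tags ω a ∧ Sat σ tags ω b
  | ω, .ex t a => ∃ v : List t.Val, (∀ x ∈ v, σ.AliveVal t x) ∧ Sat σ tags (ω.push t v) a
  | _, .tag t => t ∈ tags

/-- The states that satisfy an assertion, for given values of the logical variables. -/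
def Asrt.states (p : Asrt) (tags : Set Tag) (ω : Env) : Set State :=
  {σ | σ.Consistent ∧ ω.Consistent σ ∧ Sat σ tags ω p}

/-- `p` under `tags` implies `q` under `tags'`. -/
def Entails (tags : Set Tag) (p : Asrt) (tags' : Set Tag) (q : Asrt) : Prop :=
  ∀ ω, p.states tags ω ⊆ q.states tags' ω

/-- The tagged triple `{pre} stmt {tags ∧ post}`. -/
structure Triple where
  pre : Asrt
  stmt : Stmt
  tags : Set Tag
  post : Asrt

/-- Semantic truth of tagged triples. -/
def Triple.Valid (π : Program) (T : Triple) : Prop :=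
  ∀ ω, ∀ σ ∈ T.pre.states T.tags ω,
    outcomes π T.tags T.stmt σ ⊆ XState.ok '' T.post.states T.tags ω

/-! ### Substitutions -/

/-- Shift the sequence variables of type `t` by one. -/
def LExp.shift (t : BTy) : {τ : Ty} → LExp τ → LExp τ
  | _, .svar t' k => .svar t' (if t' = t then k + 1 else k)
  | _, .fld l x => .fld (l.shift t) x
  | _, .cond c l₁ l₂ => .cond (c.shift t) (l₁.shift t) (l₂.shift t)
  | _, .op1 o l => .op1 o (l.shift t)
  | _, .op2 o l₁ l₂ => .op2 o (l₁.shift t) (l₂.shift t)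
  | _, l => l

/-- Simultaneous substitutions for program variables, the result variable and logical variables. -/
structure Subst where
  var : Var → LExp (.base .obj) := .var
  res : LExp (.base .obj) := .res
  lvar : (t : BTy) → ℕ → LExp (.base t) := .lvar
  svar : (t : BTy) → ℕ → LExp (.seq t) := .svar

/-- The substitution below a quantifier over sequences of type `t`. -/
def Subst.lift (θ : Subst) (t : BTy) : Subst where
  var := fun v => (θ.var v).shift t
  res := θ.res.shift t
  lvar := fun t' x => (θ.lvar t' x).shift t
  svar := fun t' k =>
    if t' = t then
      match k with
      | 0 => .svar t' 0
      | k + 1 => (θ.svar t' k).shift t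
    else (θ.svar t' k).shift t

def LExp.subst (θ : Subst) : {τ : Ty} → LExp τ → LExp τ
  | _, .lvar t x => θ.lvar t x
  | _, .svar t k => θ.svar t k
  | _, .var v => θ.var v
  | _, .res => θ.res
  | _, .fld l x => .fld (l.subst θ) x
  | _, .cond c l₁ l₂ => .cond (c.subst θ) (l₁.subst θ) (l₂.subst θ)
  | _, .op1 o l => .op1 o (l.subst θ)
  | _, .op2 o l₁ l₂ => .op2 o (l₁.subst θ) (l₂.subst θ)
  | _, l => l

def Asrt.subst : Subst → Asrt → Asrt
  | θ, .eq l₁ l₂ => .eq (l₁.subst θ) (l₂.subst θ)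
  | θ, .isIn l Cs => .isIn (l.subst θ) Cs
  | θ, .neg a => .neg (a.subst θ)
  | θ, .and a b => .and (a.subst θ) (b.subst θ)
  | θ, .ex t a => .ex t (a.subst (θ.lift t))
  | _, .tag t => .tag t

/-- `p[r := l]` -/
def Asrt.substRes (p : Asrt) (l : LExp (.base .obj)) : Asrt := p.subst { res := l }

/-- `p[v := l]` -/
def Asrt.substVar (p : Asrt) (v : Var) (l : LExp (.base .obj)) : Asrt :=
  p.subst { var := Function.update LExp.var v l }

/-- `p[z := l]` for a logical variable `z` of type `ℕ` -/
def Asrt.substNat (p : Asrt) (z : ℕ) (l : LExp (.base .nat)) : Asrt :=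
  p.subst { lvar := Function.update LExp.lvar .nat (Function.update (LExp.lvar .nat) z l) }

/-- `l[this.@x := r]` -/
def LExp.substFld (x : Field) : {τ : Ty} → LExp τ → LExp τ
  | _, .fld l y =>
      if y = x then
        .cond (.op2 (.eq .obj) (l.substFld x) (.var .this)) .res (.fld (l.substFld x) y)
      else .fld (l.substFld x) y
  | _, .cond c l₁ l₂ => .cond (c.substFld x) (l₁.substFld x) (l₂.substFld x)
  | _, .op1 o l => .op1 o (l.substFld x)
  | _, .op2 o l₁ l₂ => .op2 o (l₁.substFld x) (l₂.substFld x)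
  | _, l => l

/-- `p[this.@x := r]`. As `@c` may be read by `isIn`, this is meant for `x` other than `@c`. -/
def Asrt.substFld (x : FieldName) : Asrt → Asrt
  | .eq l₁ l₂ => .eq (l₁.substFld (.prog x)) (l₂.substFld (.prog x))
  | .isIn l Cs => .isIn (l.substFld (.prog x)) Cs
  | .neg a => .neg (a.substFld x)
  | .and a b => .and (a.substFld x) (b.substFld x)
  | .ex t a => .ex t (a.substFld x)
  | .tag t => .tag t

/-! Abbreviations -/

def Asrt.or (a b : Asrt) : Asrt := .neg (.and (.neg a) (.neg b))
def Asrt.imp (a b : Asrt) : Asrt := .or (.neg a) b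
def Asrt.iff (a b : Asrt) : Asrt := .and (a.imp b) (b.imp a)
def Asrt.true : Asrt := .eq LExp.null LExp.null
def Asrt.ne (l₁ l₂ : LExp (.base .obj)) : Asrt := .neg (.eq l₁ l₂)

/-- A boolean expression as an assertion. -/
def LExp.holds (l : LExp (.base .bool)) : Asrt := .eq l (.boolC Bool.true)

/-- `|v| = 1` for the innermost bound variable -/
def Asrt.single (t : BTy) : Asrt := .eq (.op1 (.len t) (.svar t 0)) (.natC 1)

/-- The first element of the innermost bound variable -/
def LExp.first (t : BTy) : LExp (.base t) := .op2 (.at t) (.svar t 0) (.natC 0)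

/-- `∃ x : t, a`, which abbreviates `∃ v : t*, |v| = 1 ∧ a[v[0]/x]` -/
def Asrt.ex1 (t : BTy) (x : ℕ) (a : Asrt) : Asrt :=
  .ex t (.and (.single t) (a.subst
    { lvar := Function.update LExp.lvar t (Function.update (LExp.lvar t) x (.first t))
      svar := Function.update LExp.svar t fun k => .svar t (k + 1) }))

def Asrt.all1 (t : BTy) (x : ℕ) (a : Asrt) : Asrt := .neg (.ex1 t x (.neg a))

/-- `∃ v : t*, a` for the free sequence variable `v` with index `k` -/
def Asrt.exSeq (t : BTy) (k : ℕ) (a : Asrt) : Asrt :=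
  .ex t (a.subst
    { svar := Function.update LExp.svar t fun j => .svar t (if j = k then 0 else j + 1) })

/-- The mapping predicate `bool(l)` -/
def isBool (l : LExp (.base .obj)) : Asrt := .and (.ne l .null) (.eq (.fld l .cls) (.rep .bool))

/-- The mapping predicate `bool(l, b)` -/
def isBoolVal (l : LExp (.base .obj)) (b : LExp (.base .bool)) : Asrt :=
  .and (isBool l) (b.holds.iff (.ne (.fld l (.prog .toRef)) .null))

/-! ### Substitution for object creation

In the state after the creation, an expression of type object either denotes the new object or has a
value that can be expressed before the creation. A quantified sequence of objects is split into a
sequence of old objects and a boolean sequence marking the positions of the new object. -/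

/-- Where the boolean sequence variables and the markings of the sequences of objects are found. -/
structure NewCtx where
  idx : ℕ → ℕ := id
  mark : ℕ → Option ℕ := fun _ => none

def NewCtx.underObj (ρ : NewCtx) : NewCtx where
  idx := fun k => ρ.idx k + 1
  mark := fun
    | 0 => some 0
    | k + 1 => (ρ.mark k).map (· + 1)

def NewCtx.underBool (ρ : NewCtx) : NewCtx where
  idx := fun
    | 0 => 0
    | k + 1 => ρ.idx k + 1
  mark := fun k => (ρ.mark k).map (· + 1)

/-- The value before the creation, and whether it is the new object (for objects) or has the new
object at a given position (for sequences of objects). -/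
structure NewTr (τ : Ty) where
  old : LExp τ
  isNew : LExp (.base .bool) := .boolC false
  newAt : LExp (.base .nat) → LExp (.base .bool) := fun _ => .boolC false

/-- Equality of two expressions of type object after the creation -/
def newEq (a₁ : LExp (.base .bool)) (l₁ : LExp (.base .obj)) (a₂ : LExp (.base .bool))
    (l₂ : LExp (.base .obj)) : LExp (.base .bool) :=
  .cond a₁ a₂ (.cond a₂ (.boolC false) (.op2 (.eq .obj) l₁ l₂))

def NewTr.op2 : {a b c : Ty} → Op2 a b c → NewTr a → NewTr b → NewTr c
  | _, _, _, .eq .obj, x, y => { old := newEq x.isNew x.old y.isNew y.old }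
  | _, _, _, .at .obj, x, y => { old := .op2 (.at .obj) x.old y.old, isNew := x.newAt y.old }
  | _, _, _, .snoc .obj, x, y =>
      { old := .op2 (.snoc .obj) x.old y.old
        newAt := fun n => .cond (.op2 (.eq .nat) n (.op1 (.len .obj) x.old)) y.isNew (x.newAt n) }
  | _, _, _, o, x, y => { old := .op2 o x.old y.old }

def LExp.new (C : ClassName) (ρ : NewCtx) : {τ : Ty} → LExp τ → NewTr τ
  | _, .res => { old := .null, isNew := .boolC true }
  | _, .svar .bool k => { old := .svar .bool (ρ.idx k) }
  | _, .svar .obj k =>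
      { old := .svar .obj k
        newAt := fun n =>
          match ρ.mark k with
          | some j => .op2 (.at .bool) (.svar .bool j) n
          | none => .boolC false }
  | _, .fld l x =>
      { old := .cond (l.new C ρ).isNew
          (match x with
            | .cls => .rep C
            | .prog _ => .undef)
          (.fld (l.new C ρ).old x) }
  | _, .cond c l₁ l₂ =>
      { old := .cond (c.new C ρ).old (l₁.new C ρ).old (l₂.new C ρ).old
        isNew := .cond (c.new C ρ).old (l₁.new C ρ).isNew (l₂.new C ρ).isNew
        newAt := fun n => .cond (c.new C ρ).old ((l₁.new C ρ).newAt n) ((l₂.new C ρ).newAt n) }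
  | _, .op1 o l => { old := .op1 o (l.new C ρ).old }
  | _, .op2 o l₁ l₂ => .op2 o (l₁.new C ρ) (l₂.new C ρ)
  | _, l => { old := l }

/-- Equations after the creation; sequences of objects are compared position by position. -/
def newEquation (C : ClassName) (ρ : NewCtx) : {τ : Ty} → LExp τ → LExp τ → Asrt
  | .base .obj, l₁, l₂ =>
      (newEq (l₁.new C ρ).isNew (l₁.new C ρ).old (l₂.new C ρ).isNew (l₂.new C ρ).old).holds
  | .seq .obj, l₁, l₂ =>
      let s₁ := (l₁.shift .nat).new C ρ
      let s₂ := (l₂.shift .nat).new C ρ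
      let i := LExp.first .nat
      .and (.eq (.op1 (.len .obj) (l₁.new C ρ).old) (.op1 (.len .obj) (l₂.new C ρ).old))
        (.neg (.ex .nat (.and (.single .nat) (.and
          (LExp.op2 .lt i (.op1 (.len .obj) s₁.old)).holds
          (.neg (newEq (s₁.newAt i) (.op2 (.at .obj) s₁.old i)
            (s₂.newAt i) (.op2 (.at .obj) s₂.old i)).holds)))))
  | _, l₁, l₂ => .eq (l₁.new C ρ).old (l₂.new C ρ).old

/-- `p[r := new_C]` -/
def Asrt.substNew (C : ClassName) : NewCtx → Asrt → Asrt
  | ρ, .eq l₁ l₂ => newEquation C ρ l₁ l₂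
  | ρ, .isIn l Cs =>
      .or (.and (l.new C ρ).isNew.holds (if C ∈ Cs then .true else .neg .true))
        (.and (.neg (l.new C ρ).isNew.holds) (.isIn (l.new C ρ).old Cs))
  | ρ, .neg a => .neg (a.substNew C ρ)
  | ρ, .and a b => .and (a.substNew C ρ) (b.substNew C ρ)
  | ρ, .ex .obj a =>
      .ex .obj (.ex .bool (.and
        (.eq (.op1 (.len .bool) (.svar .bool 0)) (.op1 (.len .obj) (.svar .obj 0)))
        (a.substNew C ρ.underObj)))
  | ρ, .ex .bool a => .ex .bool (a.substNew C ρ.underBool)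
  | ρ, .ex t a => .ex t (a.substNew C ρ)
  | _, .tag t => .tag t

/-! ### Free, accessed and changed variables -/

inductive Sym
  | var (v : Var)
  | res
  | fld (x : Field)
  | lvar (t : BTy) (x : ℕ)
  | svar (t : BTy) (k : ℕ)

/-- The name that a free variable has below a quantifier over sequences of type `t`. -/
def Sym.lift (t : BTy) : Sym → Sym
  | .svar t' k => .svar t' (if t' = t then k + 1 else k)
  | y => y

def LExp.free : {τ : Ty} → LExp τ → Set Sym
  | _, .lvar t x => {.lvar t x}
  | _, .svar t k => {.svar t k}
  | _, .var v => {.var v}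
  | _, .res => {.res}
  | _, .fld l x => insert (.fld x) l.free
  | _, .cond c l₁ l₂ => c.free ∪ l₁.free ∪ l₂.free
  | _, .op1 _ l => l.free
  | _, .op2 _ l₁ l₂ => l₁.free ∪ l₂.free
  | _, _ => ∅

def Asrt.free : Asrt → Set Sym
  | .eq l₁ l₂ => l₁.free ∪ l₂.free
  | .isIn l _ => insert (.fld .cls) l.free
  | .neg a => a.free
  | .and a b => a.free ∪ b.free
  | .ex t a => {y | y.lift t ∈ a.free}
  | .tag _ => ∅

/-- The tags occurring in an assertion -/
def Asrt.tagsIn : Asrt → Set Tag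
  | .eq _ _ | .isIn _ _ => ∅
  | .neg a | .ex _ a => a.tagsIn
  | .and a b => a.tagsIn ∪ b.tagsIn
  | .tag t => {t}

/-- No quantification over (sequences of) objects -/
def Asrt.NoObjQuant : Asrt → Prop
  | .eq _ _ | .isIn _ _ | .tag _ => True
  | .neg a => a.NoObjQuant
  | .and a b => a.NoObjQuant ∧ b.NoObjQuant
  | .ex t a => t ≠ .obj ∧ a.NoObjQuant

def Arg.vars : Arg → Set Sym
  | .var v => {.var v}
  | .null => ∅

def Term.vars : Term → Set Sym
  | .arg a => a.vars
  | _ => ∅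

/-- The targets of a simultaneous assignment -/
def targets (f : Var → Option Term) : Set Sym := {y | ∃ v, y = .var v ∧ f v ≠ none}

def sources (f : Var → Option Term) : Set Sym := {y | ∃ v t, f v = some t ∧ y ∈ t.vars}

/-- The variables accessed in a statement; instance variables are those of `this`. -/
def Stmt.vars : Stmt → Set Sym
  | .skip | .null | .alloc _ => ∅
  | .var v => {.var v}
  | .ivar x => {.var .this, .fld (.prog x)}
  | .asgn u e => insert (.var (.loc u)) e.vars
  | .iasgn x e => {.var .this, .fld (.prog x)} ∪ e.vars
  | .seq a b | .while a b | .eq a b => a.vars ∪ b.vars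
  | .ite e a b => e.vars ∪ a.vars ∪ b.vars
  | .isA e _ => e.vars
  | .call e _ _ args => e.vars ∪ ⋃ i, (args i).vars
  | .new _ _ args => ⋃ i, (args i).vars
  | .assign f => targets f ∪ sources f
  | .block f s => targets f ∪ sources f ∪ s.vars

/-- The variables appearing on the left of an assignment in a statement -/
def Stmt.change : Stmt → Set Sym
  | .skip | .null | .alloc _ | .var _ | .ivar _ => ∅
  | .asgn u e => insert (.var (.loc u)) e.change
  | .iasgn x e => insert (.fld (.prog x)) e.change
  | .seq a b | .while a b | .eq a b => a.change ∪ b.change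
  | .ite e a b => e.change ∪ a.change ∪ b.change
  | .isA e _ => e.change
  | .call e _ _ args => e.change ∪ ⋃ i, (args i).change
  | .new _ _ args => ⋃ i, (args i).change
  | .assign f => targets f
  | .block f s => targets f ∪ s.change

/-- The variables accessed in the methods of a program -/
def methodVars (π : Program) : Set Sym :=
  {y | ∃ C m n, ∃ d : Method n, π C m n = some d ∧
    (y ∈ d.body.vars ∨ ∃ i, y = .var (.loc (d.params i)))}

/-- The instance variables changed by the methods of a program -/
def methodChange (π : Program) : Set Sym :=
  {y | ∃ x, y = .fld x ∧ ∃ C m n, ∃ d : Method n, π C m n = some d ∧ y ∈ d.body.change}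

/-- Everything that the execution of `s` may change, including the result variable -/
def changed (π : Program) (s : Stmt) : Set Sym := insert .res (methodChange π ∪ s.change)

/-! ## The proof system -/

def Arg.stmt : Arg → Stmt
  | .var v => .var v
  | .null => .null

def Arg.exp : Arg → LExp (.base .obj)
  | .var v => .var v
  | .null => .null

def Term.exp : Term → Option (LExp (.base .obj))
  | .arg a => some a.exp
  | .undef => some .undef
  | .val _ => none

/-- `(failsafe → l ≠ null) ∧ (typesafe → (l ≠ null → a))` -/
def guarded (l : LExp (.base .obj)) (a : Asrt) : Asrt :=
  .and (.imp (.tag .failsafe) (.ne l .null)) (.imp (.tag .typesafe) (.imp (.ne l .null) a))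

/-- `terminates → ∀ z' : ℕ, r(z') → z' < z` -/
def decreases (r : Asrt) (z z' : ℕ) : Asrt :=
  .imp (.tag .terminates) (.all1 .nat z' (.imp (r.substNat z (.lvar .nat z'))
    (LExp.op2 .lt (.lvar .nat z') (.lvar .nat z)).holds))

/-- A method call with its specification, as used in the rule for recursion: the triple
`{p} l.m(args) {tags ∧ q}`, the bound `r(z)`, and the method `d` of the class `C`. -/
structure CallSpec where
  p : Asrt
  q : Asrt
  tags : Set Tag
  l : Arg
  m : MethName
  n : ℕ
  args : Fin n → Arg
  C : ClassName
  d : Method n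
  r : Asrt

def CallSpec.call (c : CallSpec) : Stmt := .call c.l.stmt c.m c.n fun i => (c.args i).stmt

/-- The block that executes the body of the called method -/
noncomputable def CallSpec.bodyBlock (c : CallSpec) : Stmt :=
  .block (c.d.bind (.arg c.l) fun i => .arg (c.args i)) c.d.body

/-- The assumption `{p} l.m(args) {tags ∧ q}` -/
def CallSpec.assumption (c : CallSpec) : Triple := ⟨c.p, c.call, c.tags, c.q⟩

/-- The assumption `{p ∧ (terminates → ∀ z', r(z') → z' < z)} l.m(args) {tags ∧ q}` -/
def CallSpec.boundedAssumption (c : CallSpec) (z z' : ℕ) : Triple :=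
  ⟨.and c.p (decreases c.r z z'), c.call, c.tags, c.q⟩

/-- Under the precondition, `d` is the method that is called (if any is), and the call itself
violates none of the required tags. -/
structure CallSpec.Dispatches (π : Program) (c : CallSpec) : Prop where
  lookup : π c.C c.m c.n = some c.d
  receiver : Entails c.tags c.p c.tags (guarded c.l.exp (.eq (.fld c.l.exp .cls) (.rep c.C)))
  arguments : ∀ i, Entails c.tags c.p c.tags
    (.imp (.tag .typesafe) (.imp (.ne c.l.exp .null) (.ne (c.args i).exp .undef)))
  unique : ∀ D, D ≠ c.C → π D c.m c.n ≠ none →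
    Entails c.tags c.p c.tags (.neg (.isIn c.l.exp [D]))

/-- `Derivable π K Γ T`: the triple `T` is derivable in the proof system for the program `π` from
the assumptions `Γ`, where the logical variables of type `ℕ` in `K` are treated as constants. -/
inductive Derivable (π : Program) : Set ℕ → Set Triple → Triple → Prop
  | hyp {K Γ T} : T ∈ Γ → Derivable π K Γ T
  | var {K Γ} (v : Var) (p : Asrt) : Derivable π K Γ ⟨p.substRes (.var v), .var v, ∅, p⟩
  | varTag {K Γ} (v : Var) (tags : Set Tag) :
      Derivable π K Γ ⟨.imp (.tag .typesafe) (.ne (.var v) .undef), .var v, tags, .true⟩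
  | ivar {K Γ} (x : FieldName) (p : Asrt) :
      Derivable π K Γ ⟨p.substRes (.fld (.var .this) (.prog x)), .ivar x, ∅, p⟩
  | ivarTag {K Γ} (x : FieldName) (tags : Set Tag) :
      Derivable π K Γ ⟨.imp (.tag .typesafe) (.ne (.fld (.var .this) (.prog x)) .undef),
        .ivar x, tags, .true⟩
  | asgn {K Γ p e tags q} (u : ℕ) :
      Derivable π K Γ ⟨p, e, tags, q.substVar (.loc u) .res⟩ →
      Derivable π K Γ ⟨p, .asgn u e, tags, q⟩
  | iasgn {K Γ p e tags q} (x : FieldName) :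
      Derivable π K Γ ⟨p, e, tags, q.substFld x⟩ →
      Derivable π K Γ ⟨p, .iasgn x e, tags, q⟩
  | const {K Γ} (tags : Set Tag) (p : Asrt) : Derivable π K Γ ⟨p.substRes .null, .null, tags, p⟩
  | seq {K Γ p s₁ s₂ tags r q} :
      Derivable π K Γ ⟨p, s₁, tags, r⟩ → Derivable π K Γ ⟨r, s₂, tags, q⟩ →
      Derivable π K Γ ⟨p, .seq s₁ s₂, tags, q⟩
  | cond {K Γ p e s₁ s₂ tags r q} :
      Derivable π K Γ ⟨p, e, tags, .and r (guarded .res (isBool .res))⟩ →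
      Derivable π K Γ ⟨.and r (isBoolVal .res (.boolC true)), s₁, tags, q⟩ →
      Derivable π K Γ ⟨.and r (isBoolVal .res (.boolC false)), s₂, tags, q⟩ →
      Derivable π K Γ ⟨p, .ite e s₁ s₂, tags, q⟩
  | loop {K Γ p p' e s tags} (r : Asrt) (z z' b : ℕ) :
      z ∉ K → .lvar .nat z ∉ p.free → .lvar .nat z ∉ p'.free →
      z' ≠ z → .lvar .nat z' ∉ r.free → .lvar .obj b ∉ p'.free →
      Entails tags p' tags (.ex1 .nat z r) →
      Derivable π K Γ ⟨p, e, tags, .and p' (guarded .res (isBool .res))⟩ →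
      Derivable π K Γ ⟨.and p' (isBoolVal .res (.boolC true)), s, tags, p⟩ →
      Derivable π K Γ ⟨.and (.and p' (isBoolVal .res (.boolC true))) r, .seq s e, tags,
        .and p' (decreases r z z')⟩ →
      Derivable π K Γ ⟨p, .while e s, tags, .ex1 .obj b
        (.and (p'.substRes (.lvar .obj b))
          (.and (isBoolVal (.lvar .obj b) (.boolC false)) (.eq .res .null)))⟩
  | cons {K Γ p p₁ s tags tags' q₁ q} :
      Entails tags p tags' p₁ → Derivable π K Γ ⟨p₁, s, tags', q₁⟩ → Entails tags' q₁ tags q →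
      tags ⊆ tags' → Derivable π K Γ ⟨p, s, tags, q⟩
  | block {K Γ p s tags q} (f : Var → Option Term) :
      Derivable π K Γ ⟨p, .seq (.assign (fillUndef f)) s, tags, q⟩ →
      targets (fillUndef f) ∩ q.free = ∅ →
      Derivable π K Γ ⟨p, .block f s, tags, q⟩
  | passgn {K Γ} (tags : Set Tag) (f : Var → Option Term) (g : Var → LExp (.base .obj))
      (p : Asrt) :
      (∀ v, f v = none → g v = .var v) → (∀ v t, f v = some t → t.exp = some (g v)) →
      Derivable π K Γ ⟨p.subst { var := g }, .assign f, tags, p⟩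
  | meth {K Γ p e₀ m n tags q} {args : Fin n → Stmt} (P : Fin (n + 1) → Asrt)
      (v : Fin (n + 1) → ℕ) (Cs : List ClassName) :
      e₀.Proper → (∀ i, (args i).Proper) → Function.Injective v →
      (∀ i, .var (.loc (v i)) ∉ e₀.vars ∪ q.free ∧ ∀ j, .var (.loc (v i)) ∉ (args j).vars) →
      (∀ C ∈ Cs, π C m n ≠ none) →
      Derivable π K Γ ⟨p, e₀, tags,
        .and ((P 0).substVar (.loc (v 0)) .res) (guarded .res (.isIn .res Cs))⟩ →
      (∀ i : Fin n, Derivable π K Γ ⟨P i.castSucc, args i, tags,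
        (P i.succ).substVar (.loc (v i.succ)) .res⟩) →
      Derivable π K Γ ⟨P (Fin.last n),
        .call (.var (.loc (v 0))) m n (fun i => .var (.loc (v i.succ))), tags, q⟩ →
      Derivable π K Γ ⟨p, .call e₀ m n args, tags, q⟩
  | recur {K Γ T} {k : ℕ} (c : Fin k → CallSpec) (z z' : ℕ) :
      z ∉ K → z' ≠ z →
      (∀ i, (c i).Dispatches π) →
      (∀ i, .lvar .nat z ∉ (c i).p.free ∪ (c i).q.free ∧ .lvar .nat z' ∉ (c i).r.free) →
      (∀ i, Entails (c i).tags (c i).p (c i).tags (.ex1 .nat z (c i).r)) →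
      Derivable π K (Γ ∪ Set.range fun i => (c i).assumption) T →
      (∀ i, Derivable π (insert z K) (Γ ∪ Set.range fun j => (c j).boundedAssumption z z')
        ⟨.and (c i).p (c i).r, (c i).bodyBlock, (c i).tags, (c i).q⟩) →
      Derivable π K Γ T
  | equal {K Γ} (tags : Set Tag) (v₀ v₁ : Var) :
      Derivable π K Γ ⟨.imp (.tag .typesafe) (.and (.ne (.var v₀) .undef) (.ne (.var v₁) .undef)),
        .eq (.var v₀) (.var v₁), tags, isBoolVal .res (.op2 (.eq .obj) (.var v₀) (.var v₁))⟩
  | isA {K Γ} (tags : Set Tag) (v : Var) (C : ClassName) :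
      Derivable π K Γ ⟨.imp (.tag .typesafe) (.ne (.var v) .undef), .isA (.var v) C, tags,
        .and (isBool .res) (.iff (.isIn (.var v) [C]) (.ne (.fld .res (.prog .toRef)) .null))⟩
  | cnst {K Γ p C n tags q} {args : Fin n → Stmt} :
      Derivable π K Γ ⟨p, .call (.alloc C) .init n args, tags, q⟩ →
      Derivable π K Γ ⟨p, .new C n args, tags, q⟩
  | new {K Γ} (tags : Set Tag) (C : ClassName) (p : Asrt) :
      Derivable π K Γ ⟨p.substNew C {}, .alloc C, tags, p⟩
  | disj {K Γ p r s tags q} :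
      Derivable π K Γ ⟨p, s, tags, q⟩ → Derivable π K Γ ⟨r, s, tags, q⟩ →
      Derivable π K Γ ⟨.or p r, s, tags, q⟩
  | conj {K Γ p₁ p₂ s tags tags' q₁ q₂} :
      Derivable π K Γ ⟨p₁, s, tags, q₁⟩ → Derivable π K Γ ⟨p₂, s, tags', q₂⟩ →
      (tags' \ tags) ∩ (p₁.tagsIn ∪ q₁.tagsIn) = ∅ →
      (tags \ tags') ∩ (p₂.tagsIn ∪ q₂.tagsIn) = ∅ →
      Derivable π K Γ ⟨.and p₁ p₂, s, tags ∪ tags', .and q₁ q₂⟩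
  | exInt {K Γ p s tags q} (t : BTy) (x : ℕ) :
      (t = .nat → x ∉ K) → .lvar t x ∉ q.free → Derivable π K Γ ⟨p, s, tags, q⟩ →
      Derivable π K Γ ⟨.ex1 t x p, s, tags, q⟩
  | exIntSeq {K Γ p s tags q} (t : BTy) (k : ℕ) :
      .svar t k ∉ q.free → Derivable π K Γ ⟨p, s, tags, q⟩ →
      Derivable π K Γ ⟨.exSeq t k p, s, tags, q⟩
  | inv {K Γ r s tags q} (p : Asrt) :
      p.free ∩ changed π s = ∅ → p.NoObjQuant → Derivable π K Γ ⟨r, s, tags, q⟩ →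
      Derivable π K Γ ⟨.and p r, s, tags, .and p q⟩
  | subst {K Γ p s tags q} (θ : Subst) :
      θ.res = .res →
      (∀ v, θ.var v ≠ .var v →
        .var v ∉ methodVars π ∪ s.vars ∧ (θ.var v).free ∩ changed π s = ∅) →
      (∀ t x, θ.lvar t x ≠ .lvar t x →
        (t = .nat → x ∉ K) ∧ (θ.lvar t x).free ∩ changed π s = ∅) →
      (∀ t k, θ.svar t k ≠ .svar t k → (θ.svar t k).free ∩ changed π s = ∅) →
      Derivable π K Γ ⟨p, s, tags, q⟩ →
      Derivable π K Γ ⟨p.subst θ, s, tags, q.subst θ⟩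

end Dyn

namespace Dyn

/-! ## Big-step semantics -/

-- Soundness splits into two invariants, each preserved by every rule and proved by induction on
-- derivations. `PValid` concerns terminating runs: a final state satisfies the postcondition, and a
-- type error or a failure occurs only if its tag is absent. `TValid` says that under the tag
-- `terminates` no run from the precondition diverges. The first invariant does not need the second.
-- The second needs the first, because termination of `s₁; s₂` depends on the states in which `s₁`
-- ends.
--
-- Both inductions are carried out on a compositional semantics. `Ev π N` is a big-step relation,
-- graded by the nesting depth `N` of calls, which has the same complete runs as the small steps
-- (`Ev.steps`, `Steps.exists_ev`). An infinite computation is an infinite chain of steps and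
-- descents into subexpressions, so absence of divergence is accessibility for `Succ`; this is
-- matched with the inductive predicate `Tm` (`Tm.acc`, `Tm.of_acc`). `mem_outcomes_iff` expresses
-- the tagged semantics through `Ev` and `Tm`.
--
-- Recursion is the heart of the matter. The body of a called method is evaluated one level below
-- the call, so the assumptions on calls are partially valid by strong induction on the depth,
-- whatever their bounds (`pvalid_recur`). They terminate by strong induction on the value `d` of
-- the bound, for all specifications simultaneously: the body is derived with `z` fixed to `d`, and
-- the assumptions available there only cover calls with bounds below `d` (`tvalid_recur`). Each
-- triple quantifies over its logical variables separately, so `d` has to be shared by other means: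
-- both invariants carry a valuation `κ` of the constants `K`, which all environments must respect.
-- Loops terminate by the same descent (`tvalid_loop`).
--
-- The other rules rest on a few invariance properties of evaluation: it changes only `changed π s`
-- on old objects (`Ev.frame`), keeps states consistent (`Ev.consistent`), and depends neither on
-- variables that are not accessed (`Ev.graft`, `Tm.graft`) nor on the initial result (`Ev.setRes`).
-- On the side of assertions they rest on the substitution lemma `sat_subst`, the coincidence lemma
-- `sat_congr`, and the translation of assertions across object creation, `sat_substNew`. For METH
-- the actual run is compared with a run of the call on stored results (`store_mem_states`,
-- `eval_stored`). `BoolCorrect` matters only for `==` and `is_a?`, which continue with a literal.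

def XState.map (f : State → State) : XState → XState
  | .ok σ => .ok (f σ)
  | x => x

theorem XState.IsError.map_eq {x : XState} (h : x.IsError) (f : State → State) : x.map f = x := by
  cases x <;> simp_all [XState.map, XState.IsError]

theorem XState.isError_or (x : XState) : x.IsError ∨ ∃ σ, x = .ok σ := by
  cases x <;> simp [XState.IsError]

theorem XState.map_map (f g : State → State) (x : XState) :
    (x.map f).map g = x.map fun σ => g (f σ) := by
  cases x <;> rfl

theorem XState.map_eq_ok {f : State → State} {x : XState} {τ : State} (h : x.map f = .ok τ) :
    ∃ ρ, x = .ok ρ ∧ f ρ = τ := by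
  cases x <;> simp_all [XState.map]

/-- The state in which the body of a block starts. -/
def State.enter (σ : State) (f : Var → Option Term) : State :=
  σ.setAll fun v => (fillUndef f v).map σ.term

/-- The state after a block that was entered in `σ` and whose body ends in `τ`. -/
def State.leave (f : Var → Option Term) (σ τ : State) : State :=
  τ.setAll fun v => (fillUndef f v).map fun _ => σ.loc v

/-- `First s e`: the execution of `s` starts with the execution of `e`. -/
inductive First : Stmt → Stmt → Prop
  | asgn {u e} : First (.asgn u e) e
  | iasgn {x e} : First (.iasgn x e) e
  | seq {s₁ s₂} : First (.seq s₁ s₂) s₁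
  | ite {e s₁ s₂} : First (.ite e s₁ s₂) e
  | call {e m n args} : First (.call e m n args) e
  | eq {e₀ e₁} : First (.eq e₀ e₁) e₀
  | isA {e C} : First (.isA e C) e

/-- The method `d` is found for a call with the result of `σ` as its receiver. -/
def State.Calls (π : Program) (σ : State) (m : MethName) (n : ℕ) (d : Method n) : Prop :=
  σ.res ≠ .null ∧ ∃ C, σ.fld σ.res .cls = .rep C ∧ π C m n = some d

/-- The assignment to `this` and the parameters for given values. -/
noncomputable def Method.bindVals {n : ℕ} (d : Method n) (σ : Fin (n + 1) → State) :
    Var → Option Term :=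
  d.bind (.val (σ 0).res) fun i => .val (σ i.succ).res

/-- `Ev π N s σ x`: the statement `s` leads from `σ` to `x` with at most `N` nested calls. -/
inductive Ev (π : Program) : ℕ → Stmt → State → XState → Prop
  | skip {N σ} : Ev π N .skip σ (.ok σ)
  | null {N σ} : Ev π N .null σ (.ok (σ.setRes .null))
  | var {N v σ} : σ.loc v ≠ .undef → Ev π N (.var v) σ (.ok (σ.setRes (σ.loc v)))
  | varErr {N v σ} : σ.loc v = .undef → Ev π N (.var v) σ .typeerror
  | ivar {N x σ} : σ.fld (σ.loc .this) (.prog x) ≠ .undef →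
      Ev π N (.ivar x) σ (.ok (σ.setRes (σ.fld (σ.loc .this) (.prog x))))
  | ivarErr {N x σ} : σ.fld (σ.loc .this) (.prog x) = .undef → Ev π N (.ivar x) σ .typeerror
  | asgn {N u e σ τ} : Ev π N e σ (.ok τ) → Ev π N (.asgn u e) σ (.ok (τ.setLoc (.loc u) τ.res))
  | iasgn {N y e σ τ} : Ev π N e σ (.ok τ) → (τ.loc .this).IsObj →
      Ev π N (.iasgn y e) σ (.ok (τ.setFld (τ.loc .this) (.prog y) τ.res))
  | first {N s e σ x} : First s e → Ev π N e σ x → x.IsError → Ev π N s σ x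
  | seq {N s₁ s₂ σ τ x} : Ev π N s₁ σ (.ok τ) → Ev π N s₂ τ x → Ev π N (.seq s₁ s₂) σ x
  | ite {N e s₁ s₂ σ τ x} (b : Bool) : Ev π N e σ (.ok τ) → τ.IsBoolVal τ.res b →
      Ev π N (cond b s₁ s₂) τ x → Ev π N (.ite e s₁ s₂) σ x
  | iteNull {N e s₁ s₂ σ τ} : Ev π N e σ (.ok τ) → τ.res = .null → Ev π N (.ite e s₁ s₂) σ .fail
  | iteType {N e s₁ s₂ σ τ} : Ev π N e σ (.ok τ) → τ.res ≠ .null → ¬ τ.IsBool τ.res →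
      Ev π N (.ite e s₁ s₂) σ .typeerror
  | loop {N e s σ x} : Ev π N (.ite e (.seq s (.while e s)) .null) σ x → Ev π N (.while e s) σ x
  | assign {N f σ} : Ev π N (.assign f) σ (.ok (σ.setAll fun v => (f v).map σ.term))
  | block {N f s σ y} : Ev π N s (σ.enter f) y → Ev π N (.block f s) σ (y.map (σ.leave f))
  | call {N e₀ m n args σ₀ y} {d : Method n} {σ : Fin (n + 1) → State} :
      Ev π (N + 1) e₀ σ₀ (.ok (σ 0)) → (σ 0).Calls π m n d →
      (∀ i : Fin n, Ev π (N + 1) (args i) (σ i.castSucc) (.ok (σ i.succ))) →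
      Ev π N d.body ((σ (Fin.last n)).enter (d.bindVals σ)) y →
      Ev π (N + 1) (.call e₀ m n args) σ₀ (y.map ((σ (Fin.last n)).leave (d.bindVals σ)))
  | callNull {N e₀ m n args σ₀ σ₁} : Ev π N e₀ σ₀ (.ok σ₁) → σ₁.res = .null →
      Ev π N (.call e₀ m n args) σ₀ .fail
  | callType {N e₀ m n args σ₀ σ₁ C} : Ev π N e₀ σ₀ (.ok σ₁) → σ₁.res ≠ .null →
      σ₁.fld σ₁.res .cls = .rep C → π C m n = none → Ev π N (.call e₀ m n args) σ₀ .typeerror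
  | callArgErr {N e₀ m n args σ₀ x} {d : Method n} {σ : Fin (n + 1) → State} (i : Fin n) :
      Ev π N e₀ σ₀ (.ok (σ 0)) → (σ 0).Calls π m n d →
      (∀ j : Fin n, j < i → Ev π N (args j) (σ j.castSucc) (.ok (σ j.succ))) →
      Ev π N (args i) (σ i.castSucc) x → x.IsError → Ev π N (.call e₀ m n args) σ₀ x
  | new {N C n args σ x} : Ev π N (.call (.alloc C) .init n args) σ x → Ev π N (.new C n args) σ x
  | alloc {N C σ n} : σ.Next n → Ev π N (.alloc C) σ (.ok (σ.create C n))
  | eq {N e₀ e₁ σ₀ σ₁ σ₂ x} (b : Bool) : Ev π N e₀ σ₀ (.ok σ₁) → Ev π N e₁ σ₁ (.ok σ₂) →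
      (b = true ↔ σ₁.res = σ₂.res) → Ev π N (boolLit b) σ₂ x → Ev π N (.eq e₀ e₁) σ₀ x
  | eqErrRight {N e₀ e₁ σ₀ σ₁ x} : Ev π N e₀ σ₀ (.ok σ₁) → Ev π N e₁ σ₁ x → x.IsError →
      Ev π N (.eq e₀ e₁) σ₀ x
  | isA {N e C σ σ₁ x} (b : Bool) : Ev π N e σ (.ok σ₁) →
      (b = true ↔ σ₁.fld σ₁.res .cls = .rep C) → Ev π N (boolLit b) σ₁ x → Ev π N (.isA e C) σ x

theorem Ev.mono {π : Program} {N M : ℕ} {s : Stmt} {σ : State} {x : XState} (h : Ev π N s σ x)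
    (hNM : N ≤ M) : Ev π M s σ x := by
  induction h generalizing M with
  | skip => exact .skip
  | null => exact .null
  | var h => exact .var h
  | varErr h => exact .varErr h
  | ivar h => exact .ivar h
  | ivarErr h => exact .ivarErr h
  | asgn _ ih => exact .asgn (ih hNM)
  | iasgn _ h ih => exact .iasgn (ih hNM) h
  | first h _ hx ih => exact .first h (ih hNM) hx
  | seq _ _ ih₁ ih₂ => exact .seq (ih₁ hNM) (ih₂ hNM)
  | ite b _ h _ ih₁ ih₂ => exact .ite b (ih₁ hNM) h (ih₂ hNM)
  | iteNull _ h ih => exact .iteNull (ih hNM) h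
  | iteType _ h h' ih => exact .iteType (ih hNM) h h'
  | loop _ ih => exact .loop (ih hNM)
  | assign => exact .assign
  | block _ ih => exact .block (ih hNM)
  | call _ h _ _ ih₁ ih₂ ih₃ =>
    obtain ⟨M, rfl⟩ : ∃ M', M = M' + 1 := ⟨M - 1, by omega⟩
    exact .call (ih₁ hNM) h (fun i => ih₂ i hNM) (ih₃ (by omega))
  | callNull _ h ih => exact .callNull (ih hNM) h
  | callType _ h h' h'' ih => exact .callType (ih hNM) h h' h''
  | callArgErr i _ h _ _ hx ih₁ ih₂ ih₃ =>
    exact .callArgErr i (ih₁ hNM) h (fun j hj => ih₂ j hj hNM) (ih₃ hNM) hx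
  | new _ ih => exact .new (ih hNM)
  | alloc h => exact .alloc h
  | eq b _ _ h _ ih₁ ih₂ ih₃ => exact .eq b (ih₁ hNM) (ih₂ hNM) h (ih₃ hNM)
  | eqErrRight _ _ hx ih₁ ih₂ => exact .eqErrRight (ih₁ hNM) (ih₂ hNM) hx
  | isA b _ h _ ih₁ ih₂ => exact .isA b (ih₁ hNM) h (ih₂ hNM)

/-! ### From big steps to small steps -/

theorem Steps.one {π : Program} {c c' : Conf} (h : Step π c c') : Steps π c c' := .head h .refl

theorem Step.exists_ok {π : Program} {c c' : Conf} (h : Step π c c') : ∃ σ, c.2 = .ok σ := by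
  cases h <;> exact ⟨_, rfl⟩

theorem Steps.eq_of_isError {π : Program} {c c' : Conf} (h : Steps π c c') (hc : c.2.IsError) :
    c' = c := by
  cases h with
  | refl => rfl
  | head h _ =>
    obtain ⟨σ, hσ⟩ := h.exists_ok
    exact absurd hσ (hc σ)

theorem Steps.trans {π : Program} : ∀ {c c' c'' : Conf}, Steps π c c' → Steps π c' c'' →
    Steps π c c''
  | _, _, _, .refl, h => h
  | _, _, _, .head h₁ h₂, h => .head h₁ (h₂.trans h)

/-- Giving `Step` a trivial motive in the mutual recursor leaves ordinary head induction towards a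
fixed final configuration. -/
theorem Steps.ind {π : Program} {c'' : Conf} {motive : Conf → Prop} (refl : motive c'')
    (head : ∀ c c', Step π c c' → Steps π c' c'' → motive c' → motive c) {c : Conf}
    (h : Steps π c c'') : motive c := by
  have aux : ∀ {c d}, Steps π c d → d = c'' → motive c := by
    intro c d h
    induction h using Steps.rec (motive_1 := fun _ _ _ => True) with
    | refl => rintro rfl; exact refl
    | head h₁ h₂ _ ih => rintro rfl; exact head _ _ h₁ h₂ (ih rfl)
    | _ => trivial
  exact aux h rfl

theorem Steps.seq {π : Program} (s : Stmt) {σ τ : State} {s₁ s₂ : Stmt}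
    (h : Steps π (s₁, .ok σ) (s₂, .ok τ)) : Steps π (.seq s₁ s, .ok σ) (.seq s₂ s, .ok τ) := by
  refine Steps.ind (motive := fun c => ∀ σ, c.2 = .ok σ →
    Steps π (.seq c.1 s, .ok σ) (.seq s₂ s, .ok τ)) ?_ ?_ h σ rfl
  · rintro _ ⟨⟩
    exact .refl
  · rintro ⟨s₁, _⟩ ⟨s', x⟩ h₁ h₂ ih σ ⟨⟩
    rcases x.isError_or with hx | ⟨ρ, rfl⟩
    -- An error configuration has no successor, so no run leads from it to a proper state.
    · exact absurd (congrArg Prod.snd (h₂.eq_of_isError hx)) (fun h => hx τ h.symm)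
    · exact .head (.seq h₁) (ih _ rfl)

theorem Steps.seq_error {π : Program} (s : Stmt) {σ : State} {x : XState} {s₁ : Stmt}
    (h : Steps π (s₁, .ok σ) (.skip, x)) (hx : x.IsError) :
    Steps π (.seq s₁ s, .ok σ) (.skip, x) := by
  refine Steps.ind (motive := fun c => ∀ σ, c.2 = .ok σ →
    Steps π (.seq c.1 s, .ok σ) (.skip, x)) ?_ ?_ h σ rfl
  · intro σ h
    exact absurd h (hx σ)
  · rintro ⟨s₁, _⟩ ⟨s', y⟩ h₁ h₂ ih σ ⟨⟩
    rcases y.isError_or with hy | ⟨ρ, rfl⟩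
    · cases h₂.eq_of_isError hy
      exact .one (.seqErr h₁ hx)
    · exact .head (.seq h₁) (ih _ rfl)

theorem Steps.seq_ok {π : Program} {s₁ s₂ : Stmt} {σ τ : State} {c : Conf}
    (h₁ : Steps π (s₁, .ok σ) (.skip, .ok τ)) (h₂ : Steps π (s₂, .ok τ) c) :
    Steps π (.seq s₁ s₂, .ok σ) c :=
  (h₁.seq s₂).trans (.head .seqSkip h₂)

/-- After a normal end of the body the restoring assignment is executed; an error skips it.
`XState.map` covers both cases. -/
theorem Steps.block {π : Program} {f : Var → Option Term} {s : Stmt} {σ : State} {y : XState}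
    (h : Steps π (s, .ok (σ.enter f)) (.skip, y)) :
    Steps π (.block f s, .ok σ) (.skip, y.map (σ.leave f)) := by
  refine .head .block (.seq_ok (.one .assign) ?_)
  rcases y.isError_or with hy | ⟨τ, rfl⟩
  · rw [hy.map_eq]
    exact h.seq_error _ hy
  · have := Step.assign (π := π) (f := σ.restore f) (σ := τ)
    simp only [State.restore, Option.map_map] at this
    exact .seq_ok h (.one this)

theorem Ev.steps {π : Program} {N : ℕ} {s : Stmt} {σ : State} {x : XState} (h : Ev π N s σ x) :
    Steps π (s, .ok σ) (.skip, x) := by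
  induction h with
  | skip => exact .refl
  | null => exact .one .null
  | var h => exact .one (.var h)
  | varErr h => exact .one (.varErr h)
  | ivar h => exact .one (.ivar h)
  | ivarErr h => exact .one (.ivarErr h)
  | asgn _ ih => exact .one (.asgn ih)
  | iasgn _ h ih => exact .one (.iasgn ih h)
  | first h _ hx ih =>
    cases h with
    | asgn => exact .one (.asgnErr ih hx)
    | iasgn => exact .one (.iasgnErr ih hx)
    | seq => exact ih.seq_error _ hx
    | ite => exact .one (.iteErr ih hx)
    | call => exact .one (.callErr ih hx)
    | eq => exact .one (.eqErrLeft ih hx)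
    | isA => exact .one (.isAErr ih hx)
  | seq _ _ ih₁ ih₂ => exact ih₁.seq_ok ih₂
  | ite b _ h _ ih₁ ih₂ =>
    cases b
    · exact .head (.iteFalse ih₁ h) ih₂
    · exact .head (.iteTrue ih₁ h) ih₂
  | iteNull _ h ih => exact .one (.iteNull ih h)
  | iteType _ h h' ih => exact .one (.iteType ih h h')
  | loop _ ih => exact .head .while ih
  | assign => exact .one .assign
  | block _ ih => exact ih.block
  | call _ h _ _ ih₁ ih₂ ih₃ =>
    obtain ⟨h, C, hC, hd⟩ := h
    exact .head (.call ih₁ h hC hd ih₂) ih₃.block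
  | callNull _ h ih => exact .one (.callNull ih h)
  | callType _ h h' h'' ih => exact .one (.callType ih h h' h'')
  | callArgErr i _ h _ _ hx ih₁ ih₂ ih₃ =>
    obtain ⟨h, C, hC, hd⟩ := h
    exact .one (.callArgErr i ih₁ h hC hd ih₂ ih₃ hx)
  | new _ ih => exact .head .new ih
  | alloc h => exact .one (.alloc h)
  | eq b _ _ h _ ih₁ ih₂ ih₃ => exact .head (.eq ih₁ ih₂ h) ih₃
  | eqErrRight _ _ hx ih₁ ih₂ => exact .one (.eqErrRight ih₁ ih₂ hx)
  | isA b _ h _ ih₁ ih₂ => exact .head (.isA ih₁ h) ih₂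

/-! ### From small steps to big steps -/

theorem Ev.seq_inv {π : Program} {N : ℕ} {s₁ s₂ : Stmt} {σ : State} {x : XState}
    (h : Ev π N (.seq s₁ s₂) σ x) :
    (∃ τ, Ev π N s₁ σ (.ok τ) ∧ Ev π N s₂ τ x) ∨ (Ev π N s₁ σ x ∧ x.IsError) := by
  cases h with
  | seq h₁ h₂ => exact .inl ⟨_, h₁, h₂⟩
  | first h h' hx => cases h; exact .inr ⟨h', hx⟩

theorem Ev.assign_inv {π : Program} {N : ℕ} {f : Var → Option Term} {σ : State} {x : XState}
    (h : Ev π N (.assign f) σ x) : x = .ok (σ.setAll fun v => (f v).map σ.term) := by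
  cases h with
  | assign => rfl
  | first h => cases h

theorem Ev.block_inv {π : Program} {N : ℕ} {f : Var → Option Term} {s : Stmt} {σ : State}
    {x : XState} (h : Ev π N (.block f s) σ x) :
    ∃ y, Ev π N s (σ.enter f) y ∧ x = y.map (σ.leave f) := by
  cases h with
  | block h => exact ⟨_, h, rfl⟩
  | first h => cases h

/-- Small steps unfold a block into assignment, body and restoring assignment, while `Ev` treats it
in one rule; inversion of the three parts closes the gap. -/
theorem Ev.block_of_seq {π : Program} {N : ℕ} {f : Var → Option Term} {s : Stmt} {σ : State}
    {x : XState} (h : Ev π N (.seq (.assign (fillUndef f)) (.seq s (.assign (σ.restore f)))) σ x) :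
    Ev π N (.block f s) σ x := by
  rcases h.seq_inv with ⟨τ, h₁, h₂⟩ | ⟨h₁, hx⟩
  · cases h₁.assign_inv
    rcases h₂.seq_inv with ⟨τ, h₁, h₂⟩ | ⟨h₁, hx⟩
    · have := h₂.assign_inv
      simp only [State.restore, Option.map_map] at this
      subst this
      exact .block h₁
    · rw [← hx.map_eq (σ.leave f)]
      exact .block h₁
  · exact absurd h₁.assign_inv (hx _)

/-- Finitely many depth bounds have a maximum. The predicate `P` selects the arguments that are
really evaluated, namely those before an erroneous one. -/
theorem Ev.exists_uniform {π : Program} {n : ℕ} {P : Fin n → Prop} {s : Fin n → Stmt}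
    {σ : Fin n → State} {x : Fin n → XState} (h : ∀ i, P i → ∃ N, Ev π N (s i) (σ i) (x i)) :
    ∃ N, ∀ i, P i → Ev π N (s i) (σ i) (x i) := by
  have h' : ∀ i, ∃ N, P i → Ev π N (s i) (σ i) (x i) := fun i => by
    by_cases hi : P i
    · obtain ⟨N, h⟩ := h i hi
      exact ⟨N, fun _ => h⟩
    · exact ⟨0, fun h => absurd h hi⟩
  choose N hN using h'
  exact ⟨Finset.univ.sup N, fun i hi => (hN i hi).mono (Finset.le_sup (Finset.mem_univ i))⟩

theorem Ev.exists_common {π : Program} {s₁ s₂ : Stmt} {σ₁ σ₂ : State} {x₁ x₂ : XState}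
    (h₁ : ∃ N, Ev π N s₁ σ₁ x₁) (h₂ : ∃ N, Ev π N s₂ σ₂ x₂) :
    ∃ N, Ev π N s₁ σ₁ x₁ ∧ Ev π N s₂ σ₂ x₂ := by
  obtain ⟨N₁, h₁⟩ := h₁
  obtain ⟨N₂, h₂⟩ := h₂
  exact ⟨max N₁ N₂, h₁.mono (le_max_left _ _), h₂.mono (le_max_right _ _)⟩

theorem Ev.skip_inv {π : Program} {N : ℕ} {σ : State} {x : XState} (h : Ev π N .skip σ x) :
    x = .ok σ := by
  cases h with
  | skip => rfl
  | first h => cases h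

/-- What a step contributes to the big-step semantics. -/
def StepSound (π : Program) (c c' : Conf) : Prop :=
  ∀ σ, c.2 = .ok σ → (c'.2.IsError → ∃ N, Ev π N c.1 σ c'.2) ∧
    (∀ τ, c'.2 = .ok τ → ∀ N x, Ev π N c'.1 τ x → ∃ M, Ev π M c.1 σ x)

theorem StepSound.of_error {π : Program} {s s' : Stmt} {σ : State} {x : XState} (hx : x.IsError)
    (h : ∃ N, Ev π N s σ x) : StepSound π (s, .ok σ) (s', x) := by
  rintro _ ⟨⟩
  exact ⟨fun _ => h, fun τ hτ => absurd hτ (hx τ)⟩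

theorem StepSound.of_ok {π : Program} {s s' : Stmt} {σ τ : State}
    (h : ∀ N x, Ev π N s' τ x → ∃ M, Ev π M s σ x) : StepSound π (s, .ok σ) (s', .ok τ) := by
  rintro _ ⟨⟩
  refine ⟨fun h => absurd rfl (h _), ?_⟩
  rintro _ ⟨⟩
  exact h

theorem StepSound.of_skip {π : Program} {s : Stmt} {σ τ : State}
    (h : ∃ N, Ev π N s σ (.ok τ)) : StepSound π (s, .ok σ) (.skip, .ok τ) :=
  .of_ok fun N x h' => by cases h'.skip_inv; exact h

/-- Big-step outcomes are closed under going back along a step (`StepSound`). The premises of a step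
are themselves complete runs, so both claims are proved in one mutual induction. -/
theorem Steps.exists_ev_aux {π : Program} {c c' : Conf} (h : Steps π c c') :
    ∀ σ, c.2 = .ok σ → c'.1 = .skip → ∃ N, Ev π N c.1 σ c'.2 := by
  induction h using Steps.rec (motive_1 := fun c c' _ => StepSound π c c') with
  | null => exact .of_skip ⟨0, .null⟩
  | var h => exact .of_skip ⟨0, .var h⟩
  | varErr h => exact .of_error (by rintro _ ⟨⟩) ⟨0, .varErr h⟩
  | ivar h => exact .of_skip ⟨0, .ivar h⟩
  | ivarErr h => exact .of_error (by rintro _ ⟨⟩) ⟨0, .ivarErr h⟩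
  | asgn _ ih =>
    obtain ⟨N, h⟩ := ih _ rfl rfl
    exact .of_skip ⟨N, .asgn h⟩
  | iasgn _ h ih =>
    obtain ⟨N, h'⟩ := ih _ rfl rfl
    exact .of_skip ⟨N, .iasgn h' h⟩
  | asgnErr _ hx ih | iasgnErr _ hx ih | iteErr _ hx ih | callErr _ hx ih | eqErrLeft _ hx ih
  | isAErr _ hx ih =>
    obtain ⟨N, h⟩ := ih _ rfl rfl
    exact .of_error hx ⟨N, .first (by constructor) h hx⟩
  | seq _ ih =>
    refine .of_ok fun N x h => ?_
    rcases h.seq_inv with ⟨τ, h₁, h₂⟩ | ⟨h, hx⟩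
    · obtain ⟨M, h₁, h₂⟩ := Ev.exists_common ((ih _ rfl).2 _ rfl _ _ h₁) ⟨_, h₂⟩
      exact ⟨M, .seq h₁ h₂⟩
    · obtain ⟨M, h⟩ := (ih _ rfl).2 _ rfl _ _ h
      exact ⟨M, .first .seq h hx⟩
  | seqErr _ hx ih =>
    obtain ⟨N, h⟩ := (ih _ rfl).1 hx
    exact .of_error hx ⟨N, .first .seq h hx⟩
  | seqSkip => exact .of_ok fun N x h => ⟨N, .seq .skip h⟩
  | iteTrue _ h ih =>
    refine .of_ok fun N x h' => ?_
    obtain ⟨M, h₁, h₂⟩ := Ev.exists_common (ih _ rfl rfl) ⟨_, h'⟩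
    exact ⟨M, .ite true h₁ h h₂⟩
  | iteFalse _ h ih =>
    refine .of_ok fun N x h' => ?_
    obtain ⟨M, h₁, h₂⟩ := Ev.exists_common (ih _ rfl rfl) ⟨_, h'⟩
    exact ⟨M, .ite false h₁ h h₂⟩
  | iteNull _ h ih =>
    obtain ⟨N, h'⟩ := ih _ rfl rfl
    exact .of_error (by rintro _ ⟨⟩) ⟨N, .iteNull h' h⟩
  | iteType _ h h' ih =>
    obtain ⟨N, h''⟩ := ih _ rfl rfl
    exact .of_error (by rintro _ ⟨⟩) ⟨N, .iteType h'' h h'⟩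
  | assign => exact .of_skip ⟨0, .assign⟩
  | block => exact .of_ok fun N x h => ⟨N, h.block_of_seq⟩
  | @call e₀ m n args σ₀ C d σ _ h hC hd _ ih₁ ih₂ =>
    refine .of_ok fun N x h' => ?_
    obtain ⟨y, hb, rfl⟩ := h'.block_inv
    obtain ⟨N₁, h₁⟩ := ih₁ _ rfl rfl
    obtain ⟨N₂, h₂⟩ := Ev.exists_uniform (P := fun _ => True) fun i _ => ih₂ i _ rfl rfl
    -- Receiver and arguments are evaluated at the successor of this depth, the body at the depth
    -- itself.
    exact ⟨_, .call (N := max N (max N₁ N₂)) (h₁.mono (by omega)) ⟨h, _, hC, hd⟩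
      (fun i => (h₂ i trivial).mono (by omega)) (hb.mono (by omega))⟩
  | callNull _ h ih =>
    obtain ⟨N, h'⟩ := ih _ rfl rfl
    exact .of_error (by rintro _ ⟨⟩) ⟨N, .callNull h' h⟩
  | callType _ h h' h'' ih =>
    obtain ⟨N, h₁⟩ := ih _ rfl rfl
    exact .of_error (by rintro _ ⟨⟩) ⟨N, .callType h₁ h h' h''⟩
  | callArgErr i _ h hC hd _ _ hx ih₁ ih₂ ih₃ =>
    obtain ⟨N₁, h₁⟩ := ih₁ _ rfl rfl
    obtain ⟨N₂, h₂⟩ := Ev.exists_uniform fun j hj => ih₂ j hj _ rfl rfl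
    obtain ⟨N₃, h₃⟩ := ih₃ _ rfl rfl
    exact .of_error hx ⟨max N₁ (max N₂ N₃), .callArgErr i (h₁.mono (by omega)) ⟨h, _, hC, hd⟩
      (fun j hj => (h₂ j hj).mono (by omega)) (h₃.mono (by omega)) hx⟩
  | new => exact .of_ok fun N x h => ⟨N, .new h⟩
  | alloc h => exact .of_skip ⟨0, .alloc h⟩
  | eq _ _ h ih₁ ih₂ =>
    refine .of_ok fun N x h' => ?_
    obtain ⟨M₁, h₁, h₂⟩ := Ev.exists_common (ih₁ _ rfl rfl) (ih₂ _ rfl rfl)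
    exact ⟨max N M₁, .eq _ (h₁.mono (by omega)) (h₂.mono (by omega)) h (h'.mono (by omega))⟩
  | eqErrRight _ _ hx ih₁ ih₂ =>
    obtain ⟨M, h₁, h₂⟩ := Ev.exists_common (ih₁ _ rfl rfl) (ih₂ _ rfl rfl)
    exact .of_error hx ⟨M, .eqErrRight h₁ h₂ hx⟩
  | isA _ h ih =>
    refine .of_ok fun N x h' => ?_
    obtain ⟨M, h₁, h₂⟩ := Ev.exists_common (ih _ rfl rfl) ⟨_, h'⟩
    exact ⟨M, .isA _ h₁ h h₂⟩
  | @refl c =>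
    rintro σ h h'
    obtain ⟨s, x⟩ := c
    cases h
    cases h'
    exact ⟨0, .skip⟩
  | @head c c₁ c₂ h₁ h₂ ih₁ ih₂ =>
    intro σ h h'
    rcases c₁.2.isError_or with hx | ⟨ρ, hρ⟩
    · cases h₂.eq_of_isError hx
      exact (ih₁ σ h).1 hx
    · obtain ⟨N, hN⟩ := ih₂ ρ hρ h'
      exact (ih₁ σ h).2 ρ hρ N _ hN
  -- Only the unfolding of a loop is left.
  | _ => exact .of_ok fun N x h => ⟨N, .loop h⟩

theorem Steps.exists_ev {π : Program} {s : Stmt} {σ : State} {x : XState}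
    (h : Steps π (s, .ok σ) (.skip, x)) : ∃ N, Ev π N s σ x :=
  h.exists_ev_aux σ rfl rfl

/-! ## Termination -/

/-- `c'` is reached from `c` by a step or by descending into a subexpression. -/
def Succ (π : Program) (c' c : Conf) : Prop := Step π c c' ∨ Descend π c c'

/-- `Tm π s σ`: the statement `s` does not diverge from `σ`. -/
inductive Tm (π : Program) : Stmt → State → Prop
  | skip {σ} : Tm π .skip σ
  | null {σ} : Tm π .null σ
  | var {v σ} : Tm π (.var v) σ
  | ivar {x σ} : Tm π (.ivar x) σ
  | alloc {C σ} : Tm π (.alloc C) σ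
  | assign {f σ} : Tm π (.assign f) σ
  | asgn {u e σ} : Tm π e σ → Tm π (.asgn u e) σ
  | iasgn {x e σ} : Tm π e σ → Tm π (.iasgn x e) σ
  | seq {s₁ s₂ σ} : Tm π s₁ σ → (∀ N τ, Ev π N s₁ σ (.ok τ) → Tm π s₂ τ) → Tm π (.seq s₁ s₂) σ
  | ite {e s₁ s₂ σ} : Tm π e σ →
      (∀ N τ b, Ev π N e σ (.ok τ) → τ.IsBoolVal τ.res b → Tm π (cond b s₁ s₂) τ) →
      Tm π (.ite e s₁ s₂) σ
  | loop {e s σ} : Tm π (.ite e (.seq s (.while e s)) .null) σ → Tm π (.while e s) σ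
  | block {f s σ} : Tm π s (σ.enter f) → Tm π (.block f s) σ
  | call {e₀ m n args σ₀} : Tm π e₀ σ₀ →
      (∀ N (d : Method n) (σ : Fin (n + 1) → State) (i : Fin n), Ev π N e₀ σ₀ (.ok (σ 0)) →
        (σ 0).Calls π m n d → (∀ j < i, Ev π N (args j) (σ j.castSucc) (.ok (σ j.succ))) →
        Tm π (args i) (σ i.castSucc)) →
      (∀ N (d : Method n) (σ : Fin (n + 1) → State), Ev π N e₀ σ₀ (.ok (σ 0)) →
        (σ 0).Calls π m n d → (∀ j, Ev π N (args j) (σ j.castSucc) (.ok (σ j.succ))) →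
        Tm π d.body ((σ (Fin.last n)).enter (d.bindVals σ))) →
      Tm π (.call e₀ m n args) σ₀
  | new {C n args σ} : Tm π (.call (.alloc C) .init n args) σ → Tm π (.new C n args) σ
  | eq {e₀ e₁ σ} : Tm π e₀ σ → (∀ N τ, Ev π N e₀ σ (.ok τ) → Tm π e₁ τ) →
      (∀ N τ ρ (b : Bool), Ev π N e₀ σ (.ok τ) → Ev π N e₁ τ (.ok ρ) →
        (b = true ↔ τ.res = ρ.res) → Tm π (boolLit b) ρ) → Tm π (.eq e₀ e₁) σ
  | isA {e C σ} : Tm π e σ → (∀ N τ (b : Bool), Ev π N e σ (.ok τ) →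
      (b = true ↔ τ.fld τ.res .cls = .rep C) → Tm π (boolLit b) τ) → Tm π (.isA e C) σ

theorem Succ.acc_skip {π : Program} (x : XState) : Acc (Succ π) (.skip, x) :=
  .intro _ fun c h => by rcases h with h | h <;> cases h

/-- The moves of a sequence are those of its first component until that has become `skip`, and then
those of the second. Hence the induction is on the accessibility of the first component, and the
second is only needed for states that the first one reaches. -/
theorem Succ.acc_seq {π : Program} {s₁ s₂ : Stmt} {σ : State} (h : Acc (Succ π) (s₁, .ok σ))
    (h₂ : ∀ τ, Steps π (s₁, .ok σ) (.skip, .ok τ) → Acc (Succ π) (s₂, .ok τ)) :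
    Acc (Succ π) (.seq s₁ s₂, .ok σ) := by
  have aux : ∀ c, Acc (Succ π) c → ∀ s₁ σ, c = (s₁, .ok σ) →
      (∀ τ, Steps π (s₁, .ok σ) (.skip, .ok τ) → Acc (Succ π) (s₂, .ok τ)) →
      Acc (Succ π) (.seq s₁ s₂, .ok σ) := by
    intro c hc
    induction hc with
    | intro c hc ih =>
      rintro s₁ σ rfl h₂
      refine .intro _ fun c' h => ?_
      rcases h with h | h
      · cases h with
        | seq h => exact ih _ (.inl h) _ _ rfl fun τ h' => h₂ τ (.head h h')
        | seqErr => exact acc_skip _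
        | seqSkip => exact h₂ σ .refl
      · cases h
        exact .intro _ hc
  exact aux _ h _ _ rfl h₂

theorem Succ.acc_block {π : Program} {f : Var → Option Term} {s : Stmt} {σ : State}
    (hs : Acc (Succ π) (s, .ok (σ.enter f))) : Acc (Succ π) (.block f s, .ok σ) := by
  refine .intro _ fun c h => ?_
  rcases h with h | h <;> cases h
  refine acc_seq (.intro _ fun c h => ?_) fun τ h => ?_
  · rcases h with h | h <;> cases h
    exact acc_skip _
  · obtain ⟨N, h⟩ := h.exists_ev
    cases h.assign_inv
    refine acc_seq hs fun τ h => .intro _ fun c h => ?_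
    rcases h with h | h <;> cases h
    exact acc_skip _

/-- Each successor of a configuration matches a premise of the corresponding `Tm` rule, once the
complete runs in the premises of the step are turned into big steps. Loops need no extra argument,
as their unfolding is a subderivation. -/
theorem Tm.acc {π : Program} {s : Stmt} {σ : State} (h : Tm π s σ) :
    Acc (Succ π) (s, .ok σ) := by
  induction h with
  | skip => exact Succ.acc_skip _
  | null | var | ivar | alloc | assign =>
    refine .intro _ fun c h => ?_
    rcases h with h | h <;> cases h <;> exact Succ.acc_skip _
  | asgn _ ih | iasgn _ ih =>
    refine .intro _ fun c h => ?_
    rcases h with h | h <;> cases h <;> first | exact Succ.acc_skip _ | exact ih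
  | seq _ _ ih₁ ih₂ =>
    refine Succ.acc_seq ih₁ fun τ h => ?_
    obtain ⟨N, h⟩ := h.exists_ev
    exact ih₂ N τ h
  | ite _ _ ih₁ ih₂ =>
    refine .intro _ fun c h => ?_
    rcases h with h | h
    · cases h with
      | iteTrue h h' =>
        obtain ⟨N, h⟩ := h.exists_ev
        exact ih₂ N _ true h h'
      | iteFalse h h' =>
        obtain ⟨N, h⟩ := h.exists_ev
        exact ih₂ N _ false h h'
      | _ => exact Succ.acc_skip _
    · cases h
      exact ih₁
  | loop _ ih =>
    refine .intro _ fun c h => ?_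
    rcases h with h | h <;> cases h
    exact ih
  | block _ ih => exact Succ.acc_block ih
  | call _ _ _ ih₁ ih₂ ih₃ =>
    refine .intro _ fun c h => ?_
    rcases h with h | h
    · cases h with
      | call h₁ h hC hd h₂ =>
        obtain ⟨N₁, h₁⟩ := h₁.exists_ev
        obtain ⟨N₂, h₂⟩ := Ev.exists_uniform (P := fun _ => True) fun i _ => (h₂ i).exists_ev
        exact Succ.acc_block (ih₃ (max N₁ N₂) _ _ (h₁.mono (by omega)) ⟨h, _, hC, hd⟩
          fun i => (h₂ i trivial).mono (by omega))
      | _ => exact Succ.acc_skip _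
    · cases h with
      | callRecv => exact ih₁
      | callArg i h₁ h hC hd h₂ =>
        obtain ⟨N₁, h₁⟩ := h₁.exists_ev
        obtain ⟨N₂, h₂⟩ := Ev.exists_uniform fun i hi => (h₂ i hi).exists_ev
        exact ih₂ (max N₁ N₂) _ _ i (h₁.mono (by omega)) ⟨h, _, hC, hd⟩
          fun j hj => (h₂ j hj).mono (by omega)
  | new _ ih =>
    refine .intro _ fun c h => ?_
    rcases h with h | h <;> cases h
    exact ih
  | eq _ _ _ ih₁ ih₂ ih₃ =>
    refine .intro _ fun c h => ?_
    rcases h with h | h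
    · cases h with
      | eq h₁ h₂ h =>
        obtain ⟨N, h₁, h₂⟩ := Ev.exists_common h₁.exists_ev h₂.exists_ev
        exact ih₃ N _ _ _ h₁ h₂ h
      | _ => exact Succ.acc_skip _
    · cases h with
      | eqLeft => exact ih₁
      | eqRight h =>
        obtain ⟨N, h⟩ := h.exists_ev
        exact ih₂ N _ h
  | isA _ _ ih₁ ih₂ =>
    refine .intro _ fun c h => ?_
    rcases h with h | h
    · cases h with
      | isA h h' =>
        obtain ⟨N, h⟩ := h.exists_ev
        exact ih₂ N _ _ h h'
      | _ => exact Succ.acc_skip _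
    · cases h
      exact ih₁

theorem Steps.reflTransGen {π : Program} {c c' : Conf} (h : Steps π c c') :
    Relation.ReflTransGen (Succ π) c' c :=
  h.ind .refl fun _ _ h _ ih => .tail ih (.inl h)

/-- The induction uses the transitive closure of `Succ`, because the premises of `Tm` for a sequence
or a method body concern configurations that are several moves away. -/
theorem Tm.of_acc {π : Program} {s : Stmt} {σ : State} (h : Acc (Succ π) (s, .ok σ)) :
    Tm π s σ := by
  have aux : ∀ c, Acc (Relation.TransGen (Succ π)) c → ∀ s σ, c = (s, .ok σ) → Tm π s σ := by
    intro c hc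
    induction hc with
    | intro c _ ih =>
      rintro s σ rfl
      have desc : ∀ {e τ}, Descend π (s, .ok σ) (e, .ok τ) → Tm π e τ := fun h =>
        ih _ (.single (.inr h)) _ _ rfl
      have step : ∀ {e τ}, Step π (s, .ok σ) (e, .ok τ) → Tm π e τ := fun h =>
        ih _ (.single (.inl h)) _ _ rfl
      have steps : ∀ {s' e τ ρ}, Step π (s, .ok σ) (s', .ok ρ) →
          Steps π (s', .ok ρ) (e, .ok τ) → Tm π e τ := fun h h' =>
        ih _ (.tail' h'.reflTransGen (.inl h)) _ _ rfl
      -- This reaches the body of a block: a step, the initialising assignment, and a descent into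
      -- the first part of the remaining sequence.
      have inner : ∀ {s' t e τ υ ρ}, Step π (s, .ok σ) (s', .ok ρ) →
          Steps π (s', .ok ρ) (t, .ok υ) → Descend π (t, .ok υ) (e, .ok τ) → Tm π e τ :=
        fun h h' h'' => ih _ (.head (.inr h'') (.tail' h'.reflTransGen (.inl h))) _ _ rfl
      cases s with
      | skip => exact .skip
      | null => exact .null
      | var => exact .var
      | ivar => exact .ivar
      | alloc => exact .alloc
      | assign => exact .assign
      | asgn => exact .asgn (desc .asgn)
      | iasgn => exact .iasgn (desc .iasgn)
      | seq s₁ s₂ =>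
        refine .seq (desc .seq) fun N τ h => ?_
        have h' : Steps π (.seq s₁ s₂, .ok σ) (s₂, .ok τ) := h.steps.seq_ok .refl
        -- The run has at least one step because `s₂` is a proper part of `.seq s₁ s₂`; the
        -- transitive closure requires this.
        cases h' with
        | head h₁ h₂ =>
          rename_i c
          obtain ⟨s', x⟩ := c
          rcases x.isError_or with hx | ⟨ρ, rfl⟩
          · exact absurd (congrArg Prod.snd (h₂.eq_of_isError hx)) fun h => hx τ h.symm
          · exact steps h₁ h₂
      | ite =>
        refine .ite (desc .ite) fun N τ b h h' => ?_
        cases b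
        · exact step (.iteFalse h.steps h')
        · exact step (.iteTrue h.steps h')
      | eq =>
        exact .eq (desc .eqLeft) (fun N τ h => desc (.eqRight h.steps))
          fun N τ ρ b h₁ h₂ h => step (.eq h₁.steps h₂.steps h)
      | isA =>
        exact .isA (desc .isA) fun N τ b h h' => step (.isA h.steps h')
      | call =>
        refine .call (desc .callRecv) (fun N d σ i h₁ h h₂ => ?_) fun N d σ h₁ h h₂ => ?_
        · obtain ⟨h, C, hC, hd⟩ := h
          exact desc (.callArg i h₁.steps h hC hd fun j hj => (h₂ j hj).steps)
        · obtain ⟨h, C, hC, hd⟩ := h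
          exact inner (.call h₁.steps h hC hd fun j => (h₂ j).steps)
            (.head .block (.seq_ok (.one .assign) .refl)) .seq
      | new => exact .new (step .new)
      | block => exact .block (inner .block (.seq_ok (.one .assign) .refl) .seq)
      | _ => exact .loop (step .while)
  exact aux _ h.transGen _ _ rfl

/-! ## Computations -/

theorem Steps.exists_comp {π : Program} {c c' : Conf} (h : Steps π c c') :
    ∃ (n : ℕ) (f : ℕ → Conf), f 0 = c ∧ f n = c' ∧ ∀ i < n, Step π (f i) (f (i + 1)) := by
  refine Steps.ind (motive := fun c => ∃ (n : ℕ) (f : ℕ → Conf), f 0 = c ∧ f n = c' ∧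
    ∀ i < n, Step π (f i) (f (i + 1))) ⟨0, fun _ => c', rfl, rfl, by simp⟩ ?_ h
  rintro c c₁ h₁ - ⟨n, f, h0, hn, hf⟩
  refine ⟨n + 1, fun | 0 => c | i + 1 => f i, rfl, hn, ?_⟩
  rintro (_ | i) hi
  · simpa [h0] using h₁
  · exact hf i (by omega)

theorem steps_of_comp {π : Program} {f : ℕ → Conf} : ∀ {n : ℕ},
    (∀ i < n, Step π (f i) (f (i + 1))) → Steps π (f 0) (f n)
  | 0, _ => .refl
  | n + 1, h => (steps_of_comp fun i hi => h i (by omega)).trans (.one (h n (by omega)))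

/-- The outcomes of a statement in terms of the big-step semantics. -/
theorem mem_outcomes_iff {π : Program} {tags : Set Tag} {s : Stmt} {σ : State} {x : XState} :
    x ∈ outcomes π tags s σ ↔
      ((∃ N, Ev π N s σ x) ∧ ((∃ τ, x = .ok τ) ∨ (x = .typeerror ∧ .typesafe ∈ tags) ∨
        (x = .fail ∧ .failsafe ∈ tags))) ∨ (x = .bot ∧ .terminates ∈ tags ∧ ¬ Tm π s σ) := by
  constructor
  · rintro ⟨ρ, hρ, h⟩
    cases ρ with
    | fin n f =>
      have hs : ∀ y, f n = (.skip, y) → ∃ N, Ev π N s σ y := fun y hy => by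
        have := steps_of_comp hρ.2
        rw [hρ.1, hy] at this
        exact this.exists_ev
      rcases h with ⟨τ, rfl, h⟩ | ⟨t, ht, h⟩
      · exact .inl ⟨hs _ h, .inl ⟨τ, rfl⟩⟩
      · cases t with
        | terminates => exact h.elim
        | typesafe =>
          obtain ⟨rfl, h⟩ := h
          exact .inl ⟨hs _ h, .inr (.inl ⟨rfl, ht⟩)⟩
        | failsafe =>
          obtain ⟨rfl, h⟩ := h
          exact .inl ⟨hs _ h, .inr (.inr ⟨rfl, ht⟩)⟩
    | inf f =>
      rcases h with h | ⟨t, ht, h⟩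
      · exact h.elim
      · cases t with
        | terminates =>
          cases h
          refine .inr ⟨rfl, ht, fun h => ?_⟩
          -- An infinite computation is literally an infinite chain for `Succ`, which accessibility
          -- forbids.
          exact not_acc_iff_exists_descending_chain.2 ⟨f, hρ.1, hρ.2⟩ h.acc
        | typesafe => exact h.elim
        | failsafe => exact h.elim
  · rintro (⟨⟨N, h⟩, h'⟩ | ⟨rfl, ht, h⟩)
    · obtain ⟨n, f, h0, hn, hf⟩ := h.steps.exists_comp
      refine ⟨.fin n f, And.intro h0 hf, ?_⟩
      rcases h' with ⟨τ, rfl⟩ | ⟨rfl, ht⟩ | ⟨rfl, ht⟩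
      · exact .inl ⟨τ, rfl, hn⟩
      · exact .inr ⟨_, ht, rfl, hn⟩
      · exact .inr ⟨_, ht, rfl, hn⟩
    · obtain ⟨f, h0, hf⟩ := not_acc_iff_exists_descending_chain.1 fun h' => h (.of_acc h')
      exact ⟨.inf f, And.intro h0 hf, .inr ⟨_, ht, rfl⟩⟩

theorem BoolCorrect.isBoolVal {π : Program} (hπ : BoolCorrect π) {N : ℕ} {b : Bool} {σ τ : State}
    (hσ : σ.Consistent) (h : Ev π N (boolLit b) σ (.ok τ)) : τ.IsBoolVal τ.res b := by
  obtain ⟨τ', h, h'⟩ := hπ b σ hσ (mem_outcomes_iff.2 (.inl ⟨⟨N, h⟩, .inl ⟨τ, rfl⟩⟩))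
  cases h
  exact h'

theorem BoolCorrect.ne_error {π : Program} (hπ : BoolCorrect π) {N : ℕ} {b : Bool} {σ : State}
    {x : XState} (hσ : σ.Consistent) (h : Ev π N (boolLit b) σ x) :
    x ≠ .typeerror ∧ x ≠ .fail := by
  constructor
  · rintro rfl
    obtain ⟨τ, h, -⟩ := hπ b σ hσ (mem_outcomes_iff.2 (.inl ⟨⟨N, h⟩, .inr (.inl ⟨rfl, trivial⟩)⟩))
    cases h
  · rintro rfl
    obtain ⟨τ, h, -⟩ := hπ b σ hσ (mem_outcomes_iff.2 (.inl ⟨⟨N, h⟩, .inr (.inr ⟨rfl, trivial⟩)⟩))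
    cases h

theorem BoolCorrect.tm {π : Program} (hπ : BoolCorrect π) (b : Bool) {σ : State}
    (hσ : σ.Consistent) : Tm π (boolLit b) σ := by
  by_contra h
  obtain ⟨τ, h, -⟩ := hπ b σ hσ (mem_outcomes_iff.2 (.inr ⟨rfl, trivial, h⟩))
  cases h

/-! ## What a statement leaves unchanged -/

/-- The step is demanded only below `k`: when an argument raises an error, only the evaluations
before it are available. -/
theorem Fin.chain {n : ℕ} {P : Fin (n + 1) → Prop} (h0 : P 0) (k : Fin (n + 1))
    (h : ∀ j : Fin n, j.castSucc < k → P j.castSucc → P j.succ) : P k := by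
  induction k using Fin.induction with
  | zero => exact h0
  | succ i ih =>
    exact h i Fin.castSucc_lt_succ (ih fun j hj => h j (hj.trans Fin.castSucc_lt_succ))

/-- Outside of `S`, the variables and the instance variables of the objects that exist in `σ` have
the same values in `τ`. -/
structure Frame (S : Set Sym) (σ τ : State) : Prop where
  heap : ∀ o y, σ.Alive o → .fld y ∉ S → τ.heap o y = σ.heap o y
  loc : ∀ v, .var v ∉ S → τ.loc v = σ.loc v

theorem State.Alive.of_cls {σ τ : State} {o : Obj} (h : σ.Alive o)
    (hc : τ.heap o .cls = σ.heap o .cls) : τ.Alive o := by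
  cases o <;> simp_all [State.Alive]

theorem Frame.alive {S : Set Sym} {σ τ : State} (h : Frame S σ τ) (hS : .fld .cls ∉ S) {o : Obj}
    (ho : σ.Alive o) : τ.Alive o :=
  ho.of_cls (h.heap o .cls ho hS)

theorem Frame.refl {S : Set Sym} {σ τ : State} (hh : τ.heap = σ.heap) (hl : τ.loc = σ.loc) :
    Frame S σ τ :=
  ⟨fun _ _ _ _ => by rw [hh], fun _ _ => by rw [hl]⟩

theorem Frame.trans {S : Set Sym} {σ τ ρ : State} (h : Frame S σ τ) (h' : Frame S τ ρ)
    (hS : .fld .cls ∉ S) : Frame S σ ρ :=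
  ⟨fun o y ho hy => (h'.heap o y (h.alive hS ho) hy).trans (h.heap o y ho hy),
    fun v hv => (h'.loc v hv).trans (h.loc v hv)⟩

theorem Frame.mono {S S' : Set Sym} {σ τ : State} (h : Frame S σ τ) (hS : S ⊆ S') : Frame S' σ τ :=
  ⟨fun o y ho hy => h.heap o y ho fun h => hy (hS h), fun v hv => h.loc v fun h => hv (hS h)⟩

theorem State.fld_eq_of_heap {σ τ : State} {o : Obj} {x : Field} (h : τ.heap o x = σ.heap o x) :
    τ.fld o x = σ.fld o x := by
  simp only [State.fld, h]

theorem Frame.fld {S : Set Sym} {σ τ : State} (h : Frame S σ τ) {o : Obj} {x : Field}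
    (ho : σ.Alive o) (hx : .fld x ∉ S) : τ.fld o x = σ.fld o x :=
  State.fld_eq_of_heap (h.heap o x ho hx)

/-- The hidden `@c` cannot be assigned syntactically. Consequently existing objects keep their class
and never cease to exist. -/
theorem Stmt.cls_notMem_change (s : Stmt) : .fld .cls ∉ s.change := by
  induction s <;> simp_all [Stmt.change, targets]

theorem cls_notMem_changed (π : Program) (s : Stmt) : .fld .cls ∉ changed π s := by
  simp [changed, methodChange, Stmt.cls_notMem_change]

theorem changed_mono (π : Program) {s s' : Stmt} (h : s.change ⊆ s'.change) :
    changed π s ⊆ changed π s' :=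
  Set.insert_subset_insert (Set.union_subset_union_right _ h)

theorem change_boolLit (b : Bool) : (boolLit b).change = ∅ := by
  cases b <;> simp [boolLit, Stmt.change]

theorem fillUndef_bind {n : ℕ} (d : Method n) (r : Term) (a : Fin n → Term) (v : Var) :
    fillUndef (d.bind r a) v ≠ none := by
  cases v <;> simp [fillUndef, Method.bind]

/-- A method call initialises `this` and every local variable, so leaving it restores the entire
local part of the state. -/
theorem State.leave_bind {n : ℕ} (d : Method n) (r : Term) (a : Fin n → Term) (σ τ : State) :
    σ.leave (d.bind r a) τ = { τ with loc := σ.loc } := by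
  simp only [State.leave, State.setAll]
  congr
  funext v
  cases h : fillUndef (d.bind r a) v with
  | none => exact absurd h (fillUndef_bind d r a v)
  | some t => rfl

theorem State.leave_bindVals {n : ℕ} (d : Method n) (a : Fin (n + 1) → State) (σ τ : State) :
    σ.leave (d.bindVals a) τ = { τ with loc := σ.loc } :=
  σ.leave_bind ..

theorem change_subset_methodChange {π : Program} {C : ClassName} {m : MethName} {n : ℕ}
    {d : Method n} (h : π C m n = some d) (y : Field) (hy : .fld y ∈ d.body.change) :
    .fld y ∈ methodChange π :=
  ⟨y, rfl, C, m, n, d, h, hy⟩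

/-- Assignments change only their targets, and creation touches only an object that did not exist. A
called body can affect its surroundings only through instance variables, since all local variables
are restored. -/
theorem Ev.frame_aux {π : Program} {N : ℕ} {s : Stmt} {σ : State} {x : XState}
    (h : Ev π N s σ x) : ∀ τ, x = .ok τ → Frame (changed π s) σ τ := by
  induction h with
  | skip | null | var | ivar => rintro _ ⟨⟩; exact .refl rfl rfl
  | varErr | ivarErr | iteNull | iteType | callNull | callType => rintro _ ⟨⟩
  | first _ _ hx | eqErrRight _ _ hx | callArgErr _ _ _ _ _ hx => rintro τ h; exact absurd h (hx τ)
  | @asgn _ u e σ τ _ ih =>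
    rintro _ ⟨⟩
    refine ((ih _ rfl).mono (changed_mono π (s' := .asgn u e) (Set.subset_insert _ _))).trans ?_
      (cls_notMem_changed _ _)
    refine ⟨fun _ _ _ _ => rfl, fun v hv => ?_⟩
    refine Function.update_of_ne ?_ _ _
    rintro rfl
    simp [changed, Stmt.change] at hv
  | @iasgn _ y e σ τ _ _ ih =>
    rintro _ ⟨⟩
    refine ((ih _ rfl).mono (changed_mono π (s' := .iasgn y e) (Set.subset_insert _ _))).trans ?_
      (cls_notMem_changed _ _)
    refine ⟨fun o z _ hz => ?_, fun v hv => rfl⟩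
    have : z ≠ .prog y := by
      rintro rfl
      simp [changed, Stmt.change] at hz
    simp only [State.setFld, Function.update_apply]
    split_ifs with h
    · subst h
      exact Function.update_of_ne this _ _
    · rfl
  | @seq _ s₁ s₂ _ _ _ _ _ ih₁ ih₂ =>
    rintro τ rfl
    exact ((ih₁ _ rfl).mono (changed_mono π (s' := .seq s₁ s₂) Set.subset_union_left)).trans
      ((ih₂ _ rfl).mono (changed_mono π (s' := .seq s₁ s₂) Set.subset_union_right))
      (cls_notMem_changed _ _)
  | @ite _ e s₁ s₂ _ _ _ b _ _ _ ih₁ ih₂ =>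
    rintro τ rfl
    refine ((ih₁ _ rfl).mono (changed_mono π (s' := .ite e s₁ s₂) ?_)).trans
      ((ih₂ _ rfl).mono (changed_mono π (s' := .ite e s₁ s₂) ?_)) (cls_notMem_changed _ _)
    · intro y hy
      exact .inl (.inl hy)
    · intro y hy
      cases b
      · exact .inr hy
      · exact .inl (.inr hy)
  | @loop _ e s _ _ _ ih =>
    rintro τ rfl
    refine (ih _ rfl).mono (changed_mono π ?_)
    simp [Stmt.change]
  | @assign _ f σ =>
    rintro _ ⟨⟩
    refine ⟨fun _ _ _ _ => rfl, fun v hv => ?_⟩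
    have : f v = none := by
      by_contra h
      exact hv (.inr (.inr ⟨v, rfl, h⟩))
    simp [State.setAll, this]
  | @block _ f s σ y _ ih =>
    intro τ h
    obtain ⟨ρ, rfl, rfl⟩ := XState.map_eq_ok h
    have h := (ih _ rfl).mono (changed_mono π (s' := .block f s) Set.subset_union_right)
    refine ⟨fun o y ho hy => h.heap o y ho hy, fun v hv => ?_⟩
    cases hf : fillUndef f v with
    | none =>
      have := h.loc v hv
      simp_all [State.leave, State.setAll, State.enter]
    | some t => simp [State.leave, State.setAll, hf]
  | @call N e₀ m n args σ₀ y d σ _ hd _ _ ih₁ ih₂ ih₃ =>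
    intro τ h
    obtain ⟨ρ, rfl, rfl⟩ := XState.map_eq_ok h
    have h₀ := (ih₁ _ rfl).mono
      (changed_mono π (s' := .call e₀ m n args) Set.subset_union_left)
    have h₁ : Frame (changed π (.call e₀ m n args)) σ₀ (σ (Fin.last n)) :=
      Fin.chain (P := fun i => Frame _ σ₀ (σ i)) h₀ _ fun j _ h =>
        h.trans ((ih₂ j _ rfl).mono (changed_mono π (s' := .call e₀ m n args)
          (Set.subset_union_of_subset_right (Set.subset_iUnion (fun i => (args i).change) j) _)))
          (cls_notMem_changed _ _)
    refine h₁.trans ?_ (cls_notMem_changed _ _)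
    rw [State.leave_bindVals]
    refine ⟨fun o y ho hy => (ih₃ _ rfl).heap o y ho ?_, fun v hv => rfl⟩
    obtain ⟨-, C, -, hd⟩ := hd
    -- An instance variable changed by the body belongs to `methodChange` whether it is changed by
    -- further calls or by the body itself.
    rintro (h | h | h)
    · cases h
    · exact hy (.inr (.inl h))
    · exact hy (.inr (.inl (change_subset_methodChange hd y h)))
  | @new _ C n args _ _ _ ih =>
    rintro τ rfl
    refine (ih _ rfl).mono (changed_mono π ?_)
    simp [Stmt.change]
  | @alloc _ C σ n hn =>
    rintro _ ⟨⟩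
    refine ⟨fun o y ho _ => ?_, fun _ _ => rfl⟩
    have : o ≠ .obj n := by
      rintro rfl
      exact hn.1 ho
    simp [State.create, this]
  | @eq _ e₀ e₁ _ _ _ _ b _ _ _ _ ih₁ ih₂ ih₃ =>
    rintro τ rfl
    exact (((ih₁ _ rfl).mono (changed_mono π (s' := .eq e₀ e₁) Set.subset_union_left)).trans
      ((ih₂ _ rfl).mono (changed_mono π (s' := .eq e₀ e₁) Set.subset_union_right))
      (cls_notMem_changed _ _)).trans ((ih₃ _ rfl).mono (changed_mono π
        (by simp [change_boolLit]))) (cls_notMem_changed _ _)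
  | @isA _ e C _ _ _ b _ _ _ ih₁ ih₂ =>
    rintro τ rfl
    exact ((ih₁ _ rfl).mono (changed_mono π (s' := .isA e C) subset_rfl)).trans
      ((ih₂ _ rfl).mono (changed_mono π (by simp [change_boolLit]))) (cls_notMem_changed _ _)

theorem Ev.frame {π : Program} {N : ℕ} {s : Stmt} {σ τ : State} (h : Ev π N s σ (.ok τ)) :
    Frame (changed π s) σ τ :=
  h.frame_aux τ rfl

theorem Ev.alive {π : Program} {N : ℕ} {s : Stmt} {σ τ : State} (h : Ev π N s σ (.ok τ)) {o : Obj}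
    (ho : σ.Alive o) : τ.Alive o :=
  h.frame.alive (cls_notMem_changed _ _) ho

/-! ## Consistency -/

theorem State.Consistent.setRes {σ : State} (h : σ.Consistent) {o : Obj} (ho : σ.Alive o) :
    (σ.setRes o).Consistent := by
  obtain ⟨h₁, h₂, h₃⟩ := h
  exact ⟨fun v => (h₁ v).of_cls rfl, ho.of_cls rfl,
    fun p x hp => (h₃ p x (hp.of_cls rfl)).of_cls rfl⟩

theorem State.Consistent.of_loc {σ τ : State} (h : σ.Consistent) (hh : τ.heap = σ.heap)
    (hr : τ.res = σ.res) (hl : ∀ v, σ.Alive (τ.loc v)) : τ.Consistent := by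
  have ha : ∀ {o}, σ.Alive o → τ.Alive o := fun ho => ho.of_cls (by rw [hh])
  have ha' : ∀ {o}, τ.Alive o → σ.Alive o := fun ho => ho.of_cls (by rw [hh])
  exact ⟨fun v => ha (hl v), ha (hr ▸ h.2.1), fun p x hp => hh ▸ ha (h.2.2 p x (ha' hp))⟩

theorem State.Consistent.setLoc {σ : State} (h : σ.Consistent) (v : Var) {o : Obj}
    (ho : σ.Alive o) : (σ.setLoc v o).Consistent := by
  refine h.of_loc rfl rfl fun w => ?_
  simp only [State.setLoc, Function.update_apply]
  split_ifs
  · exact ho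
  · exact h.1 w

theorem State.setFld_heap_cls (σ : State) (o p : Obj) (y : FieldName) (d : Obj) :
    (σ.setFld o (.prog y) d).heap p .cls = σ.heap p .cls := by
  simp only [State.setFld, Function.update_apply]
  split_ifs with h
  · subst h
    rfl
  · rfl

theorem State.Consistent.setFld {σ : State} (h : σ.Consistent) (o : Obj) (y : FieldName) {d : Obj}
    (hd : σ.Alive d) : (σ.setFld o (.prog y) d).Consistent := by
  have ha : ∀ {p}, σ.Alive p → (σ.setFld o (.prog y) d).Alive p := fun hp =>
    hp.of_cls (σ.setFld_heap_cls ..)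
  have ha' : ∀ {p}, (σ.setFld o (.prog y) d).Alive p → σ.Alive p := fun hp =>
    hp.of_cls (σ.setFld_heap_cls ..).symm
  refine ⟨fun v => ha (h.1 v), ha h.2.1, fun p x hp => ha ?_⟩
  simp only [State.setFld, Function.update_apply]
  split_ifs with h₁
  · subst h₁
    rw [Function.update_apply]
    split_ifs
    · exact hd
    · exact h.2.2 _ x (ha' hp)
  · exact h.2.2 _ x (ha' hp)

theorem State.alive_create {σ : State} (C : ClassName) (n : ℕ) {o : Obj}
    (ho : σ.Alive o ∨ o = .obj n) : (σ.create C n).Alive o := by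
  by_cases h : o = .obj n
  · subst h
    simp [State.Alive, State.create, initFields]
  · exact (ho.resolve_right h).of_cls (by simp [State.create, h])

theorem State.alive_of_create {σ : State} {C : ClassName} {n : ℕ} {o : Obj}
    (ho : (σ.create C n).Alive o) (h : o ≠ .obj n) : σ.Alive o :=
  ho.of_cls (by simp [State.create, h])

theorem State.Consistent.create {σ : State} (h : σ.Consistent) (C : ClassName) (n : ℕ) :
    (σ.create C n).Consistent := by
  refine ⟨fun v => alive_create C n (.inl (h.1 v)), alive_create C n (.inr rfl), fun o x ho => ?_⟩
  by_cases hn : o = .obj n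
  · subst hn
    cases x <;> simp [State.create, initFields, State.Alive]
  · refine alive_create C n (.inl ?_)
    simpa [State.create, hn] using h.2.2 o x (alive_of_create ho hn)

theorem State.Consistent.alive_fld {σ : State} (h : σ.Consistent) {o : Obj} (ho : σ.Alive o)
    (x : Field) : σ.Alive (σ.fld o x) := by
  unfold State.fld
  split_ifs
  · exact h.2.2 o x ho
  · trivial

theorem Method.bindVals_eq {n : ℕ} (d : Method n) (σ : Fin (n + 1) → State) {v : Var} {t : Term}
    (h : fillUndef (d.bindVals σ) v = some t) : t = .undef ∨ ∃ i, t = .val (σ i).res := by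
  cases v with
  | this =>
    simp only [fillUndef, Method.bindVals, Method.bind, Option.some.injEq] at h
    exact .inr ⟨0, h.symm⟩
  | loc u =>
    simp only [fillUndef, Method.bindVals, Method.bind, Option.some.injEq] at h
    split_ifs at h
    · exact .inr ⟨_, h.symm⟩
    · exact .inl h.symm

theorem State.Consistent.enter_bindVals {n : ℕ} {d : Method n} {σ : Fin (n + 1) → State}
    {τ : State} (h : τ.Consistent) (hr : ∀ i, τ.Alive (σ i).res) :
    (τ.enter (d.bindVals σ)).Consistent := by
  refine h.of_loc rfl rfl fun v => ?_
  simp only [State.enter, State.setAll]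
  cases hv : fillUndef (d.bindVals σ) v with
  | none => exact absurd hv (fillUndef_bind d _ _ v)
  | some t =>
    rcases d.bindVals_eq σ hv with rfl | ⟨i, rfl⟩
    · trivial
    · exact hr i

/-- Guarantees that the results of the receiver and of earlier arguments still exist when they are
bound after the last argument. -/
theorem Ev.alive_chain {π : Program} {N n : ℕ} {args : Fin n → Stmt} {σ : Fin (n + 1) → State}
    {k : Fin (n + 1)}
    (h : ∀ j : Fin n, j.castSucc < k → Ev π N (args j) (σ j.castSucc) (.ok (σ j.succ)))
    {i : Fin (n + 1)} (hi : i ≤ k) {o : Obj} (ho : (σ i).Alive o) : (σ k).Alive o := by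
  refine Fin.chain (P := fun k => i ≤ k → (σ k).Alive o) ?_ k ?_ hi
  · intro hi
    rw [Fin.le_zero_iff] at hi
    exact hi ▸ ho
  · intro j hj ih hij
    rcases hij.lt_or_eq with hlt | rfl
    · exact (h j hj).alive (ih (Fin.le_castSucc_iff.2 hlt))
    · exact ho

theorem boolLit_proper (b : Bool) : (boolLit b).Proper := by
  cases b <;> simp [boolLit, Stmt.Proper]

theorem Stmt.Proper.first {s e : Stmt} (hs : s.Proper) (h : First s e) : e.Proper := by
  cases h <;> simp_all [Stmt.Proper]

/-- Simultaneous assignments and blocks may contain arbitrary run-time values, hence the restriction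
to proper statements. The local variables restored after a call are harmless because objects never
cease to exist. -/
theorem Ev.consistent_aux {π : Program} {N : ℕ} {s : Stmt} {σ : State} {x : XState}
    (h : Ev π N s σ x) : s.Proper → σ.Consistent → ∀ τ, x = .ok τ → τ.Consistent := by
  induction h with
  | skip | assign | block => exact fun h => h.elim
  | null => rintro - hσ _ ⟨⟩; exact hσ.setRes trivial
  | var => rintro - hσ _ ⟨⟩; exact hσ.setRes (hσ.1 _)
  | ivar => rintro - hσ _ ⟨⟩; exact hσ.setRes (hσ.alive_fld (hσ.1 _) _)
  | varErr | ivarErr | iteNull | iteType | callNull | callType => rintro - - _ ⟨⟩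
  | first _ _ hx | eqErrRight _ _ hx | callArgErr _ _ _ _ _ hx =>
    rintro - - τ h; exact absurd h (hx τ)
  | asgn _ ih =>
    rintro hs hσ _ ⟨⟩
    have := ih hs hσ _ rfl
    exact this.setLoc _ this.2.1
  | iasgn _ _ ih =>
    rintro hs hσ _ ⟨⟩
    have := ih hs hσ _ rfl
    exact this.setFld _ _ this.2.1
  | seq _ _ ih₁ ih₂ => exact fun hs hσ => ih₂ hs.2 (ih₁ hs.1 hσ _ rfl)
  | ite b _ _ _ ih₁ ih₂ =>
    intro hs hσ
    refine ih₂ ?_ (ih₁ hs.1 hσ _ rfl)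
    cases b
    · exact hs.2.2
    · exact hs.2.1
  | loop _ ih => exact fun hs => ih ⟨hs.1, ⟨hs.2, hs⟩, trivial⟩
  | @call N e₀ m n args σ₀ y d σ _ hd h₂ hb ih₁ ih₂ ih₃ =>
    intro hs hσ τ h
    obtain ⟨ρ, rfl, rfl⟩ := XState.map_eq_ok h
    have h₁ : ∀ k, (σ k).Consistent := fun k =>
      Fin.chain (P := fun i => (σ i).Consistent) (ih₁ hs.1 hσ _ rfl) k fun j _ h =>
        ih₂ j (hs.2 j) h _ rfl
    have h₃ := ih₃ d.body_proper ((h₁ _).enter_bindVals fun i =>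
      Ev.alive_chain (fun j _ => h₂ j) (Fin.le_last i) (h₁ i).2.1) _ rfl
    rw [State.leave_bindVals]
    refine h₃.of_loc rfl rfl fun v => ?_
    exact Ev.alive hb (σ := (σ (Fin.last n)).enter (d.bindVals σ)) ((h₁ (Fin.last n)).1 v)
  | new _ ih => exact fun hs => ih ⟨trivial, hs⟩
  | alloc => rintro - hσ _ ⟨⟩; exact hσ.create _ _
  | eq b _ _ _ _ ih₁ ih₂ ih₃ =>
    exact fun hs hσ => ih₃ (boolLit_proper b) (ih₂ hs.2 (ih₁ hs.1 hσ _ rfl) _ rfl)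
  | isA b _ _ _ ih₁ ih₂ => exact fun hs hσ => ih₂ (boolLit_proper b) (ih₁ hs hσ _ rfl)

theorem Ev.consistent {π : Program} {N : ℕ} {s : Stmt} {σ τ : State} (h : Ev π N s σ (.ok τ))
    (hs : s.Proper) (hσ : σ.Consistent) : τ.Consistent :=
  h.consistent_aux hs hσ τ rfl

/-- Reading the mark is a type error, so it never becomes a result. For METH this means that stored
results can be read back without an error. -/
theorem Ev.res_ne_undef_aux {π : Program} {N : ℕ} {s : Stmt} {σ : State} {x : XState}
    (h : Ev π N s σ x) : s.Proper → ∀ τ, x = .ok τ → τ.res ≠ .undef := by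
  induction h with
  | skip | assign | block => exact fun h => h.elim
  | null | alloc => rintro - _ ⟨⟩ ⟨⟩
  | var h | ivar h => rintro - _ ⟨⟩; exact h
  | varErr | ivarErr | iteNull | iteType | callNull | callType => rintro - _ ⟨⟩
  | first _ _ hx | eqErrRight _ _ hx | callArgErr _ _ _ _ _ hx =>
    rintro - τ h; exact absurd h (hx τ)
  | asgn _ ih | iasgn _ _ ih =>
    rintro hs _ ⟨⟩ h
    exact ih hs _ rfl h
  | seq _ _ _ ih => exact fun hs => ih hs.2
  | ite b _ _ _ _ ih =>
    intro hs
    refine ih ?_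
    cases b
    · exact hs.2.2
    · exact hs.2.1
  | loop _ ih => exact fun hs => ih ⟨hs.1, ⟨hs.2, hs⟩, trivial⟩
  | @call N e₀ m n args σ₀ y d σ _ _ _ _ _ _ ih =>
    intro _ τ h
    obtain ⟨ρ, rfl, rfl⟩ := XState.map_eq_ok h
    exact fun h => ih d.body_proper _ rfl h
  | new _ ih => exact fun hs => ih ⟨trivial, hs⟩
  | eq b _ _ _ _ _ _ ih => exact fun _ => ih (boolLit_proper b)
  | isA b _ _ _ _ ih => exact fun _ => ih (boolLit_proper b)

theorem Ev.res_ne_undef {π : Program} {N : ℕ} {s : Stmt} {σ τ : State} (h : Ev π N s σ (.ok τ))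
    (hs : s.Proper) : τ.res ≠ .undef :=
  h.res_ne_undef_aux hs τ rfl

/-! ## Independence of the initial result -/

/-- A proper statement writes the result variable before anything reads it. This bridges the
difference between a call, whose receiver and arguments have left a value there, and the block for
its body. -/
theorem Ev.setRes {π : Program} {N : ℕ} {s : Stmt} {σ : State} {x : XState} (h : Ev π N s σ x)
    (o : Obj) : s.Proper → Ev π N s (σ.setRes o) x := by
  induction h with
  | skip | assign | block => exact fun h => h.elim
  | null => exact fun _ => .null (σ := State.setRes _ o)
  | var h => exact fun _ => .var (σ := State.setRes _ o) h
  | varErr h => exact fun _ => .varErr h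
  | ivar h => exact fun _ => .ivar (σ := State.setRes _ o) h
  | ivarErr h => exact fun _ => .ivarErr h
  | asgn _ ih => exact fun hs => .asgn (ih hs)
  | iasgn _ h ih => exact fun hs => .iasgn (ih hs) h
  | first h _ hx ih => exact fun hs => .first h (ih (hs.first h)) hx
  | seq _ h ih => exact fun hs => .seq (ih hs.1) h
  | ite b _ h h' ih => exact fun hs => .ite b (ih hs.1) h h'
  | iteNull _ h ih => exact fun hs => .iteNull (ih hs.1) h
  | iteType _ h h' ih => exact fun hs => .iteType (ih hs.1) h h'
  | loop _ ih => exact fun hs => .loop (ih ⟨hs.1, ⟨hs.2, hs⟩, trivial⟩)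
  | call _ h h' h'' ih => exact fun hs => .call (ih hs.1) h h' h''
  | callNull _ h ih => exact fun hs => .callNull (ih hs.1) h
  | callType _ h h' h'' ih => exact fun hs => .callType (ih hs.1) h h' h''
  | callArgErr i _ h h' h'' hx ih => exact fun hs => .callArgErr i (ih hs.1) h h' h'' hx
  | new _ ih => exact fun hs => .new (ih ⟨trivial, hs⟩)
  | alloc h => exact fun _ => .alloc (σ := State.setRes _ o) h
  | eq b _ h h' h'' ih => exact fun hs => .eq b (ih hs.1) h h' h''
  | eqErrRight _ h hx ih => exact fun hs => .eqErrRight (ih hs.1) h hx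
  | isA b _ h h' ih => exact fun hs => .isA b (ih hs) h h'

theorem Ev.of_setRes {π : Program} {N : ℕ} {s : Stmt} {σ : State} {x : XState} {o : Obj}
    (h : Ev π N s (σ.setRes o) x) (hs : s.Proper) : Ev π N s σ x :=
  h.setRes σ.res hs

theorem Tm.setRes {π : Program} {s : Stmt} {σ : State} (h : Tm π s σ) (o : Obj) :
    s.Proper → Tm π s (σ.setRes o) := by
  induction h with
  | skip | assign | block => exact fun h => h.elim
  | null => exact fun _ => .null
  | var => exact fun _ => .var
  | ivar => exact fun _ => .ivar
  | alloc => exact fun _ => .alloc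
  | asgn _ ih => exact fun hs => .asgn (ih hs)
  | iasgn _ ih => exact fun hs => .iasgn (ih hs)
  | seq _ h ih => exact fun hs => .seq (ih hs.1) fun N τ h' => h N τ (h'.of_setRes hs.1)
  | ite _ h ih => exact fun hs => .ite (ih hs.1) fun N τ b h' => h N τ b (h'.of_setRes hs.1)
  | loop _ ih => exact fun hs => .loop (ih ⟨hs.1, ⟨hs.2, hs⟩, trivial⟩)
  | call _ h₁ h₂ ih =>
    exact fun hs => .call (ih hs.1) (fun N d σ i h => h₁ N d σ i (h.of_setRes hs.1))
      fun N d σ h => h₂ N d σ (h.of_setRes hs.1)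
  | new _ ih => exact fun hs => .new (ih ⟨trivial, hs⟩)
  | eq _ h₁ h₂ ih =>
    exact fun hs => .eq (ih hs.1) (fun N τ h => h₁ N τ (h.of_setRes hs.1))
      fun N τ ρ b h => h₂ N τ ρ b (h.of_setRes hs.1)
  | isA _ h₁ ih => exact fun hs => .isA (ih hs) fun N τ b h => h₁ N τ b (h.of_setRes hs)

/-! ## Independence of variables that are not accessed -/

open Classical in
/-- The values of the variables in `V` are taken from `ρ`. -/
noncomputable def State.graft (V : Set Var) (ρ : Var → Obj) (σ : State) : State :=
  { σ with loc := fun v => if v ∈ V then ρ v else σ.loc v }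

theorem State.graft_loc_of_mem {V : Set Var} {ρ : Var → Obj} {σ : State} {v : Var} (h : v ∈ V) :
    (σ.graft V ρ).loc v = ρ v := if_pos h

theorem State.graft_loc_of_notMem {V : Set Var} {ρ : Var → Obj} {σ : State} {v : Var}
    (h : v ∉ V) : (σ.graft V ρ).loc v = σ.loc v := if_neg h

theorem State.ext {σ τ : State} (hl : ∀ v, σ.loc v = τ.loc v) (hr : σ.res = τ.res)
    (hh : σ.heap = τ.heap) : σ = τ := by
  cases σ
  cases τ
  simp only [State.mk.injEq]
  exact ⟨funext hl, hr, hh⟩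

theorem State.graft_graft (V : Set Var) (ρ ρ' : Var → Obj) (σ : State) :
    (σ.graft V ρ).graft V ρ' = σ.graft V ρ' := by
  refine State.ext (fun v => ?_) rfl rfl
  by_cases hv : v ∈ V <;> simp [State.graft, hv]

theorem State.graft_self {V : Set Var} {ρ : Var → Obj} {σ : State} (h : ∀ v ∈ V, ρ v = σ.loc v) :
    σ.graft V ρ = σ := by
  refine State.ext (fun v => ?_) rfl rfl
  by_cases hv : v ∈ V
  · exact (graft_loc_of_mem hv).trans (h v hv)
  · exact graft_loc_of_notMem hv

/-- The statement accesses no variable of `V`. -/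
def Stmt.Avoids (s : Stmt) (V : Set Var) : Prop := ∀ v ∈ V, .var v ∉ s.vars

theorem Stmt.Avoids.of_subset {s s' : Stmt} {V : Set Var} (h : s'.Avoids V)
    (hs : s.vars ⊆ s'.vars) : s.Avoids V := fun v hv h' => h v hv (hs h')

theorem First.vars_subset {s e : Stmt} (h : First s e) : e.vars ⊆ s.vars := by
  cases h <;> simp only [Stmt.vars, Set.union_assoc] <;>
    first
      | exact Set.subset_union_left
      | exact Set.subset_union_right
      | exact Set.subset_insert _ _
      | exact subset_rfl

theorem boolLit_avoids (b : Bool) (V : Set Var) : (boolLit b).Avoids V := by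
  intro v _
  cases b <;> simp [boolLit, Stmt.vars]

theorem Stmt.Avoids.seq {a b : Stmt} {V : Set Var} (h : (Stmt.seq a b).Avoids V) :
    a.Avoids V ∧ b.Avoids V :=
  ⟨h.of_subset Set.subset_union_left, h.of_subset Set.subset_union_right⟩

theorem Stmt.Avoids.eq {a b : Stmt} {V : Set Var} (h : (Stmt.eq a b).Avoids V) :
    a.Avoids V ∧ b.Avoids V :=
  ⟨h.of_subset Set.subset_union_left, h.of_subset Set.subset_union_right⟩

theorem Stmt.Avoids.ite {e a b : Stmt} {V : Set Var} (h : (Stmt.ite e a b).Avoids V) :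
    e.Avoids V ∧ ∀ c, (cond c a b).Avoids V := by
  refine ⟨h.of_subset fun y hy => .inl (.inl hy), fun c => h.of_subset fun y hy => ?_⟩
  cases c
  · exact .inr hy
  · exact .inl (.inr hy)

theorem Stmt.Avoids.while {e s : Stmt} {V : Set Var} (h : (Stmt.while e s).Avoids V) :
    (Stmt.ite e (.seq s (.while e s)) .null).Avoids V := by
  refine h.of_subset ?_
  simp [Stmt.vars]

theorem Stmt.Avoids.call {e : Stmt} {m : MethName} {n : ℕ} {args : Fin n → Stmt} {V : Set Var}
    (h : (Stmt.call e m n args).Avoids V) : e.Avoids V ∧ ∀ i, (args i).Avoids V :=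
  ⟨h.of_subset Set.subset_union_left, fun i => h.of_subset
    (Set.subset_union_of_subset_right (Set.subset_iUnion (fun i => (args i).vars) i) _)⟩

theorem Stmt.Avoids.new {C : ClassName} {n : ℕ} {args : Fin n → Stmt} {V : Set Var}
    (h : (Stmt.new C n args).Avoids V) : (Stmt.call (.alloc C) .init n args).Avoids V := by
  refine h.of_subset ?_
  simp [Stmt.vars]

/-- The variables of `V` that keep their values when a block is entered. -/
def keep (V : Set Var) (f : Var → Option Term) : Set Var := {v | v ∈ V ∧ fillUndef f v = none}

theorem State.term_graft {σ : State} {V : Set Var} {ρ : Var → Obj} {t : Term}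
    (h : ∀ v ∈ V, .var v ∉ t.vars) : (σ.graft V ρ).term t = σ.term t := by
  cases t with
  | arg a =>
    cases a with
    | var w =>
      refine graft_loc_of_notMem fun hw => h w hw ?_
      simp [Term.vars, Arg.vars]
    | null => rfl
  | undef => rfl
  | val => rfl

/-- Variables initialised by the block lose their grafted values on entry, and the initial values do
not depend on the graft because no source lies in `V`. -/
theorem State.enter_graft {σ : State} {V : Set Var} {ρ : Var → Obj} {f : Var → Option Term}
    (h : ∀ v ∈ V, .var v ∉ sources f) :
    (σ.graft V ρ).enter f = (σ.enter f).graft (keep V f) ρ := by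
  refine State.ext (fun v => ?_) rfl rfl
  cases hf : fillUndef f v with
  | none => by_cases hv : v ∈ V <;> simp [State.enter, State.setAll, State.graft, keep, hf, hv]
  | some t =>
    rw [State.graft_loc_of_notMem (by simp [keep, hf])]
    simp only [State.enter, State.setAll, hf, Option.map_some, Option.getD_some]
    refine State.term_graft fun w hw h' => h w hw ⟨v, t, ?_, h'⟩
    cases v with
    | this => exact hf
    | loc u =>
      simp only [fillUndef] at hf
      cases hu : f (.loc u) with
      | none =>
        simp only [hu, Option.getD_none, Option.some.injEq] at hf
        subst hf
        cases h'
      | some t' => simpa [hu] using hf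

theorem State.leave_graft (σ τ : State) (V : Set Var) (ρ : Var → Obj) (f : Var → Option Term) :
    (σ.graft V ρ).leave f (τ.graft (keep V f) ρ) = (σ.leave f τ).graft V ρ := by
  refine State.ext (fun v => ?_) rfl rfl
  by_cases hv : v ∈ V <;> cases hf : fillUndef f v <;>
    simp [State.leave, State.setAll, State.graft, keep, hf, hv]

/-- A method body sees none of the caller's variables: its start state is determined by the heap,
the result variable and the actual values. -/
theorem State.enter_bindVals_congr {n : ℕ} (d : Method n) (a b : Fin (n + 1) → State)
    (σ τ : State) (hh : τ.heap = σ.heap) (hr : τ.res = σ.res) (h : ∀ i, (a i).res = (b i).res) :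
    τ.enter (d.bindVals b) = σ.enter (d.bindVals a) := by
  have hab : d.bindVals b = d.bindVals a := by simp only [Method.bindVals, h]
  rw [hab]
  refine State.ext (fun v => ?_) hr hh
  simp only [State.enter, State.setAll]
  cases hv : fillUndef (d.bindVals a) v with
  | none => exact absurd hv (fillUndef_bind d _ _ v)
  | some t => rcases d.bindVals_eq a hv with rfl | ⟨i, rfl⟩ <;> rfl

/-- Values that are never read or written are merely carried along. A called body starts in the same
state with or without the graft, and the grafted values return when the caller's variables are
restored; so nothing is required of the bodies of methods. -/
theorem Ev.graft {π : Program} {N : ℕ} {s : Stmt} {σ : State} {x : XState} (h : Ev π N s σ x) :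
    ∀ {V : Set Var} (ρ : Var → Obj), s.Avoids V →
      Ev π N s (σ.graft V ρ) (x.map (State.graft V ρ)) := by
  induction h with
  | skip => exact fun _ _ => .skip
  | null => exact fun _ _ => .null
  | alloc h => exact fun ρ _ => .alloc (σ := State.graft _ ρ _) h
  | @var _ v σ h =>
    intro V ρ hV
    have hv : (σ.graft V ρ).loc v = σ.loc v :=
      State.graft_loc_of_notMem fun h => hV v h rfl
    have := Ev.var (π := π) (N := ‹ℕ›) (hv.symm ▸ h)
    rw [hv] at this
    exact this
  | @varErr _ v σ h =>
    intro V ρ hV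
    exact .varErr ((State.graft_loc_of_notMem fun h => hV v h rfl).trans h)
  | @ivar _ x σ h =>
    intro V ρ hV
    have hv : (σ.graft V ρ).loc .this = σ.loc .this :=
      State.graft_loc_of_notMem fun h => hV _ h (.inl rfl)
    have hf : (σ.graft V ρ).fld ((σ.graft V ρ).loc .this) (.prog x) =
        σ.fld (σ.loc .this) (.prog x) := by
      rw [hv]
      rfl
    have := Ev.ivar (π := π) (N := ‹ℕ›) (hf.symm ▸ h)
    rw [hf] at this
    exact this
  | @ivarErr _ x σ h =>
    intro V ρ hV
    have hv : (σ.graft V ρ).loc .this = σ.loc .this :=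
      State.graft_loc_of_notMem fun h => hV _ h (.inl rfl)
    refine .ivarErr ?_
    rw [hv]
    exact h
  | @asgn _ u e σ τ _ ih =>
    intro V ρ hV
    have := Ev.asgn (u := u) (ih ρ (hV.of_subset (Set.subset_insert _ _)))
    have hu : Var.loc u ∉ V := fun h => hV _ h (.inl rfl)
    have heq : (τ.setLoc (.loc u) τ.res).graft V ρ =
        (τ.graft V ρ).setLoc (.loc u) (τ.graft V ρ).res := by
      refine State.ext (fun v => ?_) rfl rfl
      by_cases hv : v = .loc u
      · subst hv
        simp [State.graft, State.setLoc, hu]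
      · simp [State.graft, State.setLoc, hv]
    simp only [XState.map, heq]
    exact this
  | @iasgn _ y e σ τ _ h ih =>
    intro V ρ hV
    have hv : (τ.graft V ρ).loc .this = τ.loc .this :=
      State.graft_loc_of_notMem fun h => hV _ h (.inl (.inl rfl))
    have := Ev.iasgn (y := y) (ih ρ (hV.of_subset Set.subset_union_right)) (hv.symm ▸ h)
    rw [hv] at this
    exact this
  | first h _ hx ih =>
    intro V ρ hV
    have := ih ρ (hV.of_subset h.vars_subset)
    rw [hx.map_eq] at this ⊢
    exact .first h this hx
  | seq _ _ ih₁ ih₂ => exact fun ρ hV => .seq (ih₁ ρ hV.seq.1) (ih₂ ρ hV.seq.2)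
  | ite b _ h _ ih₁ ih₂ => exact fun ρ hV => .ite b (ih₁ ρ hV.ite.1) h (ih₂ ρ (hV.ite.2 b))
  | iteNull _ h ih => exact fun ρ hV => .iteNull (ih ρ hV.ite.1) h
  | iteType _ h h' ih => exact fun ρ hV => .iteType (ih ρ hV.ite.1) h h'
  | loop _ ih => exact fun ρ hV => .loop (ih ρ hV.while)
  | @assign _ f σ =>
    intro V ρ hV
    have heq : (σ.setAll fun v => (f v).map σ.term).graft V ρ =
        (σ.graft V ρ).setAll fun v => (f v).map (σ.graft V ρ).term := by
      refine State.ext (fun v => ?_) rfl rfl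
      cases hf : f v with
      | none => by_cases hv : v ∈ V <;> simp [State.graft, State.setAll, hv, hf]
      | some t =>
        have hv : v ∉ V := fun h => hV v h (.inl ⟨v, rfl, by simp [hf]⟩)
        rw [State.graft_loc_of_notMem hv]
        simp only [State.setAll, hf, Option.map_some, Option.getD_some]
        exact (State.term_graft fun w hw h' => hV w hw (.inr ⟨v, t, hf, h'⟩)).symm
    simp only [XState.map, heq]
    exact .assign
  | @block _ f s σ y _ ih =>
    intro V ρ hV
    have h := ih (V := keep V f) ρ fun v hv h => hV v hv.1 (.inr h)
    rw [← State.enter_graft fun v hv h => hV v hv (.inl (.inr h))] at h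
    have := Ev.block h
    simp only [XState.map_map, State.leave_graft] at this ⊢
    exact this
  | @call N e₀ m n args σ₀ y d σ _ hd _ hb ih₁ ih₂ _ =>
    intro V ρ hV
    rw [← State.enter_bindVals_congr d σ (fun i => (σ i).graft V ρ) (σ (Fin.last n))
      ((σ (Fin.last n)).graft V ρ) rfl rfl fun _ => rfl] at hb
    have := Ev.call (σ := fun i => (σ i).graft V ρ) (ih₁ ρ hV.call.1) hd
      (fun i => ih₂ i ρ (hV.call.2 i)) hb
    have heq : ((σ (Fin.last n)).graft V ρ).leave (d.bindVals fun i => (σ i).graft V ρ) =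
        fun τ => ((σ (Fin.last n)).leave (d.bindVals σ) τ).graft V ρ := by
      funext τ
      simp only [State.leave_bindVals]
      refine State.ext (fun v => ?_) rfl rfl
      by_cases hv : v ∈ V <;> simp [State.graft, hv]
    rw [heq] at this
    rw [XState.map_map]
    exact this
  | callNull _ h ih => exact fun ρ hV => .callNull (ih ρ hV.call.1) h
  | callType _ h h' h'' ih => exact fun ρ hV => .callType (ih ρ hV.call.1) h h' h''
  | @callArgErr N e₀ m n args σ₀ x d σ i _ h _ _ hx ih₁ ih₂ ih₃ =>
    intro V ρ hV
    have := ih₃ ρ (hV.call.2 i)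
    rw [hx.map_eq] at this ⊢
    exact .callArgErr (σ := fun i => (σ i).graft V ρ) i (ih₁ ρ hV.call.1) h
      (fun j hj => ih₂ j hj ρ (hV.call.2 j)) this hx
  | new _ ih => exact fun ρ hV => .new (ih ρ hV.new)
  | eq b _ _ h _ ih₁ ih₂ ih₃ =>
    exact fun ρ hV => .eq b (ih₁ ρ hV.eq.1) (ih₂ ρ hV.eq.2) h (ih₃ ρ (boolLit_avoids b _))
  | eqErrRight _ _ hx ih₁ ih₂ =>
    intro V ρ hV
    have := ih₂ ρ hV.eq.2
    rw [hx.map_eq] at this ⊢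
    exact .eqErrRight (ih₁ ρ hV.eq.1) this hx
  | isA b _ h _ ih₁ ih₂ =>
    exact fun ρ hV => .isA b (ih₁ ρ hV) h (ih₂ ρ (boolLit_avoids b _))

theorem Ev.ungraft {π : Program} {N : ℕ} {s : Stmt} {σ : State} {x : XState} {V : Set Var}
    {ρ : Var → Obj} (h : Ev π N s (σ.graft V ρ) x) (hV : s.Avoids V) :
    Ev π N s σ (x.map (State.graft V σ.loc)) := by
  have := h.graft σ.loc hV
  rwa [State.graft_graft, State.graft_self fun _ _ => rfl] at this

/-- The premises of `Tm` quantify over runs from the grafted state. `Ev.ungraft` turns these into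
runs from the original state, where the induction hypothesis applies, and `back` returns to the
intermediate state of the grafted run. -/
theorem Tm.graft {π : Program} {s : Stmt} {σ : State} (h : Tm π s σ) :
    ∀ {V : Set Var} (ρ : Var → Obj), s.Avoids V → Tm π s (σ.graft V ρ) := by
  have back : ∀ {V : Set Var} {ρ : Var → Obj} {σ : State} {s},
      Tm π s ((σ.graft V ρ).graft V σ.loc) → Tm π s σ := fun h => by
    rwa [State.graft_graft, State.graft_self fun _ _ => rfl] at h
  induction h with
  | skip => exact fun _ _ => .skip
  | null => exact fun _ _ => .null
  | alloc => exact fun _ _ => .alloc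
  | var => exact fun _ _ => .var
  | ivar => exact fun _ _ => .ivar
  | assign => exact fun _ _ => .assign
  | asgn _ ih => exact fun ρ hV => .asgn (ih ρ (hV.of_subset (Set.subset_insert _ _)))
  | iasgn _ ih => exact fun ρ hV => .iasgn (ih ρ (hV.of_subset Set.subset_union_right))
  | seq _ _ ih₁ ih₂ =>
    exact fun ρ hV => .seq (ih₁ ρ hV.seq.1) fun N τ h =>
      back (ih₂ N _ (h.ungraft hV.seq.1) τ.loc hV.seq.2)
  | ite _ _ ih₁ ih₂ =>
    exact fun ρ hV => .ite (ih₁ ρ hV.ite.1) fun N τ b h h' =>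
      back (ih₂ N _ b (h.ungraft hV.ite.1) h' τ.loc (hV.ite.2 b))
  | loop _ ih => exact fun ρ hV => .loop (ih ρ hV.while)
  | @block f s σ _ ih =>
    intro V ρ hV
    have h := ih (V := keep V f) ρ fun v hv h => hV v hv.1 (.inr h)
    rw [← State.enter_graft fun v hv h => hV v hv (.inl (.inr h))] at h
    exact .block h
  | @call e₀ m n args σ₀ _ _ _ ih₁ ih₂ ih₃ =>
    intro V ρ hV
    refine .call (ih₁ ρ hV.call.1) (fun N d σ i h h' h'' => ?_) fun N d σ h h' h'' => ?_
    · refine back (ρ := σ₀.loc) (ih₂ N d (fun i => (σ i).graft V σ₀.loc) i (h.ungraft hV.call.1) h'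
        (fun j hj => ?_) (σ i.castSucc).loc (hV.call.2 i))
      exact (h'' j hj).graft _ (hV.call.2 j)
    -- The body starts in the same state in both runs, so the induction hypothesis is used with an
    -- empty graft.
    · have := ih₃ N d (fun i => (σ i).graft V σ₀.loc) (h.ungraft hV.call.1) h'
        (fun j => (h'' j).graft _ (hV.call.2 j)) (V := ∅) σ₀.loc (fun v hv => hv.elim)
      rw [State.graft_self (fun v hv => hv.elim)] at this
      rwa [State.enter_bindVals_congr d σ (fun i => (σ i).graft V σ₀.loc) (σ (Fin.last n))
        ((σ (Fin.last n)).graft V σ₀.loc) rfl rfl fun _ => rfl] at this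
  | new _ ih => exact fun ρ hV => .new (ih ρ hV.new)
  | eq _ _ _ ih₁ ih₂ ih₃ =>
    intro V ρ hV
    refine .eq (ih₁ ρ hV.eq.1) (fun N τ h => back (ih₂ N _ (h.ungraft hV.eq.1) τ.loc hV.eq.2))
      fun N τ υ b h h' hb => ?_
    exact back (ih₃ N _ _ b (h.ungraft hV.eq.1) (h'.graft _ hV.eq.2) hb υ.loc (boolLit_avoids b _))
  | isA _ _ ih₁ ih₂ =>
    exact fun ρ hV => .isA (ih₁ ρ hV) fun N τ b h hb =>
      back (ih₂ N _ b (h.ungraft hV) hb τ.loc (boolLit_avoids b _))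

/-! ## Assertions -/

theorem State.AliveVal.dflt (σ : State) (t : BTy) : σ.AliveVal t t.dflt := by
  cases t <;> trivial

/-- All objects in a value exist. -/
def State.AliveTy (σ : State) : (τ : Ty) → τ.Val → Prop
  | .base t, v => σ.AliveVal t v
  | .seq t, v => ∀ x ∈ v, σ.AliveVal t x

theorem List.getD_prop {α : Type*} {P : α → Prop} {l : List α} {d : α} (hl : ∀ x ∈ l, P x)
    (hd : P d) (i : ℕ) : P (l.getD i d) := by
  rw [List.getD_eq_getElem?_getD]
  cases h : l[i]? with
  | none => exact hd
  | some a => exact hl a (List.mem_of_getElem? h)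

theorem Op1.eval_alive (σ : State) {a b : Ty} (o : Op1 a b) (x : a.Val) :
    σ.AliveTy b (o.eval x) := by
  cases o <;> trivial

theorem Op2.eval_alive {σ : State} {a b c : Ty} (o : Op2 a b c) {x : a.Val} {y : b.Val}
    (hx : σ.AliveTy a x) (hy : σ.AliveTy b y) : σ.AliveTy c (o.eval x y) := by
  cases o with
  | snoc t =>
    intro z hz
    rcases List.mem_append.1 hz with h | h
    · exact hx z h
    · rw [List.mem_singleton.1 h]
      exact hy
  | _ => first | trivial | exact List.getD_prop hx (State.AliveVal.dflt σ _) y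

/-- Consistency propagates through all operations, including the default values of undefined ones.
So instance variables need to be compared on existing objects only, and no expression denotes an
object yet to be created. -/
theorem LExp.eval_alive {σ : State} {ω : Env} (hσ : σ.Consistent) (hω : ω.Consistent σ) {τ : Ty}
    (l : LExp τ) : σ.AliveTy τ (l.eval σ ω) := by
  induction l with
  | lvar t x => exact hω.1 t x
  | svar t k => exact hω.2 t k
  | var v => exact hσ.1 v
  | res => exact hσ.2.1
  | fld l x ih => exact hσ.alive_fld ih x
  | null | undef | rep | natC | boolC | strC => trivial
  | nil t => exact fun x hx => absurd hx List.not_mem_nil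
  | cond c l₁ l₂ _ ih₁ ih₂ =>
    simp only [LExp.eval]
    cases c.eval σ ω
    · exact ih₂
    · exact ih₁
  | op1 o l _ => exact o.eval_alive σ _
  | op2 o l₁ l₂ ih₁ ih₂ => exact o.eval_alive ih₁ ih₂

/-! ### Environments -/

theorem Env.ext {ω ω' : Env} (hb : ∀ t x, ω.base t x = ω'.base t x)
    (hs : ∀ t k, ω.seq t k = ω'.seq t k) : ω = ω' := by
  cases ω
  cases ω'
  simp only [Env.mk.injEq]
  exact ⟨funext fun t => funext (hb t), funext fun t => funext (hs t)⟩

theorem Env.push_seq_zero (ω : Env) (t : BTy) (v : List t.Val) : (ω.push t v).seq t 0 = v := by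
  simp [Env.push]

theorem Env.push_seq_succ (ω : Env) (t : BTy) (v : List t.Val) (k : ℕ) :
    (ω.push t v).seq t (k + 1) = ω.seq t k := by
  simp [Env.push]

theorem Env.push_seq_ne (ω : Env) {t t' : BTy} (v : List t.Val) (h : t' ≠ t) (k : ℕ) :
    (ω.push t v).seq t' k = ω.seq t' k := by
  simp [Env.push, h]

theorem Env.push_seq_lift (ω : Env) (t t' : BTy) (v : List t.Val) (k : ℕ) :
    (ω.push t v).seq t' (if t' = t then k + 1 else k) = ω.seq t' k := by
  split_ifs with h
  · subst h
    exact ω.push_seq_succ t' v k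
  · exact ω.push_seq_ne v h k

theorem Env.Consistent.push {ω : Env} {σ : State} (h : ω.Consistent σ) {t : BTy} {v : List t.Val}
    (hv : ∀ x ∈ v, σ.AliveVal t x) : (ω.push t v).Consistent σ := by
  refine ⟨h.1, fun t' k => ?_⟩
  by_cases ht : t' = t
  · subst ht
    cases k with
    | zero => rwa [Env.push_seq_zero]
    | succ k =>
      rw [Env.push_seq_succ]
      exact h.2 t' k
  · rw [Env.push_seq_ne _ _ ht]
    exact h.2 t' k

theorem State.AliveVal.of_alive {σ τ : State} (h : ∀ o, σ.Alive o → τ.Alive o) {t : BTy}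
    {v : t.Val} (hv : σ.AliveVal t v) : τ.AliveVal t v := by
  cases t with
  | obj => exact h v hv
  | _ => trivial

theorem Env.Consistent.of_alive {ω : Env} {σ τ : State} (h : ω.Consistent σ)
    (ha : ∀ o, σ.Alive o → τ.Alive o) : ω.Consistent τ :=
  ⟨fun t x => (h.1 t x).of_alive ha, fun t k v hv => (h.2 t k v hv).of_alive ha⟩

/-- The values of the logical variables of basic type with one value changed. -/
def Env.setBase (ω : Env) (t : BTy) (x : ℕ) (d : t.Val) : Env :=
  { ω with base := Function.update ω.base t (Function.update (ω.base t) x d) }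

def Env.setSeq (ω : Env) (t : BTy) (k : ℕ) (d : List t.Val) : Env :=
  { ω with seq := Function.update ω.seq t (Function.update (ω.seq t) k d) }

theorem Env.setBase_base_self (ω : Env) (t : BTy) (x : ℕ) (d : t.Val) :
    (ω.setBase t x d).base t x = d := by
  simp [Env.setBase]

theorem Env.setBase_base_ne (ω : Env) {t t' : BTy} {x x' : ℕ} (d : t.Val)
    (h : t' ≠ t ∨ x' ≠ x) : (ω.setBase t x d).base t' x' = ω.base t' x' := by
  by_cases ht : t' = t
  · subst ht
    simp [Env.setBase, h.resolve_left (fun h => h rfl)]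
  · simp [Env.setBase, ht]

theorem Env.setSeq_seq_self (ω : Env) (t : BTy) (k : ℕ) (d : List t.Val) :
    (ω.setSeq t k d).seq t k = d := by
  simp [Env.setSeq]

theorem Env.setSeq_seq_ne (ω : Env) {t t' : BTy} {k k' : ℕ} (d : List t.Val)
    (h : t' ≠ t ∨ k' ≠ k) : (ω.setSeq t k d).seq t' k' = ω.seq t' k' := by
  by_cases ht : t' = t
  · subst ht
    simp [Env.setSeq, h.resolve_left (fun h => h rfl)]
  · simp [Env.setSeq, ht]

theorem Env.setBase_setBase (ω : Env) (t : BTy) (x : ℕ) (d d' : t.Val) :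
    (ω.setBase t x d).setBase t x d' = ω.setBase t x d' := by
  refine Env.ext (fun t' x' => ?_) fun _ _ => rfl
  by_cases ht : t' = t
  · subst ht
    by_cases hx : x' = x <;> simp [Env.setBase, hx]
  · simp only [Env.setBase_base_ne _ _ (.inl ht)]

theorem Env.Consistent.setBase {ω : Env} {σ : State} (h : ω.Consistent σ) {t : BTy} (x : ℕ)
    {d : t.Val} (hd : σ.AliveVal t d) : (ω.setBase t x d).Consistent σ := by
  refine ⟨fun t' x' => ?_, h.2⟩
  by_cases hx : t' = t ∧ x' = x
  · obtain ⟨rfl, rfl⟩ := hx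
    rwa [Env.setBase_base_self]
  · rw [Env.setBase_base_ne _ _ (by tauto)]
    exact h.1 t' x'

theorem Env.Consistent.setSeq {ω : Env} {σ : State} (h : ω.Consistent σ) {t : BTy} (k : ℕ)
    {d : List t.Val} (hd : ∀ x ∈ d, σ.AliveVal t x) : (ω.setSeq t k d).Consistent σ := by
  refine ⟨h.1, fun t' k' => ?_⟩
  by_cases hx : t' = t ∧ k' = k
  · obtain ⟨rfl, rfl⟩ := hx
    rwa [Env.setSeq_seq_self]
  · rw [Env.setSeq_seq_ne _ _ (by tauto)]
    exact h.2 t' k'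

/-! ### Simultaneous substitution -/

theorem LExp.eval_shift (σ : State) (ω : Env) (t : BTy) (v : List t.Val) {τ : Ty} (l : LExp τ) :
    (l.shift t).eval σ (ω.push t v) = l.eval σ ω := by
  induction l with
  | svar t' k => exact ω.push_seq_lift t t' v k
  | _ => simp_all [LExp.shift, LExp.eval, Env.push]

/-- The state in which the substituted variables have the values of their substitutes. -/
noncomputable def Subst.state (θ : Subst) (σ : State) (ω : Env) : State :=
  { loc := fun v => (θ.var v).eval σ ω, res := θ.res.eval σ ω, heap := σ.heap }

noncomputable def Subst.env (θ : Subst) (σ : State) (ω : Env) : Env :=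
  { base := fun t x => (θ.lvar t x).eval σ ω, seq := fun t k => (θ.svar t k).eval σ ω }

theorem Subst.state_lift (θ : Subst) (σ : State) (ω : Env) (t : BTy) (v : List t.Val) :
    (θ.lift t).state σ (ω.push t v) = θ.state σ ω := by
  simp only [Subst.state, Subst.lift, LExp.eval_shift]

theorem Subst.env_lift (θ : Subst) (σ : State) (ω : Env) (t : BTy) (v : List t.Val) :
    (θ.lift t).env σ (ω.push t v) = (θ.env σ ω).push t v := by
  refine Env.ext (fun t' x => LExp.eval_shift ..) fun t' k => ?_
  simp only [Subst.env, Subst.lift]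
  by_cases h : t' = t
  · subst h
    cases k with
    | zero => simp [LExp.eval, Env.push_seq_zero]
    | succ k => simp [LExp.eval_shift, Env.push_seq_succ]
  · simp [h, LExp.eval_shift, Env.push_seq_ne]

theorem LExp.eval_subst (θ : Subst) (σ : State) (ω : Env) {τ : Ty} (l : LExp τ) :
    (l.subst θ).eval σ ω = l.eval (θ.state σ ω) (θ.env σ ω) := by
  induction l with
  | fld l x ih =>
    simp only [LExp.subst, LExp.eval, ih]
    rfl
  | lvar | svar | var | res => rfl
  | _ => simp_all [LExp.subst, LExp.eval]

/-- A substitution amounts to evaluating in the state and environment of the substitutes, and both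
commute with lifting below a quantifier. The heap is untouched, so the quantifiers keep their
ranges. -/
theorem sat_subst (σ : State) (tags : Set Tag) (p : Asrt) : ∀ (θ : Subst) (ω : Env),
    Sat σ tags ω (p.subst θ) ↔ Sat (θ.state σ ω) tags (θ.env σ ω) p := by
  induction p with
  | eq l₁ l₂ => intro θ ω; simp only [Asrt.subst, Sat, LExp.eval_subst]
  | isIn l Cs => intro θ ω; simp only [Asrt.subst, Sat, LExp.eval_subst]; rfl
  | neg a ih => intro θ ω; simp only [Asrt.subst, Sat, ih]
  | and a b ih₁ ih₂ => intro θ ω; simp only [Asrt.subst, Sat, ih₁, ih₂]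
  | ex t a ih =>
    intro θ ω
    simp only [Asrt.subst, Sat, ih, Subst.state_lift, Subst.env_lift]
    refine exists_congr fun v => and_congr_left' ?_
    refine forall₂_congr fun x _ => ?_
    cases t <;> rfl
  | tag t => intro θ ω; rfl

/-! ### Coincidence -/

/-- `y` has the same value in both states and environments; instance variables are compared on
the objects that exist in `σ`. -/
def SymAgree (σ τ : State) (ω υ : Env) : Sym → Prop
  | .var v => τ.loc v = σ.loc v
  | .res => τ.res = σ.res
  | .fld x => ∀ o, σ.Alive o → τ.heap o x = σ.heap o x
  | .lvar t x => υ.base t x = ω.base t x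
  | .svar t k => υ.seq t k = ω.seq t k

theorem LExp.eval_congr {σ τ : State} {ω υ : Env} (hσ : σ.Consistent) (hω : ω.Consistent σ)
    {t : Ty} (l : LExp t) (h : ∀ y ∈ l.free, SymAgree σ τ ω υ y) :
    l.eval τ υ = l.eval σ ω := by
  induction l with
  | lvar | svar | var | res => exact h _ rfl
  | fld l x ih =>
    simp only [LExp.eval]
    rw [ih fun y hy => h y (.inr hy)]
    exact State.fld_eq_of_heap (h _ (.inl rfl) _ (LExp.eval_alive hσ hω l))
  | null | undef | rep | natC | boolC | strC | nil => rfl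
  | cond c l₁ l₂ ih ih₁ ih₂ =>
    simp only [LExp.eval]
    rw [ih fun y hy => h y (.inl (.inl hy)), ih₁ fun y hy => h y (.inl (.inr hy)),
      ih₂ fun y hy => h y (.inr hy)]
  | op1 o l ih =>
    simp only [LExp.eval]
    rw [ih h]
  | op2 o l₁ l₂ ih₁ ih₂ =>
    simp only [LExp.eval]
    rw [ih₁ fun y hy => h y (.inl hy), ih₂ fun y hy => h y (.inr hy)]

theorem SymAgree.push {σ τ : State} {ω υ : Env} {t : BTy} (v : List t.Val) {S : Set Sym}
    (h : ∀ y, y.lift t ∈ S → SymAgree σ τ ω υ y) :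
    ∀ y ∈ S, SymAgree σ τ (ω.push t v) (υ.push t v) y := by
  intro y hy
  cases y with
  | svar t' k =>
    by_cases ht : t' = t
    · subst ht
      cases k with
      | zero => simp [SymAgree, Env.push_seq_zero]
      | succ k =>
        simp only [SymAgree, Env.push_seq_succ]
        exact h (.svar t' k) (by simpa [Sym.lift] using hy)
    · simp only [SymAgree, Env.push_seq_ne _ _ ht]
      exact h (.svar t' k) (by simpa [Sym.lift, ht] using hy)
  | var v => exact h (.var v) hy
  | res => exact h .res hy
  | fld x => exact h (.fld x) hy
  | lvar t' x => exact h (.lvar t' x) hy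

/-- Quantifiers over objects can observe which objects exist. Either they are absent, or both states
must have the same existing objects; the ranges of all other quantifiers are fixed. -/
theorem sat_congr {σ τ : State} {tags : Set Tag} (hσ : σ.Consistent) (p : Asrt)
    (ha : p.NoObjQuant ∨ ∀ o, τ.Alive o ↔ σ.Alive o) : ∀ {ω υ : Env}, ω.Consistent σ →
    (∀ y ∈ p.free, SymAgree σ τ ω υ y) → (Sat τ tags υ p ↔ Sat σ tags ω p) := by
  induction p with
  | eq l₁ l₂ =>
    intro ω υ hω h
    simp only [Sat]
    rw [l₁.eval_congr hσ hω fun y hy => h y (.inl hy), l₂.eval_congr hσ hω fun y hy => h y (.inr hy)]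
  | isIn l Cs =>
    intro ω υ hω h
    simp only [Sat]
    rw [l.eval_congr hσ hω fun y hy => h y (.inr hy),
      State.fld_eq_of_heap (h _ (.inl rfl) _ (LExp.eval_alive hσ hω l))]
  | neg a ih =>
    intro ω υ hω h
    simp only [Sat]
    rw [ih ha hω h]
  | and a b ih₁ ih₂ =>
    intro ω υ hω h
    simp only [Sat]
    rw [ih₁ (ha.imp_left And.left) hω fun y hy => h y (.inl hy),
      ih₂ (ha.imp_left And.right) hω fun y hy => h y (.inr hy)]
  | ex t a ih =>
    intro ω υ hω h
    simp only [Sat]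
    refine exists_congr fun v => ?_
    have hv : (∀ x ∈ v, τ.AliveVal t x) ↔ ∀ x ∈ v, σ.AliveVal t x := by
      refine forall₂_congr fun x _ => ?_
      cases t with
      | obj => exact (ha.resolve_left fun h => h.1 rfl) x
      | _ => exact Iff.rfl
    rw [hv]
    refine and_congr_right fun hv => ih (ha.imp_left And.right) (hω.push hv) (SymAgree.push v h)
  | tag t => intros; rfl

/-- The special case that the heap is the same. -/
theorem sat_congr_heap {σ τ : State} {tags : Set Tag} {ω υ : Env} (hσ : σ.Consistent)
    (hω : ω.Consistent σ) (p : Asrt) (hh : τ.heap = σ.heap)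
    (hl : ∀ v, .var v ∈ p.free → τ.loc v = σ.loc v) (hr : .res ∈ p.free → τ.res = σ.res)
    (hb : ∀ t x, .lvar t x ∈ p.free → υ.base t x = ω.base t x)
    (hs : ∀ t k, .svar t k ∈ p.free → υ.seq t k = ω.seq t k) :
    Sat τ tags υ p ↔ Sat σ tags ω p := by
  refine sat_congr hσ p (.inr fun o => ?_) hω fun y hy => ?_
  · exact ⟨fun h => h.of_cls (by rw [hh]), fun h => h.of_cls (by rw [hh])⟩
  · cases y with
    | var v => exact hl v hy
    | res => exact hr hy
    | fld x => exact fun o _ => by rw [hh]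
    | lvar t x => exact hb t x hy
    | svar t k => exact hs t k hy

theorem sat_setBase {σ : State} {tags : Set Tag} {ω : Env} (hσ : σ.Consistent)
    (hω : ω.Consistent σ) {p : Asrt} {t : BTy} {x : ℕ} (hx : .lvar t x ∉ p.free) (d : t.Val) :
    Sat σ tags (ω.setBase t x d) p ↔ Sat σ tags ω p := by
  refine sat_congr_heap hσ hω p rfl (fun _ _ => rfl) (fun _ => rfl) (fun t' x' h => ?_)
    fun _ _ _ => rfl
  refine Env.setBase_base_ne _ _ ?_
  by_contra! h'
  obtain ⟨rfl, rfl⟩ := h'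
  exact hx h

theorem sat_setSeq {σ : State} {tags : Set Tag} {ω : Env} (hσ : σ.Consistent)
    (hω : ω.Consistent σ) {p : Asrt} {t : BTy} {k : ℕ} (hk : .svar t k ∉ p.free)
    (d : List t.Val) : Sat σ tags (ω.setSeq t k d) p ↔ Sat σ tags ω p := by
  refine sat_congr_heap hσ hω p rfl (fun _ _ => rfl) (fun _ => rfl) (fun _ _ _ => rfl)
    fun t' k' h => ?_
  refine Env.setSeq_seq_ne _ _ ?_
  by_contra! h'
  obtain ⟨rfl, rfl⟩ := h'
  exact hk h

theorem sat_congr_tags {σ : State} {tags tags' : Set Tag} (p : Asrt)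
    (h : ∀ t ∈ p.tagsIn, t ∈ tags ↔ t ∈ tags') : ∀ ω, Sat σ tags ω p ↔ Sat σ tags' ω p := by
  induction p with
  | eq | isIn => exact fun _ => Iff.rfl
  | neg a ih => exact fun ω => not_congr (ih h ω)
  | and a b ih₁ ih₂ =>
    exact fun ω => and_congr (ih₁ (fun t ht => h t (.inl ht)) ω) (ih₂ (fun t ht => h t (.inr ht)) ω)
  | ex t a ih => exact fun ω => exists_congr fun v => and_congr_right fun _ => ih h _
  | tag t => exact fun _ => h t rfl

/-! ### Abbreviations -/

section

variable {σ : State} {tags : Set Tag} {ω : Env}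

theorem sat_and (a b : Asrt) : Sat σ tags ω (.and a b) ↔ Sat σ tags ω a ∧ Sat σ tags ω b := Iff.rfl

theorem sat_neg (a : Asrt) : Sat σ tags ω (.neg a) ↔ ¬ Sat σ tags ω a := Iff.rfl

theorem sat_tag (t : Tag) : Sat σ tags ω (.tag t) ↔ t ∈ tags := Iff.rfl

theorem sat_eq {τ : Ty} (l₁ l₂ : LExp τ) :
    Sat σ tags ω (.eq l₁ l₂) ↔ l₁.eval σ ω = l₂.eval σ ω := Iff.rfl

theorem sat_or (a b : Asrt) : Sat σ tags ω (a.or b) ↔ Sat σ tags ω a ∨ Sat σ tags ω b := by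
  simp only [Asrt.or, Sat]
  tauto

theorem sat_imp (a b : Asrt) : Sat σ tags ω (a.imp b) ↔ (Sat σ tags ω a → Sat σ tags ω b) := by
  simp only [Asrt.imp, sat_or, sat_neg]
  tauto

theorem sat_iff (a b : Asrt) : Sat σ tags ω (a.iff b) ↔ (Sat σ tags ω a ↔ Sat σ tags ω b) := by
  simp only [Asrt.iff, sat_and, sat_imp]
  tauto

theorem sat_true : Sat σ tags ω .true := rfl

theorem sat_ne (l₁ l₂ : LExp (.base .obj)) :
    Sat σ tags ω (.ne l₁ l₂) ↔ l₁.eval σ ω ≠ l₂.eval σ ω := Iff.rfl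

theorem sat_holds (l : LExp (.base .bool)) : Sat σ tags ω l.holds ↔ l.eval σ ω = true := Iff.rfl

theorem State.isBool_ne_null {o : Obj} (h : σ.IsBool o) : o ≠ .null := by
  rintro rfl
  simp [State.IsBool, State.fld, Obj.IsObj] at h

theorem sat_isBool (l : LExp (.base .obj)) :
    Sat σ tags ω (isBool l) ↔ σ.IsBool (l.eval σ ω) :=
  ⟨fun h => h.2, fun h => ⟨State.isBool_ne_null h, h⟩⟩

theorem sat_isBoolVal (l : LExp (.base .obj)) (b : LExp (.base .bool)) :
    Sat σ tags ω (isBoolVal l b) ↔ σ.IsBoolVal (l.eval σ ω) (b.eval σ ω) := by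
  simp only [isBoolVal, sat_and, sat_isBool, sat_iff, sat_holds, sat_ne]
  rfl

theorem sat_guarded (l : LExp (.base .obj)) (a : Asrt) :
    Sat σ tags ω (guarded l a) ↔ (.failsafe ∈ tags → l.eval σ ω ≠ .null) ∧
      (.typesafe ∈ tags → l.eval σ ω ≠ .null → Sat σ tags ω a) := by
  simp only [guarded, sat_and, sat_imp, sat_tag, sat_ne]
  rfl

theorem sat_isIn_one (l : LExp (.base .obj)) (C : ClassName) :
    Sat σ tags ω (.isIn l [C]) ↔ σ.fld (l.eval σ ω) .cls = .rep C := by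
  simp [Sat]

theorem sat_substRes (p : Asrt) (l : LExp (.base .obj)) :
    Sat σ tags ω (p.substRes l) ↔ Sat (σ.setRes (l.eval σ ω)) tags ω p :=
  sat_subst σ tags p _ ω

theorem sat_substVar (p : Asrt) (v : Var) (l : LExp (.base .obj)) :
    Sat σ tags ω (p.substVar v l) ↔ Sat (σ.setLoc v (l.eval σ ω)) tags ω p := by
  rw [Asrt.substVar, sat_subst]
  have : Subst.state { var := Function.update LExp.var v l } σ ω = σ.setLoc v (l.eval σ ω) := by
    refine State.ext (fun w => ?_) rfl rfl
    by_cases h : w = v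
    · subst h
      simp [Subst.state, State.setLoc]
    · simp [Subst.state, State.setLoc, h, LExp.eval]
  rw [this]
  rfl

theorem sat_substNat (p : Asrt) (z : ℕ) (l : LExp (.base .nat)) :
    Sat σ tags ω (p.substNat z l) ↔ Sat σ tags (ω.setBase .nat z (l.eval σ ω)) p := by
  rw [Asrt.substNat, sat_subst]
  refine iff_of_eq (congrArg (fun υ => Sat σ tags υ p) (Env.ext (fun t x => ?_) fun t k => rfl))
  by_cases h : t = .nat ∧ x = z
  · obtain ⟨rfl, rfl⟩ := h
    simp [Subst.env, Env.setBase]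
  · rw [Env.setBase_base_ne _ _ (by tauto)]
    simp only [Subst.env]
    by_cases ht : t = .nat
    · subst ht
      have : x ≠ z := by tauto
      simp [this, LExp.eval]
    · simp [ht, LExp.eval]

theorem single_iff {t : BTy} {v : List t.Val} :
    Sat σ tags (ω.push t v) (.single t) ↔ ∃ d, v = [d] := by
  simp only [Asrt.single, Sat, LExp.eval, Op1.eval, Env.push_seq_zero]
  exact List.length_eq_one_iff

theorem LExp.eval_first {t : BTy} (d : t.Val) : (LExp.first t).eval σ (ω.push t [d]) = d := by
  simp only [LExp.first, LExp.eval, Op2.eval, Env.push_seq_zero]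
  rfl

/-- A value is coded by a sequence of length one. The substitution puts its first element for `x`
and moves the free sequence variables past the new binder. -/
theorem sat_ex1 (t : BTy) (x : ℕ) (p : Asrt) :
    Sat σ tags ω (.ex1 t x p) ↔ ∃ d, σ.AliveVal t d ∧ Sat σ tags (ω.setBase t x d) p := by
  have key : ∀ d : t.Val, Sat σ tags (ω.push t [d]) (p.subst
      { lvar := Function.update LExp.lvar t (Function.update (LExp.lvar t) x (.first t))
        svar := Function.update LExp.svar t fun k => .svar t (k + 1) }) ↔
      Sat σ tags (ω.setBase t x d) p := by
    intro d
    rw [sat_subst]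
    refine iff_of_eq (congrArg (fun υ => Sat σ tags υ p) (Env.ext (fun t' x' => ?_) fun t' k => ?_))
    · by_cases h : t' = t ∧ x' = x
      · obtain ⟨rfl, rfl⟩ := h
        simp [Subst.env, Env.setBase, LExp.eval_first]
      · rw [Env.setBase_base_ne _ _ (by tauto)]
        simp only [Subst.env]
        by_cases ht : t' = t
        · subst ht
          have : x' ≠ x := by tauto
          simp [this, LExp.eval, Env.push]
        · simp [ht, LExp.eval, Env.push]
    · simp only [Subst.env]
      by_cases ht : t' = t
      · subst ht
        simp [LExp.eval, Env.push_seq_succ, Env.setBase]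
      · simp [ht, LExp.eval, Env.push_seq_ne, Env.setBase]
  simp only [Asrt.ex1, Sat]
  constructor
  · rintro ⟨v, hv, h₁, h₂⟩
    obtain ⟨d, rfl⟩ := single_iff.1 h₁
    exact ⟨d, hv d (List.mem_singleton_self d), (key d).1 h₂⟩
  · rintro ⟨d, hd, h⟩
    refine ⟨[d], fun x hx => ?_, single_iff.2 ⟨d, rfl⟩, (key d).2 h⟩
    rw [List.mem_singleton.1 hx]
    exact hd

theorem sat_exSeq (t : BTy) (k : ℕ) (p : Asrt) :
    Sat σ tags ω (.exSeq t k p) ↔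
      ∃ v, (∀ x ∈ v, σ.AliveVal t x) ∧ Sat σ tags (ω.setSeq t k v) p := by
  simp only [Asrt.exSeq, Sat]
  refine exists_congr fun v => and_congr_right fun _ => ?_
  rw [sat_subst]
  refine iff_of_eq (congrArg (fun υ => Sat σ tags υ p) (Env.ext (fun t' x' => rfl) fun t' j => ?_))
  simp only [Subst.env]
  by_cases ht : t' = t
  · subst ht
    by_cases hj : j = k
    · subst hj
      simp [LExp.eval, Env.push_seq_zero, Env.setSeq]
    · simp [hj, LExp.eval, Env.push_seq_succ, Env.setSeq]
  · simp [ht, LExp.eval, Env.push_seq_ne, Env.setSeq]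

theorem sat_all1_nat (x : ℕ) (p : Asrt) :
    Sat σ tags ω (.all1 .nat x p) ↔ ∀ d : ℕ, Sat σ tags (ω.setBase .nat x d) p := by
  simp only [Asrt.all1, sat_neg, sat_ex1]
  push Not
  exact ⟨fun h d => h d trivial, fun h d _ => h d⟩

theorem LExp.eval_lt (l₁ l₂ : LExp (.base .nat)) :
    (LExp.op2 .lt l₁ l₂).eval σ ω = true ↔ (l₁.eval σ ω : ℕ) < l₂.eval σ ω := by
  simp only [LExp.eval, Op2.eval, decide_eq_true_eq]
  rfl

/-- As `z'` differs from `z` and is not free in `r`, the updates of the two variables commute, and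
that of `z'` does not influence `r`. -/
theorem sat_decreases (hσ : σ.Consistent) (hω : ω.Consistent σ) {r : Asrt} {z z' : ℕ}
    (hz : z' ≠ z) (hr : .lvar .nat z' ∉ r.free) :
    Sat σ tags ω (decreases r z z') ↔ (.terminates ∈ tags →
      ∀ k : ℕ, Sat σ tags (ω.setBase .nat z k) r → k < ω.base .nat z) := by
  simp only [decreases, sat_imp, sat_tag, sat_all1_nat, sat_substNat, sat_holds]
  refine imp_congr_right fun _ => forall_congr' fun k => ?_
  have h₁ : (LExp.lvar .nat z').eval σ (ω.setBase .nat z' k) = k := ω.setBase_base_self .nat z' k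
  have h₂ : (ω.setBase .nat z' k).setBase .nat z k = (ω.setBase .nat z k).setBase .nat z' k := by
    refine Env.ext (fun t x => ?_) fun _ _ => rfl
    by_cases hx : t = .nat ∧ x = z
    · obtain ⟨rfl, rfl⟩ := hx
      rw [Env.setBase_base_self, Env.setBase_base_ne _ _ (.inr hz.symm), Env.setBase_base_self]
    · rw [Env.setBase_base_ne _ _ (by tauto)]
      by_cases hx' : t = .nat ∧ x = z'
      · obtain ⟨rfl, rfl⟩ := hx'
        rw [Env.setBase_base_self, Env.setBase_base_self]
      · rw [Env.setBase_base_ne _ _ (by tauto), Env.setBase_base_ne _ _ (by tauto),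
          Env.setBase_base_ne _ _ (by tauto)]
  rw [h₁, h₂, sat_setBase hσ (hω.setBase (t := .nat) (d := k) z trivial) hr]
  refine imp_congr_right fun _ => ?_
  have h₃ : (ω.setBase .nat z' k).base .nat z = ω.base .nat z :=
    ω.setBase_base_ne (t := .nat) k (.inr hz.symm)
  rw [LExp.eval_lt]
  change (ω.setBase .nat z' k).base .nat z' < (ω.setBase .nat z' k).base .nat z ↔ _
  rw [h₃, Env.setBase_base_self]

end

/-! ### Assignment to instance variables -/

theorem State.fld_setFld (σ : State) {o : Obj} (ho : o.IsObj) (x : Field) (d p : Obj) (y : Field) :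
    (σ.setFld o x d).fld p y = if p = o ∧ y = x then d else σ.fld p y := by
  simp only [State.fld, State.setFld, Function.update_apply]
  by_cases hp : p = o
  · subst hp
    by_cases hy : y = x <;> simp [ho, hy]
  · simp [hp]

/-- Aliasing is resolved at evaluation time by the inserted conditional, which asks whether the
dereferenced object is `this`. A genuine object is needed, since an update at `null` or at the mark
is invisible to `State.fld`. -/
theorem LExp.eval_substFld {σ : State} (h : (σ.loc .this).IsObj) (ω : Env) (x : Field) {τ : Ty}
    (l : LExp τ) :
    (l.substFld x).eval σ ω = l.eval (σ.setFld (σ.loc .this) x σ.res) ω := by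
  induction l with
  | fld l y ih =>
    simp only [LExp.substFld, LExp.eval, ← ih, State.fld_setFld σ h]
    by_cases hy : y = x
    · subst hy
      simp only [if_true, LExp.eval, Op2.eval, and_true]
      by_cases ht : (l.substFld y).eval σ ω = σ.loc .this <;> simp [ht]
    · simp [hy, LExp.eval]
  | lvar | svar | var | res => rfl
  | _ => simp_all [LExp.substFld, LExp.eval]

/-- The assigned field is one of the program and hence not `@c`: class membership is unaffected, and
the same objects exist before and after. -/
theorem sat_substFld {σ : State} (h : (σ.loc .this).IsObj) (tags : Set Tag) (x : FieldName)
    (p : Asrt) : ∀ ω, Sat σ tags ω (p.substFld x) ↔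
      Sat (σ.setFld (σ.loc .this) (.prog x) σ.res) tags ω p := by
  induction p with
  | eq l₁ l₂ => intro ω; simp only [Asrt.substFld, Sat, LExp.eval_substFld h]
  | isIn l Cs =>
    intro ω
    simp only [Asrt.substFld, Sat, LExp.eval_substFld h, State.fld_setFld σ h]
    simp
  | neg a ih => intro ω; simp only [Asrt.substFld, Sat, ih]
  | and a b ih₁ ih₂ => intro ω; simp only [Asrt.substFld, Sat, ih₁, ih₂]
  | ex t a ih =>
    intro ω
    simp only [Asrt.substFld, Sat, ih]
    refine exists_congr fun v => and_congr_left' (forall₂_congr fun y _ => ?_)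
    cases t with
    | obj =>
      exact ⟨fun h => h.of_cls (σ.setFld_heap_cls ..), fun h => h.of_cls (σ.setFld_heap_cls ..).symm⟩
    | _ => exact Iff.rfl
  | tag t => intro ω; rfl

/-! ### Object creation -/

/-- Whether the position `i` of the sequence of objects `k` is marked as holding the new object. -/
def NewCtx.marked (ρ : NewCtx) (ω : Env) (k i : ℕ) : Bool :=
  match ρ.mark k with
  | some j => List.getD (ω.seq .bool j) i false
  | none => false

/-- The environment `υ` for the state after the creation of `n` is represented by the environment
`ω` for the state before it. -/
structure NewRel (n : ℕ) (ρ : NewCtx) (ω υ : Env) : Prop where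
  base : ∀ t x, υ.base t x = ω.base t x
  nat : ∀ k, υ.seq .nat k = ω.seq .nat k
  str : ∀ k, υ.seq .str k = ω.seq .str k
  bool : ∀ k, υ.seq .bool k = ω.seq .bool (ρ.idx k)
  len : ∀ k, (υ.seq .obj k).length = (ω.seq .obj k).length
  getD : ∀ k i, List.getD (υ.seq .obj k) i Obj.null =
    bif ρ.marked ω k i then Obj.obj n else List.getD (ω.seq .obj k) i Obj.null

/-- The value `v` after the creation of `n` is represented by the translation. -/
def NewTr.Repr (n : ℕ) (σ : State) (ω : Env) : {τ : Ty} → NewTr τ → τ.Val → Prop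
  | .base .obj, x, v => v = bif x.isNew.eval σ ω then Obj.obj n else x.old.eval σ ω
  | .seq .obj, x, v => ∃ f : ℕ → Bool, (∀ e, (x.newAt e).eval σ ω = f (e.eval σ ω)) ∧
      List.length v = List.length (x.old.eval σ ω) ∧
      ∀ i, List.getD v i Obj.null =
        bif f i then Obj.obj n else List.getD (x.old.eval σ ω) i Obj.null
  | .base .nat, x, v => v = x.old.eval σ ω
  | .base .bool, x, v => v = x.old.eval σ ω
  | .base .str, x, v => v = x.old.eval σ ω
  | .seq .nat, x, v => v = x.old.eval σ ω
  | .seq .bool, x, v => v = x.old.eval σ ω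
  | .seq .str, x, v => v = x.old.eval σ ω

/-- Before the creation nothing refers to the inactive object. Hence an old value is never confused
with the new object, and the flags of the translation are unambiguous. -/
theorem LExp.eval_ne_new {σ : State} {ω : Env} {n : ℕ} (hσ : σ.Consistent) (hω : ω.Consistent σ)
    (hn : ¬ σ.Alive (.obj n)) (l : LExp (.base .obj)) : l.eval σ ω ≠ Obj.obj n := by
  intro h
  have := l.eval_alive hσ hω
  rw [h] at this
  exact hn this

theorem eval_newEq {σ : State} {ω : Env} {n : ℕ} (hσ : σ.Consistent) (hω : ω.Consistent σ)
    (hn : ¬ σ.Alive (.obj n)) (a₁ a₂ : LExp (.base .bool)) (l₁ l₂ : LExp (.base .obj)) :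
    (newEq a₁ l₁ a₂ l₂).eval σ ω = true ↔
      (bif a₁.eval σ ω then Obj.obj n else l₁.eval σ ω) =
        (bif a₂.eval σ ω then Obj.obj n else l₂.eval σ ω) := by
  have h₁ := l₁.eval_ne_new hσ hω hn
  have h₂ := l₂.eval_ne_new hσ hω hn
  simp only [newEq, LExp.eval, Op2.eval]
  cases a₁.eval σ ω <;> cases a₂.eval σ ω <;> simp [h₁, h₂.symm]

theorem State.fld_create (σ : State) (C : ClassName) (n : ℕ) (o : Obj) (x : Field) :
    (σ.create C n).fld o x = if o = .obj n then initFields C x else σ.fld o x := by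
  by_cases h : o = .obj n
  · subst h
    simp [State.fld, State.create, Obj.IsObj]
  · simp [State.fld, State.create, h]

/-- A value after the creation is an old value plus a flag for the new object, position by position
for sequences of objects. Every operation acts on these data, and the fields of the new object are
known constants. -/
theorem LExp.repr_new {σ : State} {n : ℕ} (C : ClassName) {ρ : NewCtx} {ω υ : Env}
    (hσ : σ.Consistent) (hω : ω.Consistent σ) (hn : ¬ σ.Alive (.obj n)) (h : NewRel n ρ ω υ)
    {τ : Ty} (l : LExp τ) : (l.new C ρ).Repr n σ ω (l.eval (σ.create C n) υ) := by
  induction l with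
  | lvar t x => cases t <;> exact h.base _ x
  | svar t k =>
    cases t with
    | nat => exact h.nat k
    | str => exact h.str k
    | bool => exact h.bool k
    | obj =>
      refine ⟨ρ.marked ω k, fun e => ?_, h.len k, h.getD k⟩
      simp only [LExp.new, NewCtx.marked]
      cases ρ.mark k <;> rfl
  | var | null | undef | rep | res => rfl
  | natC | boolC | strC => rfl
  | nil t =>
    cases t with
    | obj => exact ⟨fun _ => false, fun _ => rfl, rfl, fun _ => rfl⟩
    | _ => rfl
  | fld l x ih =>
    simp only [LExp.new, NewTr.Repr, LExp.eval] at ih ⊢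
    rw [ih, State.fld_create]
    have := (l.new C ρ).old.eval_ne_new hσ hω hn
    cases (l.new C ρ).isNew.eval σ ω
    · simp [this]
    · cases x <;> simp [initFields, LExp.eval]
  | @cond τ c l₁ l₂ ih ih₁ ih₂ =>
    have hc : c.eval (σ.create C n) υ = (c.new C ρ).old.eval σ ω := ih
    cases τ with
    | base t =>
      cases t <;> simp only [LExp.new, NewTr.Repr, LExp.eval, hc] at ih₁ ih₂ ⊢ <;> rw [ih₁, ih₂] <;>
        cases (c.new C ρ).old.eval σ ω <;> rfl
    | seq t =>
      cases t with
      | obj =>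
        obtain ⟨f₁, h₁, h₁', h₁''⟩ := ih₁
        obtain ⟨f₂, h₂, h₂', h₂''⟩ := ih₂
        refine ⟨fun i => bif (c.new C ρ).old.eval σ ω then f₁ i else f₂ i, fun e => ?_, ?_⟩
        · simp only [LExp.new, LExp.eval, h₁, h₂]
        · simp only [LExp.new, LExp.eval, hc]
          cases (c.new C ρ).old.eval σ ω
          · exact ⟨h₂', h₂''⟩
          · exact ⟨h₁', h₁''⟩
      | _ =>
        simp only [LExp.new, NewTr.Repr, LExp.eval, hc] at ih₁ ih₂ ⊢
        rw [ih₁, ih₂]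
  | op1 o l ih =>
    cases o with
    | len t =>
      cases t with
      | obj =>
        obtain ⟨f, -, hl, -⟩ := ih
        exact hl
      | _ => exact congrArg List.length ih
    | not => exact congrArg Bool.not ih
    | strLen => exact congrArg List.length ih
  | op2 o l₁ l₂ ih₁ ih₂ =>
    cases o with
    | eq t =>
      cases t with
      | obj =>
        simp only [LExp.new, NewTr.op2, NewTr.Repr, LExp.eval, Op2.eval] at ih₁ ih₂ ⊢
        rw [Bool.eq_iff_iff, eval_newEq hσ hω hn, ← ih₁, ← ih₂]
        simp
      | _ =>
        simp only [NewTr.Repr] at ih₁ ih₂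
        simp only [LExp.new, NewTr.op2, NewTr.Repr, LExp.eval, ih₁, ih₂]
    | snoc t =>
      cases t with
      | obj =>
        obtain ⟨f, hf, hl, hg⟩ := ih₁
        have ih₂ : l₂.eval (σ.create C n) υ = bif (l₂.new C ρ).isNew.eval σ ω then Obj.obj n
          else (l₂.new C ρ).old.eval σ ω := ih₂
        -- The appended element stands at the position given by the old length and brings its own
        -- flag; all other positions keep theirs.
        refine ⟨fun i => bif decide (i = List.length ((l₁.new C ρ).old.eval σ ω)) then
          (l₂.new C ρ).isNew.eval σ ω else f i, fun e => ?_, ?_, fun i => ?_⟩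
        · simp only [LExp.new, NewTr.op2, LExp.eval, Op2.eval, Op1.eval, hf]
          congr 1
          exact decide_eq_decide.2 Iff.rfl
        · simp only [LExp.new, NewTr.op2, LExp.eval, Op2.eval, List.length_append, hl]
          rfl
        · simp only [LExp.new, NewTr.op2, LExp.eval, Op2.eval]
          have hgi := hg i
          rcases lt_trichotomy i (List.length ((l₁.new C ρ).old.eval σ ω)) with hi | hi | hi
          · rw [List.getD_append _ _ _ _ (by omega), List.getD_append _ _ _ _ hi, hgi]
            simp [hi.ne]
          · rw [List.getD_append_right _ _ _ _ (by omega), List.getD_append_right _ _ _ _ (by omega),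
              ih₂]
            simp [hi, hl]
          · rw [List.getD_append_right _ _ _ _ (by omega), List.getD_append_right _ _ _ _ (by omega)]
            -- Past the appended element every lookup yields the default `null`, and `hgi` relates
            -- this default to the flag at `i`.
            rw [List.getD_eq_default _ _ (by omega), List.getD_eq_default _ _ (by omega)] at hgi
            rw [List.getD_eq_default _ _ (by simp; omega),
              List.getD_eq_default _ _ (by simp; omega), hgi]
            cases f i <;> simp [hi.ne']
      | _ =>
        simp only [NewTr.Repr] at ih₁ ih₂
        simp only [LExp.new, NewTr.op2, NewTr.Repr, LExp.eval, ih₁, ih₂]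
    | add | sub | mul | div | mod | lt | and | strAt | strSnoc =>
      simp only [NewTr.Repr] at ih₁ ih₂
      simp only [LExp.new, NewTr.op2, NewTr.Repr, LExp.eval, ih₁, ih₂]
    | _ =>
      rename_i t
      cases t with
      | obj =>
        obtain ⟨f, hf, hl, hg⟩ := ih₁
        have ih₂ : l₂.eval (σ.create C n) υ = (l₂.new C ρ).old.eval σ ω := ih₂
        simp only [LExp.new, NewTr.op2, NewTr.Repr, LExp.eval, Op2.eval, ih₂]
        rw [hf]
        -- The default of type object is `null`, so this also covers positions out of range.
        exact hg _
      | _ =>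
        simp only [NewTr.Repr] at ih₁ ih₂
        simp only [LExp.new, NewTr.op2, NewTr.Repr, LExp.eval, ih₁, ih₂]

theorem NewRel.push_nat {n : ℕ} {ρ : NewCtx} {ω υ : Env} (h : NewRel n ρ ω υ) (v : List ℕ) :
    NewRel n ρ (ω.push .nat v) (υ.push .nat v) where
  base := h.base
  nat k := by
    cases k with
    | zero => simp only [Env.push_seq_zero]
    | succ k => simpa only [Env.push_seq_succ] using h.nat k
  str := h.str
  bool := h.bool
  len := h.len
  getD := h.getD

theorem NewRel.push_str {n : ℕ} {ρ : NewCtx} {ω υ : Env} (h : NewRel n ρ ω υ)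
    (v : List (List ℕ)) : NewRel n ρ (ω.push .str v) (υ.push .str v) where
  base := h.base
  nat := h.nat
  str k := by
    cases k with
    | zero => simp only [Env.push_seq_zero]
    | succ k => simpa only [Env.push_seq_succ] using h.str k
  bool := h.bool
  len := h.len
  getD := h.getD

theorem NewRel.push_bool {n : ℕ} {ρ : NewCtx} {ω υ : Env} (h : NewRel n ρ ω υ)
    (v : List Bool) : NewRel n ρ.underBool (ω.push .bool v) (υ.push .bool v) where
  base := h.base
  nat := h.nat
  str := h.str
  bool k := by
    cases k with
    | zero => simp only [NewCtx.underBool, Env.push_seq_zero]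
    | succ k => simpa only [NewCtx.underBool, Env.push_seq_succ] using h.bool k
  len := h.len
  getD k i := by
    have hm : ρ.underBool.marked (ω.push .bool v) k i = ρ.marked ω k i := by
      simp only [NewCtx.marked, NewCtx.underBool]
      cases ρ.mark k with
      | none => rfl
      | some j => simp [Env.push_seq_succ]
    rw [hm]
    exact h.getD k i

/-- The boolean sequence pushed along with the old objects is the mask of the new binder. It takes
index `0`, which is why `underObj` shifts all earlier boolean indices and masks. -/
theorem NewRel.push_obj {n : ℕ} {ρ : NewCtx} {ω υ : Env} (h : NewRel n ρ ω υ)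
    {v v' : List Obj} {b : List Bool} (hl : v'.length = v.length)
    (hg : ∀ i, v'.getD i .null = bif b.getD i false then .obj n else v.getD i .null) :
    NewRel n ρ.underObj ((ω.push .obj v).push .bool b) (υ.push .obj v') where
  base := h.base
  nat := h.nat
  str := h.str
  bool k := by
    simp only [NewCtx.underObj, Env.push_seq_succ]
    exact h.bool k
  len k := by
    cases k with
    | zero => exact hl
    | succ k => exact h.len k
  getD k i := by
    cases k with
    | zero => exact hg i
    | succ k =>
      have hm : ρ.underObj.marked ((ω.push .obj v).push .bool b) (k + 1) i = ρ.marked ω k i := by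
        simp only [NewCtx.marked, NewCtx.underObj]
        cases ρ.mark k with
        | none => rfl
        | some j => rfl
      rw [hm]
      exact h.getD k i

/-- Equal sequences of objects may have different old parts, as the entries below the mask are
arbitrary. Hence the lengths are compared first, and then the actual objects at each position. -/
theorem sat_newEquation {σ : State} {n : ℕ} {tags : Set Tag} (C : ClassName) {ρ : NewCtx}
    {ω υ : Env} (hσ : σ.Consistent) (hω : ω.Consistent σ) (hn : ¬ σ.Alive (.obj n))
    (h : NewRel n ρ ω υ) {τ : Ty} (l₁ l₂ : LExp τ) :
    Sat σ tags ω (newEquation C ρ l₁ l₂) ↔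
      l₁.eval (σ.create C n) υ = l₂.eval (σ.create C n) υ := by
  have h₁ := l₁.repr_new C hσ hω hn h
  have h₂ := l₂.repr_new C hσ hω hn h
  cases τ with
  | base t =>
    cases t with
    | obj =>
      simp only [NewTr.Repr] at h₁ h₂
      rw [h₁, h₂]
      exact eval_newEq hσ hω hn ..
    | _ =>
      simp only [NewTr.Repr] at h₁ h₂
      rw [h₁, h₂]
      rfl
  | seq t =>
    cases t with
    | obj =>
      obtain ⟨_, -, hl₁, -⟩ := h₁
      obtain ⟨_, -, hl₂, -⟩ := h₂
      have pos : ∀ i : ℕ, Sat σ tags (ω.push .nat [i])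
          (newEq (((l₁.shift .nat).new C ρ).newAt (.first .nat))
            (.op2 (.at .obj) ((l₁.shift .nat).new C ρ).old (.first .nat))
            (((l₂.shift .nat).new C ρ).newAt (.first .nat))
            (.op2 (.at .obj) ((l₂.shift .nat).new C ρ).old (.first .nat))).holds ↔
          List.getD (l₁.eval (σ.create C n) υ) i Obj.null =
            List.getD (l₂.eval (σ.create C n) υ) i Obj.null := by
        intro i
        have hω' : (ω.push .nat [i]).Consistent σ := hω.push fun _ _ => trivial
        have h' := h.push_nat [i]
        obtain ⟨f₁, hf₁, -, hg₁⟩ := (l₁.shift .nat).repr_new C hσ hω' hn h'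
        obtain ⟨f₂, hf₂, -, hg₂⟩ := (l₂.shift .nat).repr_new C hσ hω' hn h'
        simp only [LExp.eval_shift] at hg₁ hg₂
        rw [sat_holds, eval_newEq hσ hω' hn, hf₁, hf₂, LExp.eval_first, hg₁, hg₂]
        simp only [LExp.eval, Op2.eval]
        rfl
      have len : ∀ i : ℕ, Sat σ tags (ω.push .nat [i])
          (LExp.op2 .lt (.first .nat) (.op1 (.len .obj) ((l₁.shift .nat).new C ρ).old)).holds ↔
          i < List.length (l₁.eval (σ.create C n) υ) := by
        intro i
        have hω' : (ω.push .nat [i]).Consistent σ := hω.push fun _ _ => trivial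
        obtain ⟨_, -, hl, -⟩ := (l₁.shift .nat).repr_new C hσ hω' hn (h.push_nat [i])
        rw [LExp.eval_shift] at hl
        rw [sat_holds, LExp.eval_lt, LExp.eval_first, hl]
        rfl
      have hlen : (LExp.op1 (.len .obj) (l₁.new C ρ).old).eval σ ω =
          (LExp.op1 (.len .obj) (l₂.new C ρ).old).eval σ ω ↔
          List.length (l₁.eval (σ.create C n) υ) = List.length (l₂.eval (σ.create C n) υ) := by
        rw [hl₁, hl₂]
        rfl
      simp only [newEquation, sat_and, sat_neg, sat_eq, hlen]
      constructor
      · rintro ⟨heq, h⟩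
        refine List.ext_getElem heq fun i hi hi' => ?_
        by_contra hne
        refine h ⟨[i], fun _ _ => trivial, single_iff.2 ⟨i, rfl⟩, (len i).2 hi, fun hp => hne ?_⟩
        have := (pos i).1 hp
        rwa [List.getD_eq_getElem _ _ hi, List.getD_eq_getElem _ _ hi'] at this
      · intro heq
        refine ⟨congrArg List.length heq, ?_⟩
        rintro ⟨v, -, hv, -, hp⟩
        obtain ⟨i, rfl⟩ := single_iff.1 hv
        exact hp ((pos i).2 (by rw [heq]))
    | _ =>
      simp only [NewTr.Repr] at h₁ h₂
      rw [h₁, h₂]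
      rfl

/-- The sequences over objects existing after the creation are exactly those obtained from a
sequence over old objects and a mask of the same length. Splitting the quantifier accordingly
therefore neither adds nor loses witnesses. -/
theorem sat_substNew {σ : State} {n : ℕ} {tags : Set Tag} (C : ClassName) (hσ : σ.Consistent)
    (hn : ¬ σ.Alive (.obj n)) (p : Asrt) : ∀ {ρ : NewCtx} {ω υ : Env}, ω.Consistent σ →
    NewRel n ρ ω υ → (Sat σ tags ω (p.substNew C ρ) ↔ Sat (σ.create C n) tags υ p) := by
  induction p with
  | eq l₁ l₂ => exact fun hω h => sat_newEquation C hσ hω hn h l₁ l₂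
  | isIn l Cs =>
    intro ρ ω υ hω h
    have hl : l.eval (σ.create C n) υ = bif (l.new C ρ).isNew.eval σ ω then Obj.obj n
      else (l.new C ρ).old.eval σ ω := l.repr_new C hσ hω hn h
    have hne := (l.new C ρ).old.eval_ne_new hσ hω hn
    simp only [Asrt.substNew, sat_or, sat_and, sat_neg, sat_holds]
    simp only [Sat, hl, State.fld_create]
    cases (l.new C ρ).isNew.eval σ ω
    · simp [hne]
    · by_cases hC : C ∈ Cs <;> simp [hC, initFields, sat_true, sat_neg]
  | neg a ih => exact fun hω h => not_congr (ih hω h)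
  | and a b ih₁ ih₂ => exact fun hω h => and_congr (ih₁ hω h) (ih₂ hω h)
  | ex t a ih =>
    intro ρ ω υ hω h
    cases t with
    | nat => exact exists_congr fun v => and_congr_right fun hv => ih (hω.push hv) (h.push_nat v)
    | str => exact exists_congr fun v => and_congr_right fun hv => ih (hω.push hv) (h.push_str v)
    | bool => exact exists_congr fun v => and_congr_right fun hv => ih (hω.push hv) (h.push_bool v)
    | obj =>
      simp only [Asrt.substNew, Sat]
      constructor
      · rintro ⟨v, hv, b, -, hlen, ha⟩
        have hlen : b.length = v.length := hlen
        have hv' : ∀ o ∈ v, σ.Alive o := hv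
        -- The new object is written into the marked positions.
        refine ⟨List.zipWith (fun c o => bif c then .obj n else o) b v, ?_, ?_⟩
        · intro o ho
          obtain ⟨i, hi, rfl⟩ := List.mem_iff_getElem.1 ho
          rw [List.getElem_zipWith]
          cases b[i]'(by simp at hi; omega)
          · exact State.alive_create C n (.inl (hv' _ (List.getElem_mem _)))
          · exact State.alive_create C n (.inr rfl)
        · refine (ih ((hω.push hv).push (t := .bool) fun _ _ => trivial) (h.push_obj ?_ fun i => ?_)).1 ha
          · simp [hlen]
          · by_cases hi : i < v.length
            · rw [List.getD_eq_getElem _ _ (by simp; omega), List.getD_eq_getElem _ _ (by omega),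
                List.getD_eq_getElem _ _ hi, List.getElem_zipWith]
            · rw [List.getD_eq_default _ _ (by simp; omega), List.getD_eq_default _ _ (by omega),
                List.getD_eq_default _ _ (by omega)]
              rfl
      · rintro ⟨v', hv', ha⟩
        have hv' : ∀ o ∈ v', (σ.create C n).Alive o := hv'
        have hv : ∀ o ∈ v'.map (fun o => if o = .obj n then .null else o), σ.Alive o := by
          intro o ho
          obtain ⟨o', ho', rfl⟩ := List.mem_map.1 ho
          split_ifs with hn'
          · trivial
          · exact State.alive_of_create (hv' _ ho') hn'
        refine ⟨v'.map (fun o => if o = .obj n then .null else o), hv,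
          v'.map (fun o => decide (o = .obj n)), fun _ _ => trivial, ?_, ?_⟩
        · simp [LExp.eval, Op1.eval, Env.push]
        · refine (ih ((hω.push hv).push (t := .bool) fun _ _ => trivial) (h.push_obj ?_ fun i => ?_)).2 ha
          · simp
          · by_cases hi : i < v'.length
            · rw [List.getD_eq_getElem _ _ hi, List.getD_eq_getElem _ _ (by simpa using hi),
                List.getD_eq_getElem _ _ (by simpa using hi)]
              simp only [List.getElem_map]
              by_cases hn' : v'[i] = .obj n <;> simp [hn']
            · rw [List.getD_eq_default _ _ (by omega), List.getD_eq_default _ _ (by simpa using hi),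
                List.getD_eq_default _ _ (by simpa using hi)]
              rfl
  | tag t => intros; rfl

theorem sat_substNew_empty {σ : State} {n : ℕ} {tags : Set Tag} {ω : Env} (C : ClassName)
    (hσ : σ.Consistent) (hω : ω.Consistent σ) (hn : ¬ σ.Alive (.obj n)) (p : Asrt) :
    Sat σ tags ω (p.substNew C {}) ↔ Sat (σ.create C n) tags ω p :=
  sat_substNew C hσ hn p hω
    ⟨fun _ _ => rfl, fun _ => rfl, fun _ => rfl, fun _ => rfl, fun _ => rfl, fun _ _ => rfl⟩

/-! ## Partial validity -/

/-- The constants in `K` have the values given by `κ`. -/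
def Env.Fixes (ω : Env) (K : Set ℕ) (κ : ℕ → ℕ) : Prop := ∀ x ∈ K, ω.base .nat x = κ x

/-- The outcome is a state in `S`, or an error that the tags permit; divergence is not considered. -/
def Allowed (tags : Set Tag) (S : Set State) : XState → Prop
  | .ok τ => τ ∈ S
  | .bot => True
  | .typeerror => .typesafe ∉ tags
  | .fail => .failsafe ∉ tags

theorem Allowed.of_error {tags : Set Tag} {S S' : Set State} {x : XState} (hx : x.IsError)
    (h : Allowed tags S x) : Allowed tags S' x := by
  cases x with
  | ok τ => exact absurd rfl (hx τ)
  | _ => exact h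

theorem Allowed.map {tags : Set Tag} {S S' : Set State} {x : XState} {f : State → State}
    (h : Allowed tags S x) (hf : ∀ τ, x = .ok τ → τ ∈ S → f τ ∈ S') :
    Allowed tags S' (x.map f) := by
  cases x with
  | ok τ => exact hf τ rfl h
  | _ => exact h

/-- Validity of a triple, up to termination, for the outcomes with at most `N` nested calls. -/
def PValid (π : Program) (K : Set ℕ) (κ : ℕ → ℕ) (N : ℕ) (T : Triple) : Prop :=
  ∀ ω : Env, ω.Fixes K κ → ∀ σ ∈ T.pre.states T.tags ω, ∀ x, Ev π N T.stmt σ x →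
    Allowed T.tags (T.post.states T.tags ω) x

theorem PValid.mono {π : Program} {K : Set ℕ} {κ : ℕ → ℕ} {N M : ℕ} {T : Triple}
    (h : PValid π K κ N T) (hM : M ≤ N) : PValid π K κ M T :=
  fun ω hω σ hσ x hx => h ω hω σ hσ x (hx.mono hM)

theorem Env.Fixes.setBase {ω : Env} {K : Set ℕ} {κ : ℕ → ℕ} (h : ω.Fixes K κ) {t : BTy} {x : ℕ}
    (hx : t = .nat → x ∉ K) (d : t.Val) : (ω.setBase t x d).Fixes K κ := by
  intro y hy
  rw [Env.setBase_base_ne]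
  · exact h y hy
  · by_contra! h'
    obtain ⟨rfl, rfl⟩ := h'
    exact hx rfl hy

-- Inversion of simple evaluations and use of frames

theorem Ev.var_inv {π : Program} {N : ℕ} {v : Var} {σ : State} {x : XState}
    (h : Ev π N (.var v) σ x) : (σ.loc v ≠ .undef ∧ x = .ok (σ.setRes (σ.loc v))) ∨
      (σ.loc v = .undef ∧ x = .typeerror) := by
  cases h with
  | var h => exact .inl ⟨h, rfl⟩
  | varErr h => exact .inr ⟨h, rfl⟩
  | first h => cases h

theorem Ev.ivar_inv {π : Program} {N : ℕ} {y : FieldName} {σ : State} {x : XState}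
    (h : Ev π N (.ivar y) σ x) :
    (σ.fld (σ.loc .this) (.prog y) ≠ .undef ∧
      x = .ok (σ.setRes (σ.fld (σ.loc .this) (.prog y)))) ∨
      (σ.fld (σ.loc .this) (.prog y) = .undef ∧ x = .typeerror) := by
  cases h with
  | ivar h => exact .inl ⟨h, rfl⟩
  | ivarErr h => exact .inr ⟨h, rfl⟩
  | first h => cases h

theorem Ev.null_inv {π : Program} {N : ℕ} {σ : State} {x : XState} (h : Ev π N .null σ x) :
    x = .ok (σ.setRes .null) := by
  cases h with
  | null => rfl
  | first h => cases h

theorem var_notMem_methodChange (π : Program) (v : Var) : .var v ∉ methodChange π := by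
  rintro ⟨x, h, -⟩
  cases h

theorem Stmt.var_mem_vars {s : Stmt} {v : Var} (h : .var v ∈ s.change) : .var v ∈ s.vars := by
  induction s with
  | call e m n args ih₁ ih₂ =>
    rcases h with h | h
    · exact .inl (ih₁ h)
    · obtain ⟨i, h⟩ := Set.mem_iUnion.1 h
      exact .inr (Set.mem_iUnion.2 ⟨i, ih₂ i h⟩)
  | new C n args ih =>
    obtain ⟨i, h⟩ := Set.mem_iUnion.1 h
    exact Set.mem_iUnion.2 ⟨i, ih i h⟩
  | _ =>
    simp only [Stmt.change, Stmt.vars, Set.mem_union, Set.mem_insert_iff,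
      Set.mem_empty_iff_false, reduceCtorEq, Set.mem_singleton_iff] at * <;> tauto

theorem var_notMem_changed {π : Program} {s : Stmt} {v : Var} (h : .var v ∉ s.vars) :
    .var v ∉ changed π s := by
  rintro (h' | h' | h')
  · cases h'
  · exact var_notMem_methodChange π v h'
  · exact h (Stmt.var_mem_vars h')

theorem Frame.symAgree {S : Set Sym} {σ τ : State} (h : Frame S σ τ) (hS : .res ∈ S) (ω : Env)
    {y : Sym} (hy : y ∉ S) : SymAgree σ τ ω ω y := by
  cases y with
  | var v => exact h.loc v hy
  | res => exact absurd hS hy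
  | fld x => exact fun o ho => h.heap o x ho hy
  | lvar | svar => rfl

theorem Frame.eval {π : Program} {s : Stmt} {σ τ : State} (h : Frame (changed π s) σ τ) {ω : Env}
    (hσ : σ.Consistent) (hω : ω.Consistent σ) {t : Ty} {l : LExp t}
    (hl : l.free ∩ changed π s = ∅) : l.eval τ ω = l.eval σ ω :=
  l.eval_congr hσ hω fun _ hy => h.symAgree (Set.mem_insert _ _) ω fun hy' =>
    (Set.disjoint_iff_inter_eq_empty.2 hl).le_bot ⟨hy, hy'⟩

-- Partial validity: the rules for statements

section

variable {π : Program} {K : Set ℕ} {κ : ℕ → ℕ} {N : ℕ} {tags : Set Tag}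

theorem pvalid_var (v : Var) (p : Asrt) : PValid π K κ N ⟨p.substRes (.var v), .var v, ∅, p⟩ := by
  rintro ω - σ ⟨hσ, hω, hp⟩ x hx
  rcases hx.var_inv with ⟨-, rfl⟩ | ⟨-, rfl⟩
  · exact ⟨hσ.setRes (hσ.1 v), hω.of_alive fun o ho => ho.of_cls rfl, (sat_substRes _ _).1 hp⟩
  · exact Set.notMem_empty _

theorem pvalid_varTag (v : Var) :
    PValid π K κ N ⟨.imp (.tag .typesafe) (.ne (.var v) .undef), .var v, tags, .true⟩ := by
  rintro ω - σ ⟨hσ, hω, hp⟩ x hx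
  rcases hx.var_inv with ⟨-, rfl⟩ | ⟨hu, rfl⟩
  · exact ⟨hσ.setRes (hσ.1 v), hω.of_alive fun o ho => ho.of_cls rfl, sat_true⟩
  · exact fun ht => (sat_imp _ _).1 hp ht hu

theorem pvalid_ivar (x : FieldName) (p : Asrt) :
    PValid π K κ N ⟨p.substRes (.fld (.var .this) (.prog x)), .ivar x, ∅, p⟩ := by
  rintro ω - σ ⟨hσ, hω, hp⟩ x hx
  rcases hx.ivar_inv with ⟨-, rfl⟩ | ⟨-, rfl⟩
  · exact ⟨hσ.setRes (hσ.alive_fld (hσ.1 _) _), hω.of_alive fun o ho => ho.of_cls rfl,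
      (sat_substRes _ _).1 hp⟩
  · exact Set.notMem_empty _

theorem pvalid_ivarTag (x : FieldName) :
    PValid π K κ N ⟨.imp (.tag .typesafe) (.ne (.fld (.var .this) (.prog x)) .undef), .ivar x,
      tags, .true⟩ := by
  rintro ω - σ ⟨hσ, hω, hp⟩ x hx
  rcases hx.ivar_inv with ⟨-, rfl⟩ | ⟨hu, rfl⟩
  · exact ⟨hσ.setRes (hσ.alive_fld (hσ.1 _) _), hω.of_alive fun o ho => ho.of_cls rfl, sat_true⟩
  · exact fun ht => (sat_imp _ _).1 hp ht hu

theorem pvalid_const (p : Asrt) : PValid π K κ N ⟨p.substRes .null, .null, tags, p⟩ := by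
  rintro ω - σ ⟨hσ, hω, hp⟩ x hx
  cases hx.null_inv
  exact ⟨hσ.setRes trivial, hω.of_alive fun o ho => ho.of_cls rfl, (sat_substRes _ _).1 hp⟩

theorem pvalid_asgn {p q : Asrt} {e : Stmt} (u : ℕ)
    (h : PValid π K κ N ⟨p, e, tags, q.substVar (.loc u) .res⟩) :
    PValid π K κ N ⟨p, .asgn u e, tags, q⟩ := by
  rintro ω hκ σ hσ x hx
  cases hx with
  | asgn hx =>
    obtain ⟨hτ, hω, hq⟩ := h ω hκ σ hσ _ hx
    exact ⟨hτ.setLoc _ hτ.2.1, hω.of_alive fun o ho => ho.of_cls rfl, (sat_substVar _ _ _).1 hq⟩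
  | first hf hx hxe => cases hf; exact (h ω hκ σ hσ _ hx).of_error hxe

theorem pvalid_iasgn {p q : Asrt} {e : Stmt} (y : FieldName)
    (h : PValid π K κ N ⟨p, e, tags, q.substFld y⟩) : PValid π K κ N ⟨p, .iasgn y e, tags, q⟩ := by
  rintro ω hκ σ hσ x hx
  cases hx with
  | iasgn hx ht =>
    obtain ⟨hτ, hω, hq⟩ := h ω hκ σ hσ _ hx
    exact ⟨hτ.setFld _ _ hτ.2.1, hω.of_alive fun o ho => ho.of_cls (State.setFld_heap_cls ..),
      (sat_substFld ht _ _ _ _).1 hq⟩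
  | first hf hx hxe => cases hf; exact (h ω hκ σ hσ _ hx).of_error hxe

theorem pvalid_seq {p q r : Asrt} {s₁ s₂ : Stmt} (h₁ : PValid π K κ N ⟨p, s₁, tags, r⟩)
    (h₂ : PValid π K κ N ⟨r, s₂, tags, q⟩) : PValid π K κ N ⟨p, .seq s₁ s₂, tags, q⟩ := by
  rintro ω hκ σ hσ x hx
  rcases hx.seq_inv with ⟨τ, hτ, hx⟩ | ⟨hx, hxe⟩
  · exact h₂ ω hκ τ (h₁ ω hκ σ hσ _ hτ) x hx
  · exact (h₁ ω hκ σ hσ _ hx).of_error hxe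

theorem mem_states_isBoolVal {r : Asrt} {ω : Env} {τ : State} {b : Bool} {a : Asrt}
    (h : τ ∈ (Asrt.and r a).states tags ω) (hb : τ.IsBoolVal τ.res b) :
    τ ∈ (Asrt.and r (isBoolVal .res (.boolC b))).states tags ω :=
  ⟨h.1, h.2.1, h.2.2.1, (sat_isBoolVal _ _).2 hb⟩

/-- The two conjuncts of the guard exclude the two errors that a condition can raise by its value,
each under its own tag. -/
theorem pvalid_cond {p q r : Asrt} {e s₁ s₂ : Stmt}
    (h : PValid π K κ N ⟨p, e, tags, .and r (guarded .res (isBool .res))⟩)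
    (h₁ : PValid π K κ N ⟨.and r (isBoolVal .res (.boolC true)), s₁, tags, q⟩)
    (h₂ : PValid π K κ N ⟨.and r (isBoolVal .res (.boolC false)), s₂, tags, q⟩) :
    PValid π K κ N ⟨p, .ite e s₁ s₂, tags, q⟩ := by
  rintro ω hκ σ hσ x hx
  cases hx with
  | ite b hτ hb hx =>
    have hτ := mem_states_isBoolVal (h ω hκ σ hσ _ hτ) hb
    cases b
    · exact h₂ ω hκ _ hτ x hx
    · exact h₁ ω hκ _ hτ x hx
  | iteNull hτ hn =>
    exact fun ht => ((sat_guarded _ _).1 (h ω hκ σ hσ _ hτ).2.2.2).1 ht hn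
  | iteType hτ hn hb =>
    exact fun ht => hb ((sat_isBool _).1 (((sat_guarded _ _).1 (h ω hκ σ hσ _ hτ).2.2.2).2 ht hn))
  | first hf hx hxe => cases hf; exact (h ω hκ σ hσ _ hx).of_error hxe

theorem pvalid_cons {p p₁ q q₁ : Asrt} {s : Stmt} {tags' : Set Tag} (hp : Entails tags p tags' p₁)
    (h : PValid π K κ N ⟨p₁, s, tags', q₁⟩) (hq : Entails tags' q₁ tags q) (ht : tags ⊆ tags') :
    PValid π K κ N ⟨p, s, tags, q⟩ := by
  rintro ω hκ σ hσ x hx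
  have := h ω hκ σ (hp ω hσ) x hx
  cases x with
  | ok τ => exact hq ω this
  | bot => trivial
  | typeerror => exact fun h => this (ht h)
  | fail => exact fun h => this (ht h)

theorem pvalid_passgn (f : Var → Option Term) (g : Var → LExp (.base .obj)) (p : Asrt)
    (h₁ : ∀ v, f v = none → g v = .var v) (h₂ : ∀ v t, f v = some t → t.exp = some (g v)) :
    PValid π K κ N ⟨p.subst { var := g }, .assign f, tags, p⟩ := by
  rintro ω - σ ⟨hσ, hω, hp⟩ x hx
  cases hx.assign_inv
  -- The state of the substitution is the state after the parallel assignment. Run-time values are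
  -- excluded as sources because they have no logical expression.
  have heq : Subst.state { var := g } σ ω = σ.setAll fun v => (f v).map σ.term := by
    refine State.ext (fun v => ?_) rfl rfl
    simp only [Subst.state, State.setAll]
    cases hf : f v with
    | none =>
      rw [h₁ v hf]
      rfl
    | some t =>
      have ht := h₂ v t hf
      cases t with
      | arg a =>
        have hg : a.exp = g v := Option.some.inj ht
        rw [← hg]
        cases a <;> rfl
      | undef =>
        have hg : .undef = g v := Option.some.inj ht
        rw [← hg]
        rfl
      | val o => cases ht
  have hc : (Subst.state { var := g } σ ω).Consistent :=
    hσ.of_loc rfl rfl fun v => (g v).eval_alive hσ hω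
  rw [heq] at hc
  refine ⟨hc, hω.of_alive fun o ho => ho.of_cls rfl, ?_⟩
  rw [← heq]
  exact (sat_subst _ _ _ _ _).1 hp

/-- Here the induction is on the run. It treats the loop, its unfolding into a conditional, and the
body followed by the loop together, with `p` holding before the first two and `p'` with a true
condition before the third. -/
theorem pvalid_loop {p p' : Asrt} {e s : Stmt} {b : ℕ} (hb : .lvar .obj b ∉ p'.free)
    (h₁ : PValid π K κ N ⟨p, e, tags, .and p' (guarded .res (isBool .res))⟩)
    (h₂ : PValid π K κ N ⟨.and p' (isBoolVal .res (.boolC true)), s, tags, p⟩) :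
    PValid π K κ N ⟨p, .while e s, tags, .ex1 .obj b (.and (p'.substRes (.lvar .obj b))
      (.and (isBoolVal (.lvar .obj b) (.boolC false)) (.eq .res .null)))⟩ := by
  rintro ω hκ σ hσ x hx
  set S := (Asrt.ex1 .obj b (.and (p'.substRes (.lvar .obj b))
      (.and (isBoolVal (.lvar .obj b) (.boolC false)) (.eq .res .null)))).states tags ω with hS
  -- The depth, the statement and the states are indices of the run; they are generalised and then
  -- recovered through equations.
  have aux : ∀ {M s₀ σ x}, Ev π M s₀ σ x → M = N →
      ((s₀ = .while e s ∨ s₀ = .ite e (.seq s (.while e s)) .null) → σ ∈ p.states tags ω →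
        Allowed tags S x) ∧
      (s₀ = .seq s (.while e s) →
        σ ∈ (Asrt.and p' (isBoolVal .res (.boolC true))).states tags ω → Allowed tags S x) := by
    intro M s₀ σ x hx
    induction hx with
    | loop hx ih =>
      rintro rfl
      refine ⟨?_, fun h => by cases h⟩
      rintro (h | h) hσ
      · cases h
        exact (ih rfl).1 (.inr rfl) hσ
      · cases h
    | seq hτ hx _ ih =>
      rintro rfl
      refine ⟨fun h => (by rcases h with h | h <;> cases h), ?_⟩
      rintro h hσ
      cases h
      exact (ih rfl).1 (.inl rfl) (h₂ ω hκ _ hσ _ hτ)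
    | ite c hτ hc hx _ ih =>
      rintro rfl
      refine ⟨?_, fun h => by cases h⟩
      rintro (h | h) hσ
      · cases h
      · cases h
        have hτ := h₁ ω hκ _ hσ _ hτ
        cases c with
        | true => exact (ih rfl).2 rfl (mem_states_isBoolVal hτ hc)
        | false =>
          cases Ev.null_inv hx
          rename_i τ _ _ _
          obtain ⟨hτ, hω, hp', -⟩ := hτ
          refine ⟨hτ.setRes trivial, hω.of_alive fun o ho => ho.of_cls rfl, ?_⟩
          have hd : (LExp.lvar .obj b).eval (τ.setRes .null) (ω.setBase .obj b τ.res) = τ.res :=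
            Env.setBase_base_self ..
          -- Leaving the loop overwrites the result by `null`; the witness for `b` is the
          -- overwritten value of the condition.
          refine (sat_ex1 _ _ _).2 ⟨τ.res, hτ.2.1.of_cls rfl, ?_, ?_, rfl⟩
          · rw [sat_substRes, hd]
            exact (sat_setBase hτ hω hb _).2 hp'
          · rw [sat_isBoolVal, hd]
            exact hc
    | iteNull hτ hn =>
      rintro rfl
      refine ⟨?_, fun h => by cases h⟩
      rintro (h | h) hσ
      · cases h
      · cases h
        exact fun ht => ((sat_guarded _ _).1 (h₁ ω hκ _ hσ _ hτ).2.2.2).1 ht hn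
    | iteType hτ hn hb =>
      rintro rfl
      refine ⟨?_, fun h => by cases h⟩
      rintro (h | h) hσ
      · cases h
      · cases h
        exact fun ht =>
          hb ((sat_isBool _).1 (((sat_guarded _ _).1 (h₁ ω hκ _ hσ _ hτ).2.2.2).2 ht hn))
    | first hf hx hxe =>
      rintro rfl
      refine ⟨?_, ?_⟩
      · rintro (rfl | rfl) hσ
        · cases hf
        · cases hf
          exact (h₁ ω hκ _ hσ _ hx).of_error hxe
      · rintro rfl hσ
        cases hf
        exact (h₂ ω hκ _ hσ _ hx).of_error hxe
    | _ => exact fun _ => ⟨fun h => (by rcases h with h | h <;> cases h), fun h => by cases h⟩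
  exact (aux hx rfl).1 (.inl rfl) hσ

/-- The restoring assignment touches only variables that `q` does not mention, and the old values it
brings back still exist. -/
theorem pvalid_block {p q : Asrt} {s : Stmt} (f : Var → Option Term)
    (h : PValid π K κ N ⟨p, .seq (.assign (fillUndef f)) s, tags, q⟩)
    (hq : targets (fillUndef f) ∩ q.free = ∅) : PValid π K κ N ⟨p, .block f s, tags, q⟩ := by
  rintro ω hκ σ hσ x hx
  obtain ⟨y, hy, rfl⟩ := hx.block_inv
  refine (h ω hκ σ hσ y (.seq .assign hy)).map fun τ hτ hτq => ?_
  subst hτ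
  obtain ⟨hτ, hω, hs⟩ := hτq
  have hloc : ∀ v, (fillUndef f v = none ∧ (σ.leave f τ).loc v = τ.loc v) ∨
      (fillUndef f v ≠ none ∧ (σ.leave f τ).loc v = σ.loc v) := fun v => by
    cases hf : fillUndef f v <;> simp [State.leave, State.setAll, hf]
  refine ⟨hτ.of_loc rfl rfl fun v => ?_, hω.of_alive fun o ho => ho.of_cls rfl, ?_⟩
  · rcases hloc v with ⟨-, h⟩ | ⟨-, h⟩
    · rw [h]
      exact hτ.1 v
    · rw [h]
      exact hy.alive ((hσ.1.1 v).of_cls rfl)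
  · refine (sat_congr_heap (τ := σ.leave f τ) hτ hω q rfl (fun v hv => ?_) (fun _ => rfl) (fun _ _ _ => rfl)
      fun _ _ _ => rfl).2 hs
    rcases hloc v with ⟨-, h⟩ | ⟨h', -⟩
    · exact h
    · exact absurd ⟨⟨v, rfl, h'⟩, hv⟩ (Set.eq_empty_iff_forall_notMem.1 hq _)

/-- Through this lemma the assumption on the class `bool` enters partial validity: neither error
occurs, so only the final states have to be examined. -/
theorem eval_boolLit (hπ : BoolCorrect π) {b : Bool} {σ : State} {x : XState} {S : Set State}
    (hσ : σ.Consistent) (h : Ev π N (boolLit b) σ x)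
    (hS : ∀ τ, Frame (changed π (boolLit b)) σ τ → τ.Consistent → τ.IsBoolVal τ.res b → τ ∈ S) :
    Allowed tags S x := by
  cases x with
  | ok τ => exact hS τ h.frame (h.consistent (boolLit_proper b) hσ) (hπ.isBoolVal hσ h)
  | bot => trivial
  | typeerror => exact absurd rfl (hπ.ne_error hσ h).1
  | fail => exact absurd rfl (hπ.ne_error hσ h).2

theorem pvalid_equal (hπ : BoolCorrect π) (v₀ v₁ : Var) : PValid π K κ N
    ⟨.imp (.tag .typesafe) (.and (.ne (.var v₀) .undef) (.ne (.var v₁) .undef)),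
      .eq (.var v₀) (.var v₁), tags, isBoolVal .res (.op2 (.eq .obj) (.var v₀) (.var v₁))⟩ := by
  rintro ω - σ ⟨hσ, hω, hp⟩ x hx
  have hp := (sat_imp _ _).1 hp
  cases hx with
  | eq b h₀ h₁ hb hx =>
    rcases h₀.var_inv with ⟨-, h⟩ | ⟨-, h⟩ <;> cases h
    rcases h₁.var_inv with ⟨-, h⟩ | ⟨-, h⟩ <;> cases h
    refine eval_boolLit hπ ((hσ.setRes (hσ.1 _)).setRes (hσ.1 _)) hx fun τ hf hτ hτb => ?_
    refine ⟨hτ, hω.of_alive fun o ho =>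
      hf.alive (cls_notMem_changed _ _) (ho.of_cls rfl), (sat_isBoolVal _ _).2 ?_⟩
    -- The evaluation of the literal leaves local variables alone, so the operands can still be
    -- compared in the final state.
    have hl : ∀ v, τ.loc v = σ.loc v := fun v =>
      hf.loc v (var_notMem_changed (boolLit_avoids b {v} v rfl))
    have : (LExp.op2 (.eq .obj) (.var v₀) (.var v₁)).eval τ ω = b := by
      rw [Bool.eq_iff_iff, hb]
      simp only [LExp.eval, Op2.eval, hl, decide_eq_true_eq]
      rfl
    rw [this]
    exact hτb
  | eqErrRight h₀ h₁ hxe =>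
    rcases h₀.var_inv with ⟨-, h⟩ | ⟨-, h⟩ <;> cases h
    rcases h₁.var_inv with ⟨-, h⟩ | ⟨hu, rfl⟩
    · exact absurd h (hxe _)
    · exact fun ht => (hp ht).2 hu
  | first hf h₀ hxe =>
    cases hf
    rcases h₀.var_inv with ⟨-, h⟩ | ⟨hu, rfl⟩
    · exact absurd h (hxe _)
    · exact fun ht => (hp ht).1 hu

theorem pvalid_isA (hπ : BoolCorrect π) (v : Var) (C : ClassName) : PValid π K κ N
    ⟨.imp (.tag .typesafe) (.ne (.var v) .undef), .isA (.var v) C, tags,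
      .and (isBool .res) (.iff (.isIn (.var v) [C]) (.ne (.fld .res (.prog .toRef)) .null))⟩ := by
  rintro ω - σ ⟨hσ, hω, hp⟩ x hx
  have hp := (sat_imp _ _).1 hp
  cases hx with
  | isA b h₀ hb hx =>
    rcases h₀.var_inv with ⟨-, h⟩ | ⟨-, h⟩ <;> cases h
    refine eval_boolLit hπ (hσ.setRes (hσ.1 _)) hx fun τ hf hτ hτb => ?_
    refine ⟨hτ, hω.of_alive fun o ho =>
      hf.alive (cls_notMem_changed _ _) (ho.of_cls rfl), (sat_isBool _).2 hτb.1, ?_⟩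
    have hl : τ.loc v = σ.loc v := hf.loc v (var_notMem_changed (boolLit_avoids b {v} v rfl))
    -- The class of an existing object is permanent, so the test has the same answer after the
    -- evaluation of the literal.
    have hc : τ.fld (σ.loc v) .cls = σ.fld (σ.loc v) .cls :=
      hf.fld ((hσ.1 v).of_cls rfl) (cls_notMem_changed _ _)
    rw [sat_iff, sat_isIn_one, sat_ne]
    simp only [LExp.eval, hl, hc]
    exact hb.symm.trans hτb.2
  | first hf h₀ hxe =>
    cases hf
    rcases h₀.var_inv with ⟨-, h⟩ | ⟨hu, rfl⟩
    · exact absurd h (hxe _)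
    · exact fun ht => hp ht hu

theorem pvalid_cnst {p q : Asrt} {C : ClassName} {n : ℕ} {args : Fin n → Stmt}
    (h : PValid π K κ N ⟨p, .call (.alloc C) .init n args, tags, q⟩) :
    PValid π K κ N ⟨p, .new C n args, tags, q⟩ := by
  rintro ω hκ σ hσ x hx
  cases hx with
  | new hx => exact h ω hκ σ hσ x hx
  | first hf => cases hf

theorem pvalid_new (C : ClassName) (p : Asrt) :
    PValid π K κ N ⟨p.substNew C {}, .alloc C, tags, p⟩ := by
  rintro ω - σ ⟨hσ, hω, hp⟩ x hx
  cases hx with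
  | alloc hn =>
    exact ⟨hσ.create C _, hω.of_alive fun o ho => State.alive_create C _ (.inl ho),
      (sat_substNew_empty C hσ hω hn.1 p).1 hp⟩
  | first hf => cases hf

-- Partial validity: the structural rules

theorem pvalid_disj {p q r : Asrt} {s : Stmt} (h₁ : PValid π K κ N ⟨p, s, tags, q⟩)
    (h₂ : PValid π K κ N ⟨r, s, tags, q⟩) : PValid π K κ N ⟨.or p r, s, tags, q⟩ := by
  rintro ω hκ σ ⟨hσ, hω, hp⟩ x hx
  rcases (sat_or _ _).1 hp with hp | hp
  · exact h₁ ω hκ σ ⟨hσ, hω, hp⟩ x hx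
  · exact h₂ ω hκ σ ⟨hσ, hω, hp⟩ x hx

/-- The tags that are added do not occur in the assertions, which therefore keep their meaning. -/
theorem states_union_left {p q : Asrt} {tags' : Set Tag}
    (h : (tags' \ tags) ∩ (p.tagsIn ∪ q.tagsIn) = ∅) (ω : Env) :
    p.states (tags ∪ tags') ω = p.states tags ω ∧ q.states (tags ∪ tags') ω = q.states tags ω := by
  have key : ∀ a : Asrt, a.tagsIn ⊆ p.tagsIn ∪ q.tagsIn →
      a.states (tags ∪ tags') ω = a.states tags ω := fun a ha => by
    ext σ
    refine and_congr_right fun _ => and_congr_right fun _ => sat_congr_tags a (fun t ht => ?_) ω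
    refine ⟨fun h' => ?_, .inl⟩
    by_contra hn
    exact Set.eq_empty_iff_forall_notMem.1 h t ⟨⟨h'.resolve_left hn, hn⟩, ha ht⟩
  exact ⟨key p Set.subset_union_left, key q Set.subset_union_right⟩

theorem states_and (p q : Asrt) (ω : Env) :
    (Asrt.and p q).states tags ω = p.states tags ω ∩ q.states tags ω := by
  ext σ
  simp only [Asrt.states, Sat, Set.mem_ofPred_eq, Set.mem_inter_iff]
  tauto

theorem pvalid_conj {p₁ p₂ q₁ q₂ : Asrt} {s : Stmt} {tags' : Set Tag}
    (h₁ : PValid π K κ N ⟨p₁, s, tags, q₁⟩) (h₂ : PValid π K κ N ⟨p₂, s, tags', q₂⟩)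
    (ht₁ : (tags' \ tags) ∩ (p₁.tagsIn ∪ q₁.tagsIn) = ∅)
    (ht₂ : (tags \ tags') ∩ (p₂.tagsIn ∪ q₂.tagsIn) = ∅) :
    PValid π K κ N ⟨.and p₁ p₂, s, tags ∪ tags', .and q₁ q₂⟩ := by
  rintro ω hκ σ hσ x hx
  obtain ⟨e₁, e₁'⟩ := states_union_left ht₁ ω
  obtain ⟨e₂, e₂'⟩ := states_union_left ht₂ ω
  rw [Set.union_comm] at e₂ e₂'
  simp only [states_and, e₁, e₁', e₂, e₂'] at hσ ⊢
  have a₁ := h₁ ω hκ σ hσ.1 x hx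
  have a₂ := h₂ ω hκ σ hσ.2 x hx
  cases x with
  | ok τ => exact ⟨a₁, a₂⟩
  | bot => trivial
  | typeerror => exact fun h => h.elim a₁ a₂
  | fail => exact fun h => h.elim a₁ a₂

/-- The witness becomes the value of `x` in the environment. This disturbs no constant, and the
postcondition does not notice when it is undone. -/
theorem pvalid_exInt {p q : Asrt} {s : Stmt} (t : BTy) (x : ℕ) (hK : t = .nat → x ∉ K)
    (hq : .lvar t x ∉ q.free) (h : PValid π K κ N ⟨p, s, tags, q⟩) :
    PValid π K κ N ⟨.ex1 t x p, s, tags, q⟩ := by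
  rintro ω hκ σ ⟨hσ, hω, hp⟩ y hy
  obtain ⟨d, hd, hp⟩ := (sat_ex1 _ _ _).1 hp
  have := h _ (hκ.setBase hK d) σ ⟨hσ, hω.setBase x hd, hp⟩ y hy
  cases y with
  | ok τ =>
    have hωτ : ω.Consistent τ := hω.of_alive fun o => hy.alive
    exact ⟨this.1, hωτ, (sat_setBase this.1 hωτ hq d).1 this.2.2⟩
  | _ => exact this

theorem pvalid_exIntSeq {p q : Asrt} {s : Stmt} (t : BTy) (k : ℕ) (hq : .svar t k ∉ q.free)
    (h : PValid π K κ N ⟨p, s, tags, q⟩) : PValid π K κ N ⟨.exSeq t k p, s, tags, q⟩ := by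
  rintro ω hκ σ ⟨hσ, hω, hp⟩ y hy
  obtain ⟨d, hd, hp⟩ := (sat_exSeq _ _ _).1 hp
  have := h (ω.setSeq t k d) hκ σ ⟨hσ, hω.setSeq k hd, hp⟩ y hy
  cases y with
  | ok τ =>
    have hωτ : ω.Consistent τ := hω.of_alive fun o => hy.alive
    exact ⟨this.1, hωτ, (sat_setSeq this.1 hωτ hq d).1 this.2.2⟩
  | _ => exact this

/-- Frame property and coincidence lemma together. Quantification over objects has to be excluded
because the statement may create some. -/
theorem pvalid_inv {r q : Asrt} {s : Stmt} (p : Asrt) (hp : p.free ∩ changed π s = ∅)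
    (hn : p.NoObjQuant) (h : PValid π K κ N ⟨r, s, tags, q⟩) :
    PValid π K κ N ⟨.and p r, s, tags, .and p q⟩ := by
  rintro ω hκ σ ⟨hσ, hω, hp', hr⟩ x hx
  have := h ω hκ σ ⟨hσ, hω, hr⟩ x hx
  cases x with
  | ok τ =>
    refine ⟨this.1, this.2.1, ?_, this.2.2⟩
    refine (sat_congr hσ p (.inl hn) hω fun y hy => ?_).2 hp'
    exact hx.frame.symAgree (Set.mem_insert _ _) ω fun hy' =>
      Set.eq_empty_iff_forall_notMem.1 hp y ⟨hy, hy'⟩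
  | _ => exact this

/-- The variables that a substitution replaces. -/
def Subst.dom (θ : Subst) : Set Var := {v | θ.var v ≠ .var v}

theorem Subst.state_eq_graft {θ : Subst} (hθ : θ.res = .res) (σ : State) (ω : Env) :
    θ.state σ ω = σ.graft θ.dom (θ.state σ ω).loc := by
  refine State.ext (fun v => ?_) ?_ rfl
  · by_cases hv : v ∈ θ.dom
    · rw [State.graft_loc_of_mem hv]
    · rw [State.graft_loc_of_notMem hv]
      have : θ.var v = .var v := by simpa [Subst.dom] using hv
      simp only [Subst.state, this, LExp.eval]
  · simp only [Subst.state, hθ]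
    rfl

theorem Subst.mem_states {θ : Subst} (hθ : θ.res = .res) {p : Asrt} {σ : State} {ω : Env}
    (h : σ ∈ (p.subst θ).states tags ω) :
    σ.graft θ.dom (θ.state σ ω).loc ∈ p.states tags (θ.env σ ω) := by
  obtain ⟨hσ, hω, hp⟩ := h
  rw [← Subst.state_eq_graft hθ]
  refine ⟨hσ.of_loc rfl ?_ fun v => (θ.var v).eval_alive hσ hω, ?_, (sat_subst _ _ _ _ _).1 hp⟩
  · simp only [Subst.state, hθ, LExp.eval]
  · refine Env.Consistent.of_alive (σ := σ) ?_ fun o ho => ho.of_cls rfl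
    exact ⟨fun t x => (θ.lvar t x).eval_alive hσ hω, fun t k => (θ.svar t k).eval_alive hσ hω⟩

theorem Subst.fixes {θ : Subst} {ω : Env} (hκ : ω.Fixes K κ)
    (h : ∀ x, θ.lvar .nat x ≠ .lvar .nat x → x ∉ K) (σ : State) : (θ.env σ ω).Fixes K κ := by
  intro x hx
  have : θ.lvar .nat x = .lvar .nat x := by
    by_contra h'
    exact h x h' hx
  simp only [Subst.env, this]
  exact hκ x hx

/-- The run is replayed from the state in which the replaced variables hold the values of their
substitutes, where the premise applies. These values do not change along the run, so the same graft
also describes the final state. -/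
theorem pvalid_subst {p q : Asrt} {s : Stmt} (θ : Subst) (hr : θ.res = .res)
    (hv : ∀ v, θ.var v ≠ .var v → .var v ∉ s.vars ∧ (θ.var v).free ∩ changed π s = ∅)
    (hl : ∀ t x, θ.lvar t x ≠ .lvar t x →
      (t = .nat → x ∉ K) ∧ (θ.lvar t x).free ∩ changed π s = ∅)
    (hs : ∀ t k, θ.svar t k ≠ .svar t k → (θ.svar t k).free ∩ changed π s = ∅)
    (h : PValid π K κ N ⟨p, s, tags, q⟩) :
    PValid π K κ N ⟨p.subst θ, s, tags, q.subst θ⟩ := by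
  rintro ω hκ σ hσ x hx
  have := h _ (Subst.fixes hκ (fun x hx => (hl _ x hx).1 rfl) σ) _ (Subst.mem_states hr hσ) _
    (hx.graft _ fun v h => (hv v h).1)
  obtain ⟨hσ, hω, -⟩ := hσ
  cases x with
  | ok τ =>
    have hf := hx.frame
    obtain ⟨hτ, -, hq⟩ := this
    have hωτ : ω.Consistent τ := hω.of_alive fun o => hx.alive
    refine ⟨hτ.of_loc rfl rfl fun v => ?_, hωτ, (sat_subst _ _ _ _ _).2 ?_⟩
    · by_cases hvd : v ∈ θ.dom
      · rw [hf.loc v (var_notMem_changed (hv v hvd).1)]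
        exact (hx.alive (hσ.1 v)).of_cls rfl
      · have := hτ.1 v
        rwa [State.graft_loc_of_notMem hvd] at this
    · have henv : θ.env τ ω = θ.env σ ω := by
        refine Env.ext (fun t x => ?_) fun t k => ?_
        · by_cases hx : θ.lvar t x = .lvar t x
          · simp only [Subst.env, hx]
            rfl
          · exact hf.eval hσ hω (hl t x hx).2
        · by_cases hx : θ.svar t k = .svar t k
          · simp only [Subst.env, hx]
            rfl
          · exact hf.eval hσ hω (hs t k hx)
      have hst : θ.state τ ω = τ.graft θ.dom (θ.state σ ω).loc := by
        rw [Subst.state_eq_graft hr]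
        refine State.ext (fun v => ?_) rfl rfl
        by_cases hvd : v ∈ θ.dom
        · rw [State.graft_loc_of_mem hvd, State.graft_loc_of_mem hvd]
          exact hf.eval hσ hω (hv v hvd).2
        · rw [State.graft_loc_of_notMem hvd, State.graft_loc_of_notMem hvd]
      rw [henv, hst]
      exact hq
  | _ => exact this

end

/-! ### Method calls -/

theorem Frame.chain {π : Program} {n : ℕ} {s : Fin n → Stmt} {S : Set Sym} {N : ℕ}
    {σ : Fin (n + 1) → State} (hS : .fld .cls ∉ S) (hs : ∀ j, changed π (s j) ⊆ S)
    (k : Fin (n + 1))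
    (h : ∀ j : Fin n, j.castSucc < k → Ev π N (s j) (σ j.castSucc) (.ok (σ j.succ))) :
    Frame S (σ 0) (σ k) :=
  Fin.chain (P := fun i => Frame S (σ 0) (σ i)) (.refl rfl rfl) k fun j hj hf =>
    hf.trans ((h j hj).frame.mono (hs j)) hS

/-- The variables `v 0, …, v i`. -/
def storeVars {n : ℕ} (v : Fin (n + 1) → ℕ) (i : Fin (n + 1)) : Set Var :=
  {w | ∃ j ≤ i, w = .loc (v j)}

theorem loc_mem_storeVars {n : ℕ} (v : Fin (n + 1) → ℕ) {i j : Fin (n + 1)} (h : j ≤ i) :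
    .loc (v j) ∈ storeVars v i :=
  ⟨j, h, rfl⟩

open Classical in
/-- The variable `v i` has the result of `σ i` as its value. -/
noncomputable def storeVals {n : ℕ} (v : Fin (n + 1) → ℕ) (σ : Fin (n + 1) → State) : Var → Obj :=
  fun w => if h : ∃ j, w = .loc (v j) then (σ h.choose).res else .null

theorem storeVals_loc {n : ℕ} {v : Fin (n + 1) → ℕ} (hv : Function.Injective v)
    (σ : Fin (n + 1) → State) (j : Fin (n + 1)) : storeVals v σ (.loc (v j)) = (σ j).res := by
  have h : ∃ i, Var.loc (v j) = .loc (v i) := ⟨j, rfl⟩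
  have hj : h.choose = j := (hv (Var.loc.inj h.choose_spec)).symm
  simp only [storeVals, dif_pos h, hj]

/-- The state `σ i`, with the results of `σ 0, …, σ i` stored in `v 0, …, v i`. -/
noncomputable def store {n : ℕ} (v : Fin (n + 1) → ℕ) (σ : Fin (n + 1) → State)
    (i : Fin (n + 1)) : State :=
  (σ i).graft (storeVars v i) (storeVals v σ)

theorem store_zero {n : ℕ} {v : Fin (n + 1) → ℕ} (hv : Function.Injective v)
    (σ : Fin (n + 1) → State) : store v σ 0 = (σ 0).setLoc (.loc (v 0)) (σ 0).res := by
  refine State.ext (fun w => ?_) rfl rfl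
  by_cases hw : w = .loc (v 0)
  · subst hw
    rw [store, State.graft_loc_of_mem (loc_mem_storeVars v le_rfl), storeVals_loc hv]
    simp [State.setLoc]
  · rw [store, State.graft_loc_of_notMem]
    · simp [State.setLoc, hw]
    · rintro ⟨j, hj, rfl⟩
      rw [Fin.le_zero_iff] at hj
      exact hw (by rw [hj])

/-- This is the form in which the premise for an argument delivers its postcondition: the argument
is evaluated with the earlier results stored, and its own result is then assigned. -/
theorem store_succ {n : ℕ} {v : Fin (n + 1) → ℕ} (hv : Function.Injective v)
    (σ : Fin (n + 1) → State) (i : Fin n) : store v σ i.succ =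
      ((σ i.succ).graft (storeVars v i.castSucc) (storeVals v σ)).setLoc (.loc (v i.succ))
        (σ i.succ).res := by
  refine State.ext (fun w => ?_) rfl rfl
  by_cases hw : w = .loc (v i.succ)
  · subst hw
    rw [store, State.graft_loc_of_mem (loc_mem_storeVars v le_rfl), storeVals_loc hv]
    simp [State.setLoc]
  · simp only [State.setLoc, Function.update_of_ne hw]
    by_cases hm : w ∈ storeVars v i.castSucc
    · obtain ⟨j, hj, rfl⟩ := hm
      rw [store, State.graft_loc_of_mem (loc_mem_storeVars v (hj.trans i.castSucc_le_succ)),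
        State.graft_loc_of_mem (loc_mem_storeVars v hj)]
    · rw [store, State.graft_loc_of_notMem, State.graft_loc_of_notMem hm]
      rintro ⟨j, hj, rfl⟩
      rcases hj.lt_or_eq with hlt | rfl
      · exact hm ⟨j, Fin.le_castSucc_iff.2 hlt, rfl⟩
      · exact hw rfl

theorem Stmt.avoids_storeVars {n : ℕ} {v : Fin (n + 1) → ℕ} {s : Stmt}
    (h : ∀ i, .var (.loc (v i)) ∉ s.vars) (i : Fin (n + 1)) : s.Avoids (storeVars v i) := by
  rintro _ ⟨j, -, rfl⟩
  exact h j

section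

variable {π : Program} {K : Set ℕ} {κ : ℕ → ℕ} {N : ℕ} {tags : Set Tag}

/-- The evaluation of receiver and arguments, with the results being stored in variables. -/
theorem store_mem_states {p : Asrt} {e₀ : Stmt} {n : ℕ} {args : Fin n → Stmt} {a : Asrt}
    {P : Fin (n + 1) → Asrt} {v : Fin (n + 1) → ℕ} (hv : Function.Injective v)
    (hva : ∀ i j, .var (.loc (v i)) ∉ (args j).vars)
    (h₀ : PValid π K κ N ⟨p, e₀, tags, .and ((P 0).substVar (.loc (v 0)) .res) a⟩)
    (h₁ : ∀ i : Fin n, PValid π K κ N ⟨P i.castSucc, args i, tags,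
      (P i.succ).substVar (.loc (v i.succ)) .res⟩)
    {ω : Env} (hκ : ω.Fixes K κ) {σ₀ : State} (hσ₀ : σ₀ ∈ p.states tags ω)
    {σ : Fin (n + 1) → State} (he₀ : Ev π N e₀ σ₀ (.ok (σ 0))) (k : Fin (n + 1))
    (he : ∀ j : Fin n, j.castSucc < k → Ev π N (args j) (σ j.castSucc) (.ok (σ j.succ))) :
    store v σ k ∈ (P k).states tags ω := by
  have close : ∀ {q : Asrt} {τ : State} {u : ℕ},
      τ ∈ (q.substVar (.loc u) .res).states tags ω → τ.setLoc (.loc u) τ.res ∈ q.states tags ω := by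
    rintro q τ u ⟨hτ, hω, hq⟩
    exact ⟨hτ.setLoc _ hτ.2.1, hω.of_alive fun o ho => ho.of_cls rfl, (sat_substVar _ _ _).1 hq⟩
  refine Fin.chain (P := fun k => store v σ k ∈ (P k).states tags ω) ?_ k fun j hj hP => ?_
  · rw [store_zero hv]
    obtain ⟨hτ, hω, hq, -⟩ := h₀ ω hκ σ₀ hσ₀ _ he₀
    exact close ⟨hτ, hω, hq⟩
  · rw [store_succ hv]
    -- The argument accesses none of the storing variables, so its run can be transferred to the
    -- state with the stored results.
    exact close (h₁ j ω hκ _ hP _ ((he j hj).graft _ (Stmt.avoids_storeVars (hva · j) _)))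

/-- A call with evaluated receiver and arguments can be repeated from the stored results. -/
theorem eval_stored {e₀ : Stmt} {m : MethName} {n : ℕ} {args : Fin n → Stmt}
    {v : Fin (n + 1) → ℕ} (hv : Function.Injective v) (hp₀ : e₀.Proper)
    (hp : ∀ i, (args i).Proper) {σ₀ : State} (hσ₀ : σ₀.Consistent) {σ : Fin (n + 1) → State}
    (he₀ : Ev π N e₀ σ₀ (.ok (σ 0)))
    (he : ∀ j : Fin n, Ev π N (args j) (σ j.castSucc) (.ok (σ j.succ))) {d : Method n}
    (hd : (σ 0).Calls π m n d) (M : ℕ) :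
    ∃ σ' : Fin (n + 1) → State,
      Ev π M (.var (.loc (v 0))) (store v σ (Fin.last n)) (.ok (σ' 0)) ∧ (σ' 0).Calls π m n d ∧
      (∀ i : Fin n, Ev π M (.var (.loc (v i.succ))) (σ' i.castSucc) (.ok (σ' i.succ))) ∧
      (σ' (Fin.last n)).enter (d.bindVals σ') = (σ (Fin.last n)).enter (d.bindVals σ) ∧
      (σ' (Fin.last n)).loc = (store v σ (Fin.last n)).loc := by
  set τ := store v σ (Fin.last n) with hτ
  have hl : ∀ (i : Fin (n + 1)) (o : Obj), (τ.setRes o).loc (.loc (v i)) = (σ i).res := fun i o =>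
    (State.graft_loc_of_mem (loc_mem_storeVars v (Fin.le_last i))).trans (storeVals_loc hv σ i)
  -- Otherwise reading the stored result would be a type error.
  have hu : ∀ i, (σ i).res ≠ .undef := fun i => by
    cases i using Fin.cases with
    | zero => exact he₀.res_ne_undef hp₀
    | succ j => exact (he j).res_ne_undef (hp j)
  have ev : ∀ (i : Fin (n + 1)) (o : Obj),
      Ev π M (.var (.loc (v i))) (τ.setRes o) (.ok (τ.setRes (σ i).res)) := fun i o => by
    have := Ev.var (π := π) (N := M) (v := .loc (v i)) (σ := τ.setRes o) (by rw [hl]; exact hu i)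
    rw [hl] at this
    exact this
  refine ⟨fun i => τ.setRes (σ i).res, ev 0 τ.res, ?_, fun i => ev i.succ _, ?_, rfl⟩
  · obtain ⟨hn, C, hC, hd⟩ := hd
    refine ⟨hn, C, ?_, hd⟩
    -- One run looks up the class of the receiver before evaluating the original arguments, the
    -- other one afterwards; `@c` is the same at both times.
    have hf : Frame {.fld .cls}ᶜ (σ 0) (σ (Fin.last n)) :=
      Frame.chain (by simp) (fun j y hy h => ?_) _ fun j _ => he j
    · rw [← hC]
      exact hf.fld (he₀.consistent hp₀ hσ₀).2.1 (by simp)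
    · exact cls_notMem_changed π (args j) (h ▸ hy)
  · exact State.enter_bindVals_congr d _ _ _ _ rfl rfl fun _ => rfl

/-- The given run is compared with the call on the stored results. Both start the body in the same
state, and their final states differ at most in the storing variables, which `q` does not mention.
-/
theorem pvalid_meth {p q : Asrt} {e₀ : Stmt} {m : MethName} {n : ℕ} {args : Fin n → Stmt}
    {P : Fin (n + 1) → Asrt} {v : Fin (n + 1) → ℕ} {Cs : List ClassName} (hp₀ : e₀.Proper)
    (hp : ∀ i, (args i).Proper) (hv : Function.Injective v)
    (hva : ∀ i, .var (.loc (v i)) ∉ e₀.vars ∪ q.free ∧ ∀ j, .var (.loc (v i)) ∉ (args j).vars)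
    (hCs : ∀ C ∈ Cs, π C m n ≠ none)
    (h₀ : PValid π K κ N ⟨p, e₀, tags,
      .and ((P 0).substVar (.loc (v 0)) .res) (guarded .res (.isIn .res Cs))⟩)
    (h₁ : ∀ i : Fin n, PValid π K κ N ⟨P i.castSucc, args i, tags,
      (P i.succ).substVar (.loc (v i.succ)) .res⟩)
    (h₂ : PValid π K κ N ⟨P (Fin.last n),
      .call (.var (.loc (v 0))) m n (fun i => .var (.loc (v i.succ))), tags, q⟩) :
    PValid π K κ N ⟨p, .call e₀ m n args, tags, q⟩ := by
  rintro ω hκ σ₀ hσ₀ x hx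
  have hx' := hx
  cases hx with
  | @call N _ _ _ _ _ y d σ he₀ hd he hb =>
    obtain ⟨σ', e₁, e₂, e₃, e₄, e₅⟩ := eval_stored hv hp₀ hp hσ₀.1 he₀ he hd (N + 1)
    rw [← e₄] at hb
    have := h₂ ω hκ _ (store_mem_states hv (fun i => (hva i).2) h₀ h₁ hκ hσ₀ he₀ _ fun j _ => he j) _
      (.call e₁ e₂ e₃ hb)
    cases y with
    | ok ρ =>
      simp only [XState.map, State.leave_bindVals, Allowed] at this hx' ⊢
      rw [e₅] at this
      have hc := hx'.consistent ⟨hp₀, hp⟩ hσ₀.1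
      refine ⟨hc, this.2.1.of_alive fun o ho => ho.of_cls rfl,
        (sat_congr_heap (τ := { loc := (σ (Fin.last n)).loc, res := ρ.res, heap := ρ.heap })
          this.1 this.2.1 q rfl (fun w hw => ?_) (fun _ => rfl) (fun _ _ _ => rfl)
          fun _ _ _ => rfl).2 this.2.2⟩
      refine (State.graft_loc_of_notMem ?_).symm
      rintro ⟨j, -, rfl⟩
      exact (hva j).1 (.inr hw)
    | _ => exact this
  | callNull he₀ hn =>
    exact fun ht => ((sat_guarded _ _).1 (h₀ ω hκ σ₀ hσ₀ _ he₀).2.2.2).1 ht hn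
  | callType he₀ hn hC hπ =>
    intro ht
    -- The guard puts the class of the receiver into the list `Cs`, all of whose members support the
    -- method.
    obtain ⟨D, hD, h⟩ := ((sat_guarded _ _).1 (h₀ ω hκ σ₀ hσ₀ _ he₀).2.2.2).2 ht hn
    have := hC.symm.trans h
    cases this
    exact hCs _ hD hπ
  | callArgErr i he₀ hd he hx hxe =>
    have := h₁ i ω hκ _ (store_mem_states hv (fun i => (hva i).2) h₀ h₁ hκ hσ₀ he₀ i.castSucc
      fun j hj => he j (Fin.castSucc_lt_castSucc_iff.1 hj)) _
      (hx.graft _ (Stmt.avoids_storeVars (fun j => (hva j).2 i) _))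
    rw [hxe.map_eq] at this
    exact this.of_error hxe
  | first hf hx hxe => cases hf; exact (h₀ ω hκ σ₀ hσ₀ _ hx).of_error hxe

/-! ### Recursion -/

theorem Arg.eval_exp (a : Arg) (σ : State) (ω : Env) : a.exp.eval σ ω = σ.arg a := by
  cases a <;> rfl

theorem Arg.ev_inv {a : Arg} {σ : State} {x : XState} (h : Ev π N a.stmt σ x) :
    (σ.arg a ≠ .undef ∧ x = .ok (σ.setRes (σ.arg a))) ∨ (σ.arg a = .undef ∧ x = .typeerror) := by
  cases a with
  | var v => exact h.var_inv
  | null => exact .inl ⟨nofun, h.null_inv⟩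

theorem Arg.ev_ok {a : Arg} {σ τ : State} (h : Ev π N a.stmt σ (.ok τ)) :
    τ = σ.setRes (σ.arg a) := by
  rcases Arg.ev_inv h with ⟨-, h⟩ | ⟨-, h⟩ <;> cases h
  rfl

theorem Arg.tm (a : Arg) (σ : State) : Tm π a.stmt σ := by
  cases a
  · exact .var
  · exact .null

/-- The assignment to `this` and the parameters for the call of a specification. -/
noncomputable def CallSpec.frame (c : CallSpec) : Var → Option Term :=
  c.d.bind (.arg c.l) fun i => .arg (c.args i)

/-- Evaluating a variable or `null` changes nothing but the result. -/
theorem arg_chain {n : ℕ} {args : Fin n → Arg} {l : Arg} {σ₀ : State} {σ : Fin (n + 1) → State}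
    (he₀ : Ev π N l.stmt σ₀ (.ok (σ 0))) (k : Fin (n + 1))
    (he : ∀ j : Fin n, j.castSucc < k → Ev π N (args j).stmt (σ j.castSucc) (.ok (σ j.succ))) :
    σ k = σ₀.setRes (σ k).res :=
  Fin.chain (P := fun k => σ k = σ₀.setRes (σ k).res)
    (by rw [Arg.ev_ok he₀]; rfl) k fun j hj h => by
      rw [Arg.ev_ok (he j hj), h]
      rfl

theorem arg_chain_res {n : ℕ} {args : Fin n → Arg} {l : Arg} {σ₀ : State}
    {σ : Fin (n + 1) → State} (he₀ : Ev π N l.stmt σ₀ (.ok (σ 0)))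
    (he : ∀ j : Fin n, Ev π N (args j).stmt (σ j.castSucc) (.ok (σ j.succ))) (j : Fin n) :
    (σ j.succ).res = σ₀.arg (args j) := by
  rw [Arg.ev_ok (he j), arg_chain he₀ j.castSucc fun j _ => he j]
  cases args j <;> rfl

/-- Even without the tag `typesafe`, a successful lookup cannot find another method, as the
precondition excludes every other class that has one. -/
theorem CallSpec.Dispatches.method_eq {c : CallSpec} (hc : c.Dispatches π) {ω : Env} {σ₀ : State}
    (hσ₀ : σ₀ ∈ c.p.states c.tags ω) {d : Method c.n}
    (hd : (σ₀.setRes (σ₀.arg c.l)).Calls π c.m c.n d) : d = c.d := by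
  obtain ⟨-, C, hC, hd⟩ := hd
  by_cases h : C = c.C
  · subst h
    exact Option.some.inj (hd.symm.trans hc.lookup)
  · have := (hc.unique C h (by simp [hd]) ω hσ₀).2.2
    refine absurd ?_ this
    rw [sat_isIn_one, Arg.eval_exp]
    exact hC

/-- The call and the block of its specification enter the body alike, except for the result
variable, which the evaluation of receiver and arguments has overwritten. -/
theorem CallSpec.enter_eq {c : CallSpec} {σ₀ : State} {σ : Fin (c.n + 1) → State}
    (he₀ : Ev π N c.l.stmt σ₀ (.ok (σ 0)))
    (he : ∀ j : Fin c.n, Ev π N (c.args j).stmt (σ j.castSucc) (.ok (σ j.succ))) :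
    (σ (Fin.last c.n)).enter (c.d.bindVals σ) =
      (σ₀.enter c.frame).setRes (σ (Fin.last c.n)).res := by
  have hl := arg_chain he₀ (Fin.last c.n) fun j _ => he j
  have h0 : (σ 0).res = σ₀.arg c.l := by
    rw [Arg.ev_ok he₀]
    rfl
  have hr := arg_chain_res he₀ he
  rw [hl]
  refine State.ext (fun w => ?_) rfl rfl
  simp only [State.enter, State.setAll, State.setRes, CallSpec.frame, Method.bindVals, h0, hr]
  cases w with
  | this => rfl
  | loc u =>
    simp only [fillUndef, Method.bind]
    split_ifs <;> rfl

theorem CallSpec.Dispatches.typesafe {c : CallSpec} (hc : c.Dispatches π) {ω : Env} {σ₀ : State}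
    (hσ₀ : σ₀ ∈ c.p.states c.tags ω) (ht : .typesafe ∈ c.tags) (hn : σ₀.arg c.l ≠ .null) :
    σ₀.fld (σ₀.arg c.l) .cls = .rep c.C ∧ ∀ i, σ₀.arg (c.args i) ≠ .undef := by
  constructor
  · have := ((sat_guarded _ _).1 (hc.receiver ω hσ₀).2.2).2 ht
    simp only [sat_eq, LExp.eval, Arg.eval_exp] at this
    exact this hn
  · intro i
    have := (hc.arguments i ω hσ₀).2.2
    simp only [sat_imp, sat_tag, sat_ne, Arg.eval_exp] at this
    exact this ht hn

theorem Env.Fixes.of_insert {ω : Env} {z k : ℕ}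
    (h : ω.Fixes (insert z K) (Function.update κ z k)) (hz : z ∉ K) : ω.Fixes K κ := by
  intro x hx
  have : x ≠ z := fun h => hz (h ▸ hx)
  rw [h x (.inr hx), Function.update_of_ne this]

theorem Env.Fixes.insert {ω : Env} (h : ω.Fixes K κ) {z : ℕ} (hz : z ∉ K) (k : ℕ) :
    (ω.setBase .nat z k).Fixes (insert z K) (Function.update κ z k) := by
  rintro x (rfl | hx)
  · rw [Env.setBase_base_self, Function.update_self]
  · have : x ≠ z := fun h => hz (h ▸ hx)
    rw [Env.setBase_base_ne _ _ (.inr this), Function.update_of_ne this]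
    exact h x hx

/-- A call is partially correct if the body of the called method is. -/
theorem CallSpec.Dispatches.pvalid {c : CallSpec} (hc : c.Dispatches π) {z : ℕ}
    (hz : .lvar .nat z ∉ c.p.free ∪ c.q.free)
    (hr : Entails c.tags c.p c.tags (.ex1 .nat z c.r)) (hzK : z ∉ K)
    (hb : ∀ M < N, ∀ k, PValid π (insert z K) (Function.update κ z k) M
      ⟨.and c.p c.r, c.bodyBlock, c.tags, c.q⟩) :
    PValid π K κ N c.assumption := by
  rintro ω hκ σ₀ hσ₀ x hx
  have hσ₀ : σ₀ ∈ c.p.states c.tags ω := hσ₀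
  have hx : Ev π N (.call c.l.stmt c.m c.n fun i => (c.args i).stmt) σ₀ x := hx
  change Allowed c.tags (c.q.states c.tags ω) x
  have hx' := hx
  cases hx with
  | @call N _ _ _ _ _ y d σ he₀ hd he hbody =>
    have h0 := Arg.ev_ok he₀
    rw [h0] at hd
    cases hc.method_eq hσ₀ hd
    rw [CallSpec.enter_eq he₀ he] at hbody
    -- Any value of the bound will do here; its decrease matters for termination only.
    obtain ⟨k, -, hk⟩ := (sat_ex1 _ _ _).1 (hr ω hσ₀).2.2
    have hmem : σ₀ ∈ (Asrt.and c.p c.r).states c.tags (ω.setBase .nat z k) :=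
      ⟨hσ₀.1, hσ₀.2.1.setBase z trivial,
        (sat_setBase hσ₀.1 hσ₀.2.1 (fun h => hz (.inl h)) _).2 hσ₀.2.2, hk⟩
    -- The body is evaluated one level below the call, so its validity at a smaller depth suffices.
    have hN := hb N (Nat.lt_succ_self N) k _ (hκ.insert hzK k) σ₀ hmem _ (.block (hbody.of_setRes c.d.body_proper))
    cases y with
    | ok ρ =>
      simp only [XState.map, State.leave_bindVals, State.leave_bind, Allowed] at hN ⊢
      have hloc : (σ (Fin.last c.n)).loc = σ₀.loc := by
        rw [arg_chain he₀ (Fin.last c.n) fun j _ => he j]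
        rfl
      rw [hloc]
      have hωρ : ω.Consistent { loc := σ₀.loc, res := ρ.res, heap := ρ.heap } :=
        hσ₀.2.1.of_alive fun o ho => hx'.alive ho
      exact ⟨hN.1, hωρ, (sat_setBase hN.1 hωρ (fun h => hz (.inr h)) _).1 hN.2.2⟩
    | _ => exact hN
  | callNull he₀ hn =>
    rw [Arg.ev_ok he₀] at hn
    intro ht
    have := ((sat_guarded _ _).1 (hc.receiver ω hσ₀).2.2).1 ht
    rw [Arg.eval_exp] at this
    exact this hn
  | callType he₀ hn hC hπ =>
    rw [Arg.ev_ok he₀] at hn hC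
    intro ht
    have := hC.symm.trans (hc.typesafe hσ₀ ht hn).1
    cases this
    exact absurd (hc.lookup.symm.trans hπ) (by simp)
  | callArgErr i he₀ hd he hx hxe =>
    have hi := arg_chain he₀ i.castSucc fun j hj => he j (Fin.castSucc_lt_castSucc_iff.1 hj)
    rcases Arg.ev_inv hx with ⟨-, h⟩ | ⟨hu, rfl⟩
    · exact absurd h (hxe _)
    · intro ht
      have hn := hd.1
      rw [Arg.ev_ok he₀] at hn
      rw [hi] at hu
      exact (hc.typesafe hσ₀ ht hn).2 i (by rw [← hu]; cases c.args i <;> rfl)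
  | first hf hx hxe =>
    cases hf
    rcases Arg.ev_inv hx with ⟨-, h⟩ | ⟨hu, rfl⟩
    · exact absurd h (hxe _)
    · intro ht
      -- The mark has no class: dereferencing it gives `null`, never the representative of a class.
      have := (hc.typesafe hσ₀ ht (by rw [hu]; nofun)).1
      simp [hu, State.fld, Obj.IsObj] at this

theorem PValid.insert {T : Triple} (h : PValid π K κ N T) {z : ℕ} (hz : z ∉ K) (k : ℕ) :
    PValid π (insert z K) (Function.update κ z k) N T :=
  fun ω hω => h ω (hω.of_insert hz)

/-- An outcome of a call at depth `M` rests on its body at a smaller depth, where the assumptions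
already hold. The bounded assumptions only have stronger preconditions, so they come for free. -/
theorem pvalid_recur {k : ℕ} (c : Fin k → CallSpec) {z z' : ℕ} (hzK : z ∉ K)
    (hc : ∀ i, (c i).Dispatches π)
    (hz : ∀ i, .lvar .nat z ∉ (c i).p.free ∪ (c i).q.free)
    (hr : ∀ i, Entails (c i).tags (c i).p (c i).tags (.ex1 .nat z (c i).r))
    (hb : ∀ M < N, ∀ d, (∀ j, PValid π (insert z K) (Function.update κ z d) M
        ((c j).boundedAssumption z z')) →
      ∀ i, PValid π (insert z K) (Function.update κ z d) M
        ⟨.and (c i).p (c i).r, (c i).bodyBlock, (c i).tags, (c i).q⟩) (i : Fin k) :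
    PValid π K κ N (c i).assumption := by
  have aux : ∀ M ≤ N, ∀ i, PValid π K κ M (c i).assumption := by
    intro M
    induction M using Nat.strong_induction_on with
    | _ M ih =>
      intro hM i
      refine (hc i).pvalid (hz i) (hr i) hzK fun L hL d => hb L (by omega) d (fun j => ?_) i
      exact fun ω hω σ hσ =>
        (ih L hL (by omega) j).insert hzK d ω hω σ ⟨hσ.1, hσ.2.1, hσ.2.2.1⟩
  exact aux N le_rfl i

end

/-! ## Termination -/

/-- Validity of a triple with respect to termination. -/
def TValid (π : Program) (K : Set ℕ) (κ : ℕ → ℕ) (T : Triple) : Prop :=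
  .terminates ∈ T.tags → ∀ ω : Env, ω.Fixes K κ → ∀ σ ∈ T.pre.states T.tags ω, Tm π T.stmt σ

-- Termination: the single rules

section

variable {π : Program} {K : Set ℕ} {κ : ℕ → ℕ} {tags : Set Tag}

theorem tvalid_asgn {p q q' : Asrt} {e : Stmt} (u : ℕ) (h : TValid π K κ ⟨p, e, tags, q'⟩) :
    TValid π K κ ⟨p, .asgn u e, tags, q⟩ :=
  fun ht ω hκ σ hσ => .asgn (h ht ω hκ σ hσ)

theorem tvalid_iasgn {p q q' : Asrt} {e : Stmt} (y : FieldName)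
    (h : TValid π K κ ⟨p, e, tags, q'⟩) : TValid π K κ ⟨p, .iasgn y e, tags, q⟩ :=
  fun ht ω hκ σ hσ => .iasgn (h ht ω hκ σ hσ)

theorem tvalid_seq {p q r : Asrt} {s₁ s₂ : Stmt} (h₁ : ∀ N, PValid π K κ N ⟨p, s₁, tags, r⟩)
    (t₁ : TValid π K κ ⟨p, s₁, tags, r⟩) (t₂ : TValid π K κ ⟨r, s₂, tags, q⟩) :
    TValid π K κ ⟨p, .seq s₁ s₂, tags, q⟩ :=
  fun ht ω hκ σ hσ => .seq (t₁ ht ω hκ σ hσ) fun N τ hτ => t₂ ht ω hκ τ (h₁ N ω hκ σ hσ _ hτ)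

theorem tvalid_cond {p q r : Asrt} {e s₁ s₂ : Stmt}
    (h : ∀ N, PValid π K κ N ⟨p, e, tags, .and r (guarded .res (isBool .res))⟩)
    (t : TValid π K κ ⟨p, e, tags, .and r (guarded .res (isBool .res))⟩)
    (t₁ : TValid π K κ ⟨.and r (isBoolVal .res (.boolC true)), s₁, tags, q⟩)
    (t₂ : TValid π K κ ⟨.and r (isBoolVal .res (.boolC false)), s₂, tags, q⟩) :
    TValid π K κ ⟨p, .ite e s₁ s₂, tags, q⟩ := by
  refine fun ht ω hκ σ hσ => .ite (t ht ω hκ σ hσ) fun N τ b hτ hb => ?_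
  have hτ := mem_states_isBoolVal (h N ω hκ σ hσ _ hτ) hb
  cases b
  · exact t₂ ht ω hκ τ hτ
  · exact t₁ ht ω hκ τ hτ

theorem tvalid_cons {p p₁ q q₁ : Asrt} {s : Stmt} {tags' : Set Tag} (hp : Entails tags p tags' p₁)
    (t : TValid π K κ ⟨p₁, s, tags', q₁⟩) (h : tags ⊆ tags') : TValid π K κ ⟨p, s, tags, q⟩ :=
  fun ht ω hκ σ hσ => t (h ht) ω hκ σ (hp ω hσ)

theorem tvalid_block {p q : Asrt} {s : Stmt} (f : Var → Option Term)
    (t : TValid π K κ ⟨p, .seq (.assign (fillUndef f)) s, tags, q⟩) :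
    TValid π K κ ⟨p, .block f s, tags, q⟩ := by
  intro ht ω hκ σ hσ
  cases t ht ω hκ σ hσ with
  | seq _ h => exact .block (h 0 _ .assign)

theorem tvalid_equal (hπ : BoolCorrect π) {p q : Asrt} (v₀ v₁ : Var) :
    TValid π K κ ⟨p, .eq (.var v₀) (.var v₁), tags, q⟩ :=
  fun _ _ _ _ hσ => .eq .var (fun _ _ _ => .var) fun _ _ _ b h₀ h₁ _ =>
    hπ.tm b (h₁.consistent trivial (h₀.consistent trivial hσ.1))

theorem tvalid_isA (hπ : BoolCorrect π) {p q : Asrt} (v : Var) (C : ClassName) :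
    TValid π K κ ⟨p, .isA (.var v) C, tags, q⟩ :=
  fun _ _ _ _ hσ => .isA .var fun _ _ b h _ => hπ.tm b (h.consistent trivial hσ.1)

theorem tvalid_cnst {p q : Asrt} {C : ClassName} {n : ℕ} {args : Fin n → Stmt}
    (t : TValid π K κ ⟨p, .call (.alloc C) .init n args, tags, q⟩) :
    TValid π K κ ⟨p, .new C n args, tags, q⟩ :=
  fun ht ω hκ σ hσ => .new (t ht ω hκ σ hσ)

theorem tvalid_disj {p q r : Asrt} {s : Stmt} (t₁ : TValid π K κ ⟨p, s, tags, q⟩)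
    (t₂ : TValid π K κ ⟨r, s, tags, q⟩) : TValid π K κ ⟨.or p r, s, tags, q⟩ := by
  rintro ht ω hκ σ ⟨hσ, hω, hp⟩
  rcases (sat_or _ _).1 hp with hp | hp
  · exact t₁ ht ω hκ σ ⟨hσ, hω, hp⟩
  · exact t₂ ht ω hκ σ ⟨hσ, hω, hp⟩

/-- The tag `terminates` stems from one of the two premises, and that premise alone ensures
termination. -/
theorem tvalid_conj {p₁ p₂ q₁ q₂ : Asrt} {s : Stmt} {tags' : Set Tag}
    (t₁ : TValid π K κ ⟨p₁, s, tags, q₁⟩) (t₂ : TValid π K κ ⟨p₂, s, tags', q₂⟩)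
    (ht₁ : (tags' \ tags) ∩ (p₁.tagsIn ∪ q₁.tagsIn) = ∅)
    (ht₂ : (tags \ tags') ∩ (p₂.tagsIn ∪ q₂.tagsIn) = ∅) :
    TValid π K κ ⟨.and p₁ p₂, s, tags ∪ tags', .and q₁ q₂⟩ := by
  rintro ht ω hκ σ hσ
  have e₁ := (states_union_left ht₁ ω).1
  have e₂ := (states_union_left ht₂ ω).1
  rw [Set.union_comm] at e₂
  simp only [states_and, e₁, e₂] at hσ
  rcases ht with ht | ht
  · exact t₁ ht ω hκ σ hσ.1
  · exact t₂ ht ω hκ σ hσ.2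

theorem tvalid_exInt {p q : Asrt} {s : Stmt} (t : BTy) (x : ℕ) (hK : t = .nat → x ∉ K)
    (h : TValid π K κ ⟨p, s, tags, q⟩) : TValid π K κ ⟨.ex1 t x p, s, tags, q⟩ := by
  rintro ht ω hκ σ ⟨hσ, hω, hp⟩
  obtain ⟨d, hd, hp⟩ := (sat_ex1 _ _ _).1 hp
  exact h ht _ (hκ.setBase hK d) σ ⟨hσ, hω.setBase x hd, hp⟩

theorem tvalid_exIntSeq {p q : Asrt} {s : Stmt} (t : BTy) (k : ℕ)
    (h : TValid π K κ ⟨p, s, tags, q⟩) : TValid π K κ ⟨.exSeq t k p, s, tags, q⟩ := by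
  rintro ht ω hκ σ ⟨hσ, hω, hp⟩
  obtain ⟨d, hd, hp⟩ := (sat_exSeq _ _ _).1 hp
  exact h ht (ω.setSeq t k d) hκ σ ⟨hσ, hω.setSeq k hd, hp⟩

theorem tvalid_inv {r q : Asrt} {s : Stmt} (p : Asrt) (h : TValid π K κ ⟨r, s, tags, q⟩) :
    TValid π K κ ⟨.and p r, s, tags, .and p q⟩ :=
  fun ht ω hκ σ hσ => h ht ω hκ σ ⟨hσ.1, hσ.2.1, hσ.2.2.2⟩

theorem Tm.of_graft {s : Stmt} {σ : State} {V : Set Var} {ρ : Var → Obj}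
    (h : Tm π s (σ.graft V ρ)) (hV : s.Avoids V) : Tm π s σ := by
  have := h.graft σ.loc hV
  rwa [State.graft_graft, State.graft_self fun _ _ => rfl] at this

theorem tvalid_subst {p q : Asrt} {s : Stmt} (θ : Subst) (hr : θ.res = .res)
    (hv : ∀ v, θ.var v ≠ .var v → .var v ∉ s.vars)
    (hl : ∀ x, θ.lvar .nat x ≠ .lvar .nat x → x ∉ K) (h : TValid π K κ ⟨p, s, tags, q⟩) :
    TValid π K κ ⟨p.subst θ, s, tags, q.subst θ⟩ :=
  fun ht _ hκ σ hσ => (h ht _ (Subst.fixes hκ hl σ) _ (Subst.mem_states hr hσ)).of_graft hv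

/-- Well-founded descent on the value of `r`: from a state with bound `k` and a true condition, the
body and the next evaluation of the condition lead only to states whose bounds are all below `k`.
This is the partial validity of the third premise with `z` set to `k`. -/
theorem tvalid_loop {p p' q r : Asrt} {e s : Stmt} {z z' : ℕ} (hzK : z ∉ K)
    (hz : .lvar .nat z ∉ p'.free) (hz' : z' ≠ z) (hr : .lvar .nat z' ∉ r.free)
    (hex : Entails tags p' tags (.ex1 .nat z r))
    (h₁ : ∀ N, PValid π K κ N ⟨p, e, tags, .and p' (guarded .res (isBool .res))⟩)
    (h₂ : ∀ N, PValid π K κ N ⟨.and p' (isBoolVal .res (.boolC true)), s, tags, p⟩)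
    (h₃ : ∀ N, PValid π K κ N ⟨.and (.and p' (isBoolVal .res (.boolC true))) r, .seq s e, tags,
      .and p' (decreases r z z')⟩)
    (t₁ : TValid π K κ ⟨p, e, tags, .and p' (guarded .res (isBool .res))⟩)
    (t₂ : TValid π K κ ⟨.and p' (isBoolVal .res (.boolC true)), s, tags, p⟩) :
    TValid π K κ ⟨p, .while e s, tags, q⟩ := by
  intro ht ω hκ
  have unfold : ∀ σ ∈ p.states tags ω, (∀ N τ, Ev π N e σ (.ok τ) →
      τ ∈ (Asrt.and p' (isBoolVal .res (.boolC true))).states tags ω →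
      Tm π (.seq s (.while e s)) τ) → Tm π (.while e s) σ := by
    refine fun σ hσ h => .loop (.ite (t₁ ht ω hκ σ hσ) fun N τ b hτ hb => ?_)
    cases b
    · exact .null
    · exact h N τ hτ (mem_states_isBoolVal (h₁ N ω hκ σ hσ _ hτ) hb)
  have body : ∀ k : ℕ, ∀ σ ∈ (Asrt.and p' (isBoolVal .res (.boolC true))).states tags ω,
      Sat σ tags (ω.setBase .nat z k) r → Tm π (.seq s (.while e s)) σ := by
    intro k
    induction k using Nat.strong_induction_on with
    | _ k ih =>
      intro σ hσ hk
      refine .seq (t₂ ht ω hκ σ hσ) fun N τ hτ => ?_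
      refine unfold τ (h₂ N ω hκ σ hσ _ hτ) fun M ρ hρ hρs => ?_
      -- The third premise speaks of `s; e` as one statement, so the two runs need a common depth.
      obtain ⟨L, hτ, hρ⟩ := Ev.exists_common ⟨N, hτ⟩ ⟨M, hρ⟩
      have hσz : σ ∈ (Asrt.and (.and p' (isBoolVal .res (.boolC true))) r).states tags
          (ω.setBase .nat z k) :=
        ⟨hσ.1, hσ.2.1.setBase z trivial, ⟨(sat_setBase hσ.1 hσ.2.1 hz _).2 hσ.2.2.1,
          (sat_isBoolVal _ _).2 ((sat_isBoolVal (tags := tags) (ω := ω) _ _).1 hσ.2.2.2)⟩, hk⟩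
      obtain ⟨hρ₁, hρ₂, -, hd⟩ := h₃ L _ (hκ.setBase (t := .nat) (fun _ => hzK) k) σ hσz _ (.seq hτ hρ)
      obtain ⟨k', -, hk'⟩ := (sat_ex1 _ _ _).1 (hex ω ⟨hρs.1, hρs.2.1, hρs.2.2.1⟩).2.2
      refine ih k' ?_ ρ hρs hk'
      -- In this environment `z` has the value `k`, so the clause yields `k' < k`.
      have := (sat_decreases hρ₁ hρ₂ hz' hr).1 hd ht k'
      rw [Env.setBase_setBase, Env.setBase_base_self] at this
      exact this hk'
  refine fun σ hσ => unfold σ hσ fun N τ _ hτs => ?_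
  obtain ⟨k, -, hk⟩ := (sat_ex1 _ _ _).1 (hex ω ⟨hτs.1, hτs.2.1, hτs.2.2.1⟩).2.2
  exact body k τ hτs hk

/-- Arguments terminate from the stored states and hence from the actual ones, which differ only in
variables that are not accessed. Termination of the call on the stored results contains that of the
body from the actual start state. -/
theorem tvalid_meth {p q a : Asrt} {e₀ : Stmt} {m : MethName} {n : ℕ} {args : Fin n → Stmt}
    {P : Fin (n + 1) → Asrt} {v : Fin (n + 1) → ℕ} (hp₀ : e₀.Proper) (hp : ∀ i, (args i).Proper)
    (hv : Function.Injective v) (hva : ∀ i j, .var (.loc (v i)) ∉ (args j).vars)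
    (h₀ : ∀ N, PValid π K κ N ⟨p, e₀, tags, .and ((P 0).substVar (.loc (v 0)) .res) a⟩)
    (h₁ : ∀ N, ∀ i : Fin n, PValid π K κ N ⟨P i.castSucc, args i, tags,
      (P i.succ).substVar (.loc (v i.succ)) .res⟩)
    (t₀ : TValid π K κ ⟨p, e₀, tags, .and ((P 0).substVar (.loc (v 0)) .res) a⟩)
    (t₁ : ∀ i : Fin n, TValid π K κ ⟨P i.castSucc, args i, tags,
      (P i.succ).substVar (.loc (v i.succ)) .res⟩)
    (t₂ : TValid π K κ ⟨P (Fin.last n),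
      .call (.var (.loc (v 0))) m n (fun i => .var (.loc (v i.succ))), tags, q⟩) :
    TValid π K κ ⟨p, .call e₀ m n args, tags, q⟩ := by
  intro ht ω hκ σ₀ hσ₀
  refine .call (t₀ ht ω hκ σ₀ hσ₀) (fun N d σ i he₀ hd he => ?_) fun N d σ he₀ hd he => ?_
  · exact (t₁ i ht ω hκ _ (store_mem_states hv hva (h₀ N) (h₁ N) hκ hσ₀ he₀ i.castSucc
      fun j hj => he j (Fin.castSucc_lt_castSucc_iff.1 hj))).of_graft
      (Stmt.avoids_storeVars (hva · i) _)
  -- Depth `0` is enough because only variables are read.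
  · obtain ⟨σ', e₁, e₂, e₃, e₄, -⟩ := eval_stored hv hp₀ hp hσ₀.1 he₀ he hd 0
    cases t₂ ht ω hκ _ (store_mem_states hv hva (h₀ N) (h₁ N) hκ hσ₀ he₀ _ fun j _ => he j) with
    | call _ _ h =>
      rw [← e₄]
      exact h 0 d σ' e₁ e₂ e₃

theorem CallSpec.Dispatches.tm {c : CallSpec} (hc : c.Dispatches π) {ω : Env} {σ₀ : State}
    (hσ₀ : σ₀ ∈ c.p.states c.tags ω) (h : Tm π c.bodyBlock σ₀) : Tm π c.call σ₀ := by
  refine .call (Arg.tm _ _) (fun _ _ _ _ _ _ _ => Arg.tm _ _) fun N d σ he₀ hd he => ?_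
  rw [Arg.ev_ok he₀] at hd
  cases hc.method_eq hσ₀ hd
  rw [CallSpec.enter_eq he₀ he]
  cases h with
  | block h => exact h.setRes _ c.d.body_proper

/-- Strong induction on the value `d` of the bound, for all specifications at once. With `z` fixed
to `d`, the bounded assumptions only promise termination of calls with bounds below `d`, which is
the induction hypothesis. -/
theorem tvalid_recur {k : ℕ} (c : Fin k → CallSpec) {z z' : ℕ} (hzK : z ∉ K) (hz' : z' ≠ z)
    (hc : ∀ i, (c i).Dispatches π)
    (hz : ∀ i, .lvar .nat z ∉ (c i).p.free ∪ (c i).q.free ∧ .lvar .nat z' ∉ (c i).r.free)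
    (hr : ∀ i, Entails (c i).tags (c i).p (c i).tags (.ex1 .nat z (c i).r))
    (hb : ∀ d, (∀ j, TValid π (insert z K) (Function.update κ z d)
        ((c j).boundedAssumption z z')) →
      ∀ i, TValid π (insert z K) (Function.update κ z d)
        ⟨.and (c i).p (c i).r, (c i).bodyBlock, (c i).tags, (c i).q⟩) (i : Fin k) :
    TValid π K κ (c i).assumption := by
  have aux : ∀ d : ℕ, ∀ i, .terminates ∈ (c i).tags → ∀ ω : Env, ω.Fixes K κ →
      ∀ σ ∈ (c i).p.states (c i).tags ω, Sat σ (c i).tags (ω.setBase .nat z d) (c i).r →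
      Tm π (c i).call σ := by
    intro d
    induction d using Nat.strong_induction_on with
    | _ d ih =>
      intro i ht ω hκ σ hσ hd
      refine (hc i).tm hσ (hb d (fun j ht ω hκ σ hσ => ?_) i ht _ (hκ.insert hzK d) σ
        ⟨hσ.1, hσ.2.1.setBase z trivial,
          (sat_setBase hσ.1 hσ.2.1 (fun h => (hz i).1 (.inl h)) _).2 hσ.2.2, hd⟩)
      obtain ⟨hσ, hω, hp, hd⟩ := hσ
      obtain ⟨d', -, hd'⟩ := (sat_ex1 _ _ _).1 (hr j ω ⟨hσ, hω, hp⟩).2.2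
      have := (sat_decreases hσ hω hz' (hz j).2).1 hd ht d' hd'
      -- Because `z` is a constant here, it still has the value `d` in the environment of the inner
      -- call.
      rw [hκ z (.inl rfl), Function.update_self] at this
      exact ih d' this j ht ω (hκ.of_insert hzK) σ ⟨hσ, hω, hp⟩ hd'
  intro ht ω hκ σ hσ
  obtain ⟨d, -, hd⟩ := (sat_ex1 _ _ _).1 (hr i ω hσ).2.2
  exact aux d i ht ω hκ σ hσ hd

theorem TValid.insert {T : Triple} (h : TValid π K κ T) {z : ℕ} (hz : z ∉ K) (k : ℕ) :
    TValid π (insert z K) (Function.update κ z k) T :=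
  fun ht ω hω => h ht ω (hω.of_insert hz)

/-! ## Soundness -/

/-- Depth and valuation are quantified after the derivation, as REC uses the derivation of a body at
all smaller depths and with every value of the new constant. -/
theorem Derivable.pvalid (hπ : BoolCorrect π) {Γ : Set Triple} {T : Triple}
    (h : Derivable π K Γ T) : ∀ (κ : ℕ → ℕ) (N : ℕ), (∀ A ∈ Γ, PValid π K κ N A) →
      PValid π K κ N T := by
  induction h with
  | hyp h => exact fun κ N hΓ => hΓ _ h
  | var v p => exact fun κ N _ => pvalid_var v p
  | varTag v tags => exact fun κ N _ => pvalid_varTag v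
  | ivar x p => exact fun κ N _ => pvalid_ivar x p
  | ivarTag x tags => exact fun κ N _ => pvalid_ivarTag x
  | asgn u _ ih => exact fun κ N hΓ => pvalid_asgn u (ih κ N hΓ)
  | iasgn x _ ih => exact fun κ N hΓ => pvalid_iasgn x (ih κ N hΓ)
  | const tags p => exact fun κ N _ => pvalid_const p
  | seq _ _ ih₁ ih₂ => exact fun κ N hΓ => pvalid_seq (ih₁ κ N hΓ) (ih₂ κ N hΓ)
  | cond _ _ _ ih ih₁ ih₂ =>
    exact fun κ N hΓ => pvalid_cond (ih κ N hΓ) (ih₁ κ N hΓ) (ih₂ κ N hΓ)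
  | loop r z z' b _ _ _ _ _ hb _ _ _ _ ih₁ ih₂ _ =>
    exact fun κ N hΓ => pvalid_loop hb (ih₁ κ N hΓ) (ih₂ κ N hΓ)
  | cons hp _ hq ht ih => exact fun κ N hΓ => pvalid_cons hp (ih κ N hΓ) hq ht
  | block f _ hq ih => exact fun κ N hΓ => pvalid_block f (ih κ N hΓ) hq
  | passgn tags f g p h₁ h₂ => exact fun κ N _ => pvalid_passgn f g p h₁ h₂
  | meth P v Cs hp₀ hp hv hva hCs _ _ _ ih₀ ih₁ ih₂ =>
    exact fun κ N hΓ => pvalid_meth hp₀ hp hv hva hCs (ih₀ κ N hΓ) (fun i => ih₁ i κ N hΓ)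
      (ih₂ κ N hΓ)
  | recur c z z' hzK _ hc hz hr _ _ ih ihb =>
    intro κ N hΓ
    refine ih κ N ?_
    rintro A (hA | ⟨i, rfl⟩)
    · exact hΓ A hA
    · refine pvalid_recur c (z' := z') hzK hc (fun i => (hz i).1) hr (fun M hM d hj i => ?_) i
      refine ihb i _ M ?_
      rintro A (hA | ⟨j, rfl⟩)
      · exact ((hΓ A hA).mono hM.le).insert hzK d
      · exact hj j
  | equal tags v₀ v₁ => exact fun κ N _ => pvalid_equal hπ v₀ v₁
  | isA tags v C => exact fun κ N _ => pvalid_isA hπ v C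
  | cnst _ ih => exact fun κ N hΓ => pvalid_cnst (ih κ N hΓ)
  | new tags C p => exact fun κ N _ => pvalid_new C p
  | disj _ _ ih₁ ih₂ => exact fun κ N hΓ => pvalid_disj (ih₁ κ N hΓ) (ih₂ κ N hΓ)
  | conj _ _ ht₁ ht₂ ih₁ ih₂ =>
    exact fun κ N hΓ => pvalid_conj (ih₁ κ N hΓ) (ih₂ κ N hΓ) ht₁ ht₂
  | exInt t x hK hq _ ih => exact fun κ N hΓ => pvalid_exInt t x hK hq (ih κ N hΓ)
  | exIntSeq t k hq _ ih => exact fun κ N hΓ => pvalid_exIntSeq t k hq (ih κ N hΓ)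
  | inv p hp hn _ ih => exact fun κ N hΓ => pvalid_inv p hp hn (ih κ N hΓ)
  | subst θ hr hv hl hs _ ih =>
    exact fun κ N hΓ => pvalid_subst θ hr
      (fun v h => ⟨fun h' => (hv v h).1 (.inr h'), (hv v h).2⟩) hl hs (ih κ N hΓ)

/-- The assumptions must be partially valid at every depth, since a terminating subrun may have any
depth. For REC this is established first, independently of termination, and then serves for the
bounded assumptions as well. -/
theorem Derivable.tvalid (hπ : BoolCorrect π) {Γ : Set Triple} {T : Triple}
    (h : Derivable π K Γ T) : ∀ κ : ℕ → ℕ, (∀ A ∈ Γ, ∀ N, PValid π K κ N A) →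
      (∀ A ∈ Γ, TValid π K κ A) → TValid π K κ T := by
  induction h with
  | hyp h => exact fun κ _ hΓ => hΓ _ h
  | var | varTag => exact fun _ _ _ _ _ _ _ _ => .var
  | ivar | ivarTag => exact fun _ _ _ _ _ _ _ _ => .ivar
  | const => exact fun _ _ _ _ _ _ _ _ => .null
  | passgn => exact fun _ _ _ _ _ _ _ _ => .assign
  | new => exact fun _ _ _ _ _ _ _ _ => .alloc
  | asgn u _ ih => exact fun κ hP hT => tvalid_asgn u (ih κ hP hT)
  | iasgn x _ ih => exact fun κ hP hT => tvalid_iasgn x (ih κ hP hT)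
  | seq d₁ _ ih₁ ih₂ =>
    exact fun κ hP hT => tvalid_seq (fun N => d₁.pvalid hπ κ N fun A hA => hP A hA N)
      (ih₁ κ hP hT) (ih₂ κ hP hT)
  | cond d _ _ ih ih₁ ih₂ =>
    exact fun κ hP hT => tvalid_cond (fun N => d.pvalid hπ κ N fun A hA => hP A hA N)
      (ih κ hP hT) (ih₁ κ hP hT) (ih₂ κ hP hT)
  | loop r z z' b hzK _ hz hz' hr _ hex d₁ d₂ d₃ ih₁ ih₂ _ =>
    exact fun κ hP hT => tvalid_loop hzK hz hz' hr hex
      (fun N => d₁.pvalid hπ κ N fun A hA => hP A hA N)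
      (fun N => d₂.pvalid hπ κ N fun A hA => hP A hA N)
      (fun N => d₃.pvalid hπ κ N fun A hA => hP A hA N) (ih₁ κ hP hT) (ih₂ κ hP hT)
  | cons hp _ _ ht ih => exact fun κ hP hT => tvalid_cons hp (ih κ hP hT) ht
  | block f _ _ ih => exact fun κ hP hT => tvalid_block f (ih κ hP hT)
  | meth P v Cs hp₀ hp hv hva _ d₀ d₁ _ ih₀ ih₁ ih₂ =>
    exact fun κ hP hT => tvalid_meth hp₀ hp hv (fun i => (hva i).2)
      (fun N => d₀.pvalid hπ κ N fun A hA => hP A hA N)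
      (fun N i => (d₁ i).pvalid hπ κ N fun A hA => hP A hA N)
      (ih₀ κ hP hT) (fun i => ih₁ i κ hP hT) (ih₂ κ hP hT)
  | recur c z z' hzK hz' hc hz hr _ db ih ihb =>
    intro κ hP hT
    have hA : ∀ N i, PValid π _ κ N (c i).assumption := fun N => by
      refine pvalid_recur c (z' := z') hzK hc (fun i => (hz i).1) hr fun M _ d hj i => ?_
      refine (db i).pvalid hπ _ M ?_
      rintro A (hA | ⟨j, rfl⟩)
      · exact (hP A hA M).insert hzK d
      · exact hj j
    refine ih κ ?_ ?_
    · rintro A (h | ⟨i, rfl⟩) N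
      · exact hP A h N
      · exact hA N i
    · rintro A (h | ⟨i, rfl⟩)
      · exact hT A h
      · refine tvalid_recur c hzK hz' hc hz hr (fun d hj i => ihb i _ ?_ ?_) i
        · rintro A (h | ⟨j, rfl⟩) N
          · exact (hP A h N).insert hzK d
          · exact fun ω hω σ hσ => (hA N j).insert hzK d ω hω σ ⟨hσ.1, hσ.2.1, hσ.2.2.1⟩
        · rintro A (h | ⟨j, rfl⟩)
          · exact (hT A h).insert hzK d
          · exact hj j
  | equal tags v₀ v₁ => exact fun κ _ _ => tvalid_equal hπ v₀ v₁
  | isA tags v C => exact fun κ _ _ => tvalid_isA hπ v C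
  | cnst _ ih => exact fun κ hP hT => tvalid_cnst (ih κ hP hT)
  | disj _ _ ih₁ ih₂ => exact fun κ hP hT => tvalid_disj (ih₁ κ hP hT) (ih₂ κ hP hT)
  | conj _ _ ht₁ ht₂ ih₁ ih₂ =>
    exact fun κ hP hT => tvalid_conj (ih₁ κ hP hT) (ih₂ κ hP hT) ht₁ ht₂
  | exInt t x hK _ _ ih => exact fun κ hP hT => tvalid_exInt t x hK (ih κ hP hT)
  | exIntSeq t k _ _ ih => exact fun κ hP hT => tvalid_exIntSeq t k (ih κ hP hT)
  | inv p _ _ _ ih => exact fun κ hP hT => tvalid_inv p (ih κ hP hT)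
  | subst θ hr hv hl _ _ ih =>
    exact fun κ hP hT => tvalid_subst θ hr (fun v h h' => (hv v h).1 (.inr h'))
      (fun x h => (hl _ x h).1 rfl) (ih κ hP hT)

/-- Proper final states and errors are handled by `Derivable.pvalid` at the depth of the run,
divergence by `Derivable.tvalid`. Without constants any valuation is respected. -/
theorem Derivable.valid (hπ : BoolCorrect π) {T : Triple} (h : Derivable π ∅ ∅ T) :
    T.Valid π := by
  intro ω σ hσ x hx
  have hκ : ω.Fixes ∅ (ω.base .nat) := fun _ h => h.elim
  rcases mem_outcomes_iff.1 hx with ⟨⟨N, hx⟩, h'⟩ | ⟨-, ht, h'⟩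
  · have := h.pvalid hπ (ω.base .nat) N (fun _ h => h.elim) ω hκ σ hσ x hx
    rcases h' with ⟨τ, rfl⟩ | ⟨rfl, ht⟩ | ⟨rfl, ht⟩
    · exact ⟨τ, this, rfl⟩
    · exact absurd ht this
    · exact absurd ht this
  · exact absurd (h.tvalid hπ (ω.base .nat) (fun _ h => h.elim) (fun _ h => h.elim) ht ω hκ σ hσ) h'

end

end Dyn

theorem mainTheorem2 (π : Dyn.Program) (hπ : Dyn.BoolCorrect π) (T : Dyn.Triple)
    (hT : Dyn.Derivable π ∅ ∅ T) : T.Valid π :=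
  hT.valid hπ
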